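/- Let $\mathbb T=\mathbb R/\mathbb Z$, let $\|\cdot\|$ be the norm of the real space $L^2(\mathbb T)=L^2(0,1)$, and set $$\mathscr H_j=\Big\{q\in L^2(\mathbb T): q^{(j)}\in L^2(\mathbb T),\ \int_0^1 q\,dx=0\Big\},\quad \|q\|_j=\|q^{(j)}\|\quad (j=0,1,2,\dots),$$ with weak derivatives on the circle, and $\mathscr H_{-1}=\{f=g' : g\in\mathscr H_0\}$ (distributions on $\mathbb T$) with $\|f\|_{-1}=\|g\|$. Let $\alpha,\beta>0$ and $A\ge 0$ be constants and let $$P(q)=q'+\alpha q^2+u-c_0,\qquad u=Ae^{-\beta Q},\quad Q(x)=\int_0^x q(t)\,dt,\quad c_0=\int_0^1(\alpha q^2+u)\,dx .$$ A real analytic isomorphism between real Hilbert spaces is a bijection $f$ such that $f$ and $f^{-1}$ are real analytic. (i) For every $j\ge 1$, $P$ maps $\mathscr H_j$ into $\mathscr H_{j-1}$ and is a real analytic isomorphism between $\mathscr H_j$ and $\mathscr H_{j-1}$. For all $q\in\mathscr H_j$, $$\|q'\|^2\le\|P(q)\|^2\le\|q'\|^2+2\alpha^2\|q\|^3\|q'\|+C_*\|q\|^2e^{2\beta\|q\|},\qquad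 C_*=A(\beta+\alpha)(2+\beta A).$$ (ii) $P$ maps $\mathscr H_0$ into $\mathscr H_{-1}$ (with $q'$ taken in the sense of distributions), and $P:\mathscr H_0\to\mathscr H_{-1}$ is real analytic and injective. For all $q\in\mathscr H_0$, $$\|P(q)\|_{-1}\le\|q\|\big(3+2\alpha\|q\|+\beta Ae^{\beta\|q\|}\big);$$ in particular, for $\alpha=1$, $\|P(q)\|_{-1}\le\|q\|(3+2\|q\|+\beta Ae^{\beta\|q\|})$. If moreover $\alpha=1$ and $\beta=4$ (that is, $\alpha=1$ and $\beta=4/m$ with $m=1$), then $P:\mathscr H_0\to\mathscr H_{-1}$ is a real analytic isomorphism between $\mathscr H_0$ and $\mathscr H_{-1}$, and for all $q\in\mathscr H_0$, $$\|q\|^2\le 2\|P(q)\|_{-1}^2\big(1+2\|P(q)\|_{-1}^2\big).$$ -/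

import Mathlib

open MeasureTheory Set
open scoped ContDiff

namespace RiccatiTorus

noncomputable section

/-! ### Functions on the circle `𝕋 = ℝ / ℤ = [0, 1]` and weak derivatives -/

/-- Lebesgue measure on one period `(0, 1]`. -/
abbrev periodMeasure : Measure ℝ := volume.restrict (Ioc (0 : ℝ) 1)

/-- The real space `L²(𝕋) = L²(0, 1)`. -/
abbrev L2T : Type := Lp ℝ 2 periodMeasure

/-- Test functions on the circle: smooth real functions on `ℝ` of period `1`. -/
def TestFn : Submodule ℝ (ℝ → ℝ) where
  carrier := {φ | ContDiff ℝ ∞ φ ∧ Function.Periodic φ 1}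
  add_mem' := fun ha hb => ⟨ha.1.add hb.1, ha.2.add hb.2⟩
  zero_mem' := ⟨contDiff_const, fun _ => rfl⟩
  smul_mem' := fun c _ ha => ⟨contDiff_const.smul ha.1, fun x => by simp [ha.2 x]⟩

/-- `g` is the `j`-th weak derivative on the circle of `q`:
`∫₀¹ q φ⁽ʲ⁾ = (-1)ʲ ∫₀¹ g φ` for all test functions `φ`. -/
def IsWeakDeriv (j : ℕ) (q g : L2T) : Prop :=
  ∀ φ ∈ TestFn, ∫ x in (0 : ℝ)..1, q x * iteratedDeriv j φ x
    = (-1) ^ j * ∫ x in (0 : ℝ)..1, g x * φ x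

/-! ### Helper facts: integrability, uniqueness of weak derivatives -/

lemma TestFn.deriv_mem {φ : ℝ → ℝ} (h : φ ∈ TestFn) : deriv φ ∈ TestFn := by
  refine ⟨(contDiff_infty_iff_deriv.1 h.1).2, fun x => ?_⟩
  rw [← deriv_comp_add_const, funext h.2]

lemma TestFn.iteratedDeriv_mem {φ : ℝ → ℝ} (h : φ ∈ TestFn) (j : ℕ) :
    iteratedDeriv j φ ∈ TestFn := by
  induction j with
  | zero => simpa using h
  | succ j ih => rw [iteratedDeriv_succ]; exact TestFn.deriv_mem ih

lemma intervalIntegrable_L2T (q : L2T) : IntervalIntegrable q volume 0 1 := by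
  rw [intervalIntegrable_iff_integrableOn_Ioc_of_le zero_le_one]
  exact (Lp.memLp q).integrable (by norm_num)

lemma intervalIntegrable_mul (q : L2T) {φ : ℝ → ℝ} (h : Continuous φ) :
    IntervalIntegrable (fun x => q x * φ x) volume 0 1 :=
  (intervalIntegrable_L2T q).mul_continuousOn h.continuousOn

lemma integral_add_mul (q r : L2T) {φ : ℝ → ℝ} (h : Continuous φ) :
    ∫ x in (0 : ℝ)..1, (q + r : L2T) x * φ x
      = (∫ x in (0 : ℝ)..1, q x * φ x) + ∫ x in (0 : ℝ)..1, r x * φ x := by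
  rw [← intervalIntegral.integral_add (intervalIntegrable_mul q h) (intervalIntegrable_mul r h)]
  simp only [intervalIntegral.integral_of_le (zero_le_one' ℝ)]
  refine integral_congr_ae ?_
  filter_upwards [Lp.coeFn_add q r] with x hx
  rw [hx, Pi.add_apply, add_mul]

lemma integral_smul_mul (c : ℝ) (q : L2T) (φ : ℝ → ℝ) :
    ∫ x in (0 : ℝ)..1, (c • q : L2T) x * φ x = c * ∫ x in (0 : ℝ)..1, q x * φ x := by
  rw [← intervalIntegral.integral_const_mul]
  simp only [intervalIntegral.integral_of_le (zero_le_one' ℝ)]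
  refine integral_congr_ae ?_
  filter_upwards [Lp.coeFn_smul c q] with x hx
  rw [hx, Pi.smul_apply, smul_eq_mul, mul_assoc]

lemma integral_zero_mul (φ : ℝ → ℝ) : ∫ x in (0 : ℝ)..1, (0 : L2T) x * φ x = 0 := by
  simpa using integral_smul_mul 0 0 φ

lemma IsWeakDeriv.add {j : ℕ} {q r g h : L2T} (hq : IsWeakDeriv j q g)
    (hr : IsWeakDeriv j r h) : IsWeakDeriv j (q + r) (g + h) := by
  intro φ hφ
  rw [integral_add_mul q r (TestFn.iteratedDeriv_mem hφ j).1.continuous,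
    integral_add_mul g h hφ.1.continuous, hq φ hφ, hr φ hφ, mul_add]

lemma IsWeakDeriv.smul {j : ℕ} {q g : L2T} (c : ℝ) (hq : IsWeakDeriv j q g) :
    IsWeakDeriv j (c • q) (c • g) := by
  intro φ hφ
  rw [integral_smul_mul, integral_smul_mul, hq φ hφ, mul_left_comm]

lemma isWeakDeriv_zero (j : ℕ) : IsWeakDeriv j 0 0 := by
  intro φ _
  rw [integral_zero_mul, integral_zero_mul, mul_zero]

/-- Test functions separate the points of `L²(𝕋)`. -/
lemma eq_zero_of_forall_integral (f : L2T)
    (h : ∀ φ ∈ TestFn, ∫ x in (0 : ℝ)..1, f x * φ x = 0) : f = 0 := by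
  have hc (n : ℤ) : ∫ x in (0 : ℝ)..1, f x * Real.cos (2 * Real.pi * n * x) = 0 := by
    apply h (fun x => Real.cos (2 * Real.pi * n * x))
    refine ⟨by fun_prop, fun x => ?_⟩
    simp only
    rw [← Real.cos_add_int_mul_two_pi (2 * Real.pi * n * x) n]
    congr 1; ring
  have hs (n : ℤ) : ∫ x in (0 : ℝ)..1, f x * Real.sin (2 * Real.pi * n * x) = 0 := by
    apply h (fun x => Real.sin (2 * Real.pi * n * x))
    refine ⟨by fun_prop, fun x => ?_⟩
    simp only
    rw [← Real.sin_add_int_mul_two_pi (2 * Real.pi * n * x) n]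
    congr 1; ring
  have hL2 : MemLp (fun x => (f x : ℂ)) 2 (volume.restrict (Ioc (0 : ℝ) 1)) :=
    (Lp.memLp f).ofReal
  have hF := hasSum_sq_fourierCoeffOn zero_lt_one hL2
  have hi (φ : ℝ → ℝ) (hφ : Continuous φ) :
      IntervalIntegrable (fun x => ((f x * φ x : ℝ) : ℂ)) volume 0 1 := by
    have := intervalIntegrable_mul f hφ
    rw [intervalIntegrable_iff] at this ⊢
    exact this.ofReal
  have h0 (n : ℤ) : fourierCoeffOn zero_lt_one (fun x => (f x : ℂ)) n = 0 := by
    rw [fourierCoeffOn_eq_integral]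
    have e : ∀ x : ℝ, fourier (-n) (x : AddCircle ((1 : ℝ) - 0)) • (f x : ℂ)
        = ((f x * Real.cos (2 * Real.pi * n * x) : ℝ) : ℂ)
          - ((f x * Real.sin (2 * Real.pi * n * x) : ℝ) : ℂ) * Complex.I := by
      intro x
      rw [fourier_coe_apply]
      have : (2 * Real.pi * Complex.I * ((-n : ℤ) : ℂ) * x / (((1 : ℝ) - 0 : ℝ) : ℂ))
          = ((-(2 * Real.pi * n * x) : ℝ) : ℂ) * Complex.I := by
        push_cast; ring
      rw [this, Complex.exp_mul_I, ← Complex.ofReal_cos, ← Complex.ofReal_sin, Real.cos_neg,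
        Real.sin_neg, smul_eq_mul]
      push_cast; ring
    simp only [e]
    rw [intervalIntegral.integral_sub, intervalIntegral.integral_mul_const,
      intervalIntegral.integral_ofReal, intervalIntegral.integral_ofReal, hc, hs]
    · simp
    · exact hi _ (by fun_prop)
    · exact (hi _ (by fun_prop)).mul_const _
  simp only [h0, norm_zero, ne_eq, OfNat.ofNat_ne_zero, not_false_eq_true, zero_pow] at hF
  have hz := hF.unique hasSum_zero
  simp only [sub_zero, inv_one, one_smul, Complex.norm_real,
    intervalIntegral.integral_of_le (zero_le_one' ℝ), Real.norm_eq_abs, sq_abs] at hz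
  rw [integral_eq_zero_iff_of_nonneg (fun x => sq_nonneg _) (Lp.memLp f).integrable_sq] at hz
  rw [Lp.eq_zero_iff_ae_eq_zero]
  filter_upwards [hz] with x hx
  simpa using hx

lemma IsWeakDeriv.unique {j : ℕ} {q g h : L2T} (hg : IsWeakDeriv j q g)
    (hh : IsWeakDeriv j q h) : g = h := by
  have hd : IsWeakDeriv j 0 (g + (-1 : ℝ) • h) := by
    simpa using hg.add (hh.smul (-1))
  have : g + (-1 : ℝ) • h = 0 := by
    refine eq_zero_of_forall_integral _ fun φ hφ => ?_
    have := hd φ hφ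
    rw [integral_zero_mul] at this
    simpa using this.symm
  simpa [add_neg_eq_zero] using this

/-- A test function of mean zero is the derivative of a test function of mean zero. -/
lemma exists_primitive {ψ : ℝ → ℝ} (hψ : ψ ∈ TestFn) (h0 : ∫ x in (0 : ℝ)..1, ψ x = 0) :
    ∃ φ ∈ TestFn, deriv φ = ψ ∧ ∫ x in (0 : ℝ)..1, φ x = 0 := by
  have hcont := hψ.1.continuous
  set F : ℝ → ℝ := fun x => ∫ t in (0 : ℝ)..x, ψ t with hF
  set c := ∫ x in (0 : ℝ)..1, F x
  have hd (x : ℝ) : HasDerivAt F (ψ x) x := hcont.integral_hasStrictDerivAt 0 x |>.hasDerivAt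
  have hFc : Continuous F := continuous_iff_continuousAt.2 fun x => (hd x).continuousAt
  have hder : deriv (fun x => F x - c) = ψ := by
    funext x
    exact ((hd x).sub_const c).deriv
  refine ⟨fun x => F x - c, ⟨?_, fun x => ?_⟩, hder, ?_⟩
  · rw [contDiff_infty_iff_deriv, hder]
    exact ⟨fun x => ((hd x).sub_const c).differentiableAt, hψ.1⟩
  · have : F (x + 1) = F x := by
      have := intervalIntegral.integral_add_adjacent_intervals
        (hcont.intervalIntegrable (μ := volume) 0 x) (hcont.intervalIntegrable x (x + 1))
      rw [hψ.2.intervalIntegral_add_eq x 0, zero_add, h0, add_zero] at this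
      exact this.symm
    simp only [this]
  · rw [intervalIntegral.integral_sub (hFc.intervalIntegrable _ _) (by simp)]
    simp [c]

lemma exists_iterated_primitive (j : ℕ) {ψ : ℝ → ℝ} (hψ : ψ ∈ TestFn)
    (h0 : ∫ x in (0 : ℝ)..1, ψ x = 0) :
    ∃ φ ∈ TestFn, iteratedDeriv j φ = ψ := by
  induction j generalizing ψ with
  | zero => exact ⟨ψ, hψ, by simp⟩
  | succ j ih =>
    obtain ⟨φ, hφ, hd, hm⟩ := exists_primitive hψ h0
    obtain ⟨χ, hχ, hj⟩ := ih hφ hm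
    exact ⟨χ, hχ, by rw [iteratedDeriv_succ, hj, hd]⟩

/-- A mean-zero function whose `j`-th weak derivative vanishes is zero. -/
lemma IsWeakDeriv.eq_zero {j : ℕ} {q : L2T} (h : IsWeakDeriv j q 0)
    (hm : ∫ x in (0 : ℝ)..1, q x = 0) : q = 0 := by
  refine eq_zero_of_forall_integral q fun ψ hψ => ?_
  set c := ∫ x in (0 : ℝ)..1, ψ x
  have hmem : (fun x => ψ x - c) ∈ TestFn :=
    ⟨hψ.1.sub contDiff_const, fun x => by simp [hψ.2 x]⟩
  have h0 : ∫ x in (0 : ℝ)..1, (ψ x - c) = 0 := by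
    rw [intervalIntegral.integral_sub (hψ.1.continuous.intervalIntegrable _ _) (by simp)]
    simp [c]
  obtain ⟨φ, hφ, hj⟩ := exists_iterated_primitive j hmem h0
  have := h φ hφ
  rw [integral_zero_mul, mul_zero, hj] at this
  simp only [mul_sub] at this
  rw [intervalIntegral.integral_sub (intervalIntegrable_mul q hψ.1.continuous)
    ((intervalIntegrable_L2T q).mul_const c), intervalIntegral.integral_mul_const, hm] at this
  simpa using this

/-! ### The spaces `ℋ_j`, `j ≥ 0` -/

/-- The underlying vector space of `ℋ_j`, `j ≥ 0`: the `q ∈ L²(𝕋)` with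
`q⁽ʲ⁾ ∈ L²(𝕋)` and `∫₀¹ q = 0`. -/
def sobolev (j : ℕ) : Submodule ℝ L2T where
  carrier := {q | (∃ g, IsWeakDeriv j q g) ∧ ∫ x in (0 : ℝ)..1, q x = 0}
  add_mem' := by
    rintro q r ⟨⟨g, hg⟩, hq⟩ ⟨⟨h, hh⟩, hr⟩
    refine ⟨⟨g + h, hg.add hh⟩, ?_⟩
    simpa [hq, hr] using integral_add_mul q r (continuous_const (y := (1 : ℝ)))
  zero_mem' := ⟨⟨0, isWeakDeriv_zero j⟩, by simpa using integral_zero_mul fun _ => 1⟩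
  smul_mem' := by
    rintro c q ⟨⟨g, hg⟩, hq⟩
    refine ⟨⟨c • g, hg.smul c⟩, ?_⟩
    simpa [hq] using integral_smul_mul c q fun _ => 1

/-- The space `ℋ_j`, `j ≥ 0`. Its norm is `‖q‖_j = ‖q⁽ʲ⁾‖_{L²}`, see below. -/
def Sob (j : ℕ) : Type := sobolev j

instance (j : ℕ) : AddCommGroup (Sob j) := inferInstanceAs (AddCommGroup (sobolev j))

instance (j : ℕ) : Module ℝ (Sob j) := inferInstanceAs (Module ℝ (sobolev j))

/-- The inclusion `ℋ_j ⊂ L²(𝕋)`. -/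
def Sob.toL2 {j : ℕ} : Sob j →ₗ[ℝ] L2T := (sobolev j).subtype

lemma Sob.toL2_injective {j : ℕ} : Function.Injective (Sob.toL2 : Sob j → L2T) :=
  Subtype.val_injective

lemma Sob.exists_weakDeriv {j : ℕ} (q : Sob j) : ∃ g, IsWeakDeriv j q.toL2 g := q.2.1

lemma Sob.integral_eq_zero {j : ℕ} (q : Sob j) : ∫ x in (0 : ℝ)..1, q.toL2 x = 0 := q.2.2

/-- The top derivative `q ↦ q⁽ʲ⁾`, from `ℋ_j` to `L²(𝕋)`. -/
def Sob.topDeriv {j : ℕ} : Sob j →ₗ[ℝ] L2T where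
  toFun q := q.exists_weakDeriv.choose
  map_add' q r := by
    refine (q + r).exists_weakDeriv.choose_spec.unique ?_
    rw [map_add]
    exact q.exists_weakDeriv.choose_spec.add r.exists_weakDeriv.choose_spec
  map_smul' c q := by
    refine (c • q).exists_weakDeriv.choose_spec.unique ?_
    rw [map_smul]
    exact q.exists_weakDeriv.choose_spec.smul c

lemma Sob.topDeriv_spec {j : ℕ} (q : Sob j) : IsWeakDeriv j q.toL2 q.topDeriv :=
  q.exists_weakDeriv.choose_spec

lemma Sob.topDeriv_injective {j : ℕ} : Function.Injective (Sob.topDeriv : Sob j → L2T) := by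
  rw [injective_iff_map_eq_zero]
  intro q hq
  have h := q.topDeriv_spec
  rw [hq] at h
  exact Sob.toL2_injective (by rw [h.eq_zero q.integral_eq_zero, map_zero])

/-- The norm `‖q‖_j = ‖q⁽ʲ⁾‖` of `ℋ_j`. -/
instance (j : ℕ) : NormedAddCommGroup (Sob j) :=
  NormedAddCommGroup.induced (Sob j) L2T Sob.topDeriv Sob.topDeriv_injective

lemma Sob.norm_def {j : ℕ} (q : Sob j) : ‖q‖ = ‖q.topDeriv‖ := rfl

/-- The inner product `(q⁽ʲ⁾, r⁽ʲ⁾)` of `ℋ_j`. -/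
instance (j : ℕ) : InnerProductSpace ℝ (Sob j) where
  norm_smul_le c q := by simp [Sob.norm_def, norm_smul]
  inner q r := inner ℝ q.topDeriv r.topDeriv
  norm_sq_eq_re_inner q := by simp [Sob.norm_def]
  conj_inner_symm q r := by simp [real_inner_comm]
  add_left q r s := by simp [inner_add_left]
  smul_left q r c := by simp [inner_smul_left]

/-! ### The space `ℋ₋₁` -/

/-- The distributional derivative `g ↦ g'` on the circle, `⟨g', φ⟩ = -∫₀¹ g φ'`. -/
def distribDeriv : Sob 0 →ₗ[ℝ] Module.Dual ℝ TestFn :=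
  LinearMap.mk₂ ℝ (fun (g : Sob 0) (φ : TestFn) =>
      -∫ x in (0 : ℝ)..1, g.toL2 x * deriv (φ : ℝ → ℝ) x)
    (fun g h φ => by
      rw [map_add, integral_add_mul _ _ (TestFn.deriv_mem φ.2).1.continuous, neg_add])
    (fun c g φ => by rw [map_smul, integral_smul_mul, smul_eq_mul, mul_neg])
    (fun g φ ψ => by
      rw [← neg_add, ← intervalIntegral.integral_add
        (intervalIntegrable_mul _ (TestFn.deriv_mem φ.2).1.continuous)
        (intervalIntegrable_mul _ (TestFn.deriv_mem ψ.2).1.continuous)]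
      congr 2
      funext x
      rw [← mul_add, Submodule.coe_add, deriv_add (φ.2.1.differentiable (by simp) x)
        (ψ.2.1.differentiable (by simp) x)])
    (fun c g φ => by
      rw [smul_eq_mul, mul_neg, ← intervalIntegral.integral_const_mul]
      congr 2
      funext x
      rw [Submodule.coe_smul, deriv_const_smul c (φ.2.1.differentiable (by simp) x),
        smul_eq_mul, mul_left_comm])

lemma distribDeriv_injective : Function.Injective distribDeriv := by
  rw [injective_iff_map_eq_zero]
  intro g hg
  have h : IsWeakDeriv 1 g.toL2 0 := by
    intro φ hφ
    have := LinearMap.congr_fun hg ⟨φ, hφ⟩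
    rw [integral_zero_mul, mul_zero, iteratedDeriv_one]
    simpa [distribDeriv] using this
  exact Sob.toL2_injective (by rw [h.eq_zero g.integral_eq_zero, map_zero])

/-- The space `ℋ₋₁ = {g' : g ∈ ℋ₀}` of distributions on the circle. Its norm is
`‖g'‖₋₁ = ‖g‖`, see below. -/
def SobNeg : Type := LinearMap.range distribDeriv

instance : AddCommGroup SobNeg := inferInstanceAs (AddCommGroup (LinearMap.range distribDeriv))

instance : Module ℝ SobNeg := inferInstanceAs (Module ℝ (LinearMap.range distribDeriv))

/-- An element of `ℋ₋₁` as a distribution. -/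
def SobNeg.toDistrib : SobNeg →ₗ[ℝ] Module.Dual ℝ TestFn :=
  (LinearMap.range distribDeriv).subtype

/-- The map `g' ↦ g`, from `ℋ₋₁` to `ℋ₀`. -/
def SobNeg.primitive : SobNeg ≃ₗ[ℝ] Sob 0 :=
  (LinearEquiv.ofInjective distribDeriv distribDeriv_injective).symm

lemma SobNeg.distribDeriv_primitive (f : SobNeg) : distribDeriv f.primitive = f.toDistrib :=
  congrArg Subtype.val
    ((LinearEquiv.ofInjective distribDeriv distribDeriv_injective).apply_symm_apply f)

/-- The norm `‖g'‖₋₁ = ‖g‖` of `ℋ₋₁`. -/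
instance : NormedAddCommGroup SobNeg :=
  NormedAddCommGroup.induced SobNeg (Sob 0) SobNeg.primitive.toLinearMap
    SobNeg.primitive.injective

lemma SobNeg.norm_def (f : SobNeg) : ‖f‖ = ‖f.primitive‖ := rfl

/-- The inner product `(g', h')₋₁ = (g, h)` of `ℋ₋₁`. -/
instance : InnerProductSpace ℝ SobNeg where
  norm_smul_le c f := by simp [SobNeg.norm_def, norm_smul]
  inner f h := inner ℝ f.primitive h.primitive
  norm_sq_eq_re_inner f := by simp [SobNeg.norm_def]
  conj_inner_symm f h := by simp [real_inner_comm]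
  add_left f h k := by simp [inner_add_left]
  smul_left f h c := by simp [inner_smul_left]

/-! ### The perturbed Riccati map -/

/-- `Q(x) = ∫₀ˣ q(t) dt`. -/
def primQ (q : L2T) (x : ℝ) : ℝ := ∫ t in (0 : ℝ)..x, q t

/-- `α q² + u`, where `u = A e^{-β Q}`. -/
def lowerTerm (α β A : ℝ) (q : L2T) (x : ℝ) : ℝ :=
  α * q x ^ 2 + A * Real.exp (-β * primQ q x)

/-- `c₀ = ∫₀¹ (α q² + u) dx`. -/
def meanTerm (α β A : ℝ) (q : L2T) : ℝ := ∫ x in (0 : ℝ)..1, lowerTerm α β A q x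

/-- `P : ℋ_{j+1} → ℋ_j` is the map `P(q) = q' + α q² + u - c₀`: every `q ∈ ℋ_{j+1}` has a weak
derivative `q' ∈ L²(𝕋)` and the formula holds almost everywhere. -/
def IsRiccatiMap (α β A : ℝ) {j : ℕ} (P : Sob (j + 1) → Sob j) : Prop :=
  ∀ q : Sob (j + 1), ∃ dq : L2T, IsWeakDeriv 1 q.toL2 dq ∧
    ∀ᵐ x ∂periodMeasure,
      (P q).toL2 x = dq x + lowerTerm α β A q.toL2 x - meanTerm α β A q.toL2

/-- `P : ℋ₀ → ℋ₋₁` is the map `P(q) = q' + α q² + u - c₀`, in the sense of distributions. -/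
def IsSingularRiccatiMap (α β A : ℝ) (P : Sob 0 → SobNeg) : Prop :=
  ∀ (q : Sob 0) (φ : TestFn),
    (P q).toDistrib φ = -(∫ x in (0 : ℝ)..1, q.toL2 x * deriv (φ : ℝ → ℝ) x)
      + ∫ x in (0 : ℝ)..1,
          (lowerTerm α β A q.toL2 x - meanTerm α β A q.toL2) * (φ : ℝ → ℝ) x

/-- A real analytic isomorphism: a real analytic bijection with real analytic inverse. -/
def IsRealAnalyticIso {E F : Type*} [NormedAddCommGroup E] [NormedSpace ℝ E]
    [NormedAddCommGroup F] [NormedSpace ℝ F] (f : E → F) : Prop :=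
  AnalyticOnNhd ℝ f univ ∧ ∃ g : F → E,
    Function.LeftInverse g f ∧ Function.RightInverse g f ∧ AnalyticOnNhd ℝ g univ

end

end RiccatiTorus

open RiccatiTorus

namespace RiccatiTorus

noncomputable section

open Filter Topology
open scoped ENNReal BoundedContinuousFunction

/-! ### Products and primitives -/

/-! Let D⁻¹ be the operator sending f to the mean-zero periodic primitive of f - ∫f. Then P(q) is
the derivative of F(q) = q + D⁻¹(αq² + u), which is `riccati`, and everything reduces to F on L².
The product maps L² × L² to L¹, the primitive maps L¹ to bounded continuous functions, and the
exponential is analytic in that Banach algebra, so F is analytic. Moreover D⁻¹ : L¹ → L² is compact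
(`isCompactOperator_invDeriv`), so F is the identity plus a compact perturbation.

Injectivity. The difference r of two functions with the same image satisfies r' + p r + z = const,
with p = α(q₁ + q₂) and z = u₁ - u₂. Since e^{-βQ} decreases in Q, z has the sign opposite to that
of y = ∫₀ˣ r, and a maximum principle for y forces r = 0 (`eq_zero_of_add_invDeriv_eq_zero`). The
kernel equation of the derivative of F has the same shape, so by the Fredholm alternative the
derivative is invertible. The inverse function theorem then makes the range of F open and the
inverse analytic on it.

Surjectivity is the continuity method (`mem_range_riccati_of_bound`): the set of t for which tp is
attained is open, and it is closed as soon as the solutions are bounded, by compactness of D⁻¹. Two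
bounds are used. If p has a weak derivative in L², the identity ‖P(q)‖² = ‖q'‖² + 2β∫uq² + ‖αq² + u
- c₀‖² gives ‖q'‖ ≤ ‖P(q)‖ (`norm_sq_riccati_bounds`). If p is only in L² and α = 1, testing the
equation with e^{2Q} and using Chebyshev's inequality for u and e^{2Q} bounds ‖q‖ by ‖p‖
(`norm_sq_le_of_riccati`).

For ℋ_j with j ≥ 1 there remains regularity: if F(q) has k weak derivatives, so has q. It is proved
for families depending analytically on a parameter (`AnalyticSobolev.of_riccati`), so that the
analytic inverse on L² becomes an analytic map ℋ_j → ℋ_{j+1}. For ℋ₋₁, differentiation is an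
isometry from ℋ₀, and P is F followed by it. -/

instance : IsProbabilityMeasure periodMeasure := ⟨by simp [periodMeasure]⟩

/-- The space `L¹(0, 1)`. -/
abbrev L1T : Type := Lp ℝ 1 periodMeasure

/-- A bounded continuous function as an element of `L¹(0, 1)`. -/
def toL1 : (ℝ →ᵇ ℝ) →L[ℝ] L1T := BoundedContinuousFunction.toLp 1 periodMeasure ℝ

/-- A bounded continuous function as an element of `L²(0, 1)`. -/
def toL2 : (ℝ →ᵇ ℝ) →L[ℝ] L2T := BoundedContinuousFunction.toLp 2 periodMeasure ℝ

lemma coeFn_toL1 (g : ℝ →ᵇ ℝ) : toL1 g =ᵐ[periodMeasure] g :=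
  BoundedContinuousFunction.coeFn_toLp _ _ _ _

lemma coeFn_toL2 (g : ℝ →ᵇ ℝ) : toL2 g =ᵐ[periodMeasure] g :=
  BoundedContinuousFunction.coeFn_toLp _ _ _ _

lemma denseRange_toL1 : DenseRange toL1 :=
  BoundedContinuousFunction.toLp_denseRange ℝ periodMeasure ℝ (by simp)

/-- The product `L²(0, 1) × L²(0, 1) → L¹(0, 1)`. -/
def mulL2 : L2T →L[ℝ] L2T →L[ℝ] L1T :=
  (ContinuousLinearMap.mul ℝ ℝ).holderL periodMeasure 2 2 1

lemma coeFn_mulL2 (f g : L2T) : mulL2 f g =ᵐ[periodMeasure] fun x => f x * g x :=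
  (ContinuousLinearMap.mul ℝ ℝ).coeFn_holder f g

lemma mulL2_comm (f g : L2T) : mulL2 f g = mulL2 g f := by
  refine Lp.ext ?_
  filter_upwards [coeFn_mulL2 f g, coeFn_mulL2 g f] with x h1 h2
  rw [h1, h2, mul_comm]

lemma norm_mulL2_le (f g : L2T) : ‖mulL2 f g‖ ≤ ‖f‖ * ‖g‖ := by
  refine ((ContinuousLinearMap.mul ℝ ℝ).norm_holder_apply_apply_le f g).trans ?_
  simp

/-- Multiplication of integrable functions by bounded continuous ones. -/
def mulBL1 : (ℝ →ᵇ ℝ) →L[ℝ] L1T →L[ℝ] L1T :=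
  ((ContinuousLinearMap.mul ℝ ℝ).holderL periodMeasure ∞ 1 1).comp
    (BoundedContinuousFunction.toLp ∞ periodMeasure ℝ)

lemma coeFn_mulBL1 (g : ℝ →ᵇ ℝ) (f : L1T) :
    mulBL1 g f =ᵐ[periodMeasure] fun x => g x * f x := by
  filter_upwards [(ContinuousLinearMap.mul ℝ ℝ).coeFn_holder (r := 1)
    (BoundedContinuousFunction.toLp ∞ periodMeasure ℝ g) f,
    BoundedContinuousFunction.coeFn_toLp ∞ periodMeasure ℝ g] with x h1 h2
  rw [← h2]
  exact h1

/-- Multiplication of square integrable functions by bounded continuous ones. -/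
def mulBL2 : (ℝ →ᵇ ℝ) →L[ℝ] L2T →L[ℝ] L2T :=
  ((ContinuousLinearMap.mul ℝ ℝ).holderL periodMeasure ∞ 2 2).comp
    (BoundedContinuousFunction.toLp ∞ periodMeasure ℝ)

lemma coeFn_mulBL2 (g : ℝ →ᵇ ℝ) (f : L2T) :
    mulBL2 g f =ᵐ[periodMeasure] fun x => g x * f x := by
  filter_upwards [(ContinuousLinearMap.mul ℝ ℝ).coeFn_holder (r := 2)
    (BoundedContinuousFunction.toLp ∞ periodMeasure ℝ g) f,
    BoundedContinuousFunction.coeFn_toLp ∞ periodMeasure ℝ g] with x h1 h2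
  rw [← h2]
  exact h1

/-- The inclusion `L²(0, 1) ⊂ L¹(0, 1)`. -/
def inclL1 : L2T →L[ℝ] L1T := mulL2 (toL2 1)

lemma coeFn_inclL1 (f : L2T) : inclL1 f =ᵐ[periodMeasure] f := by
  filter_upwards [coeFn_mulL2 (toL2 1) f, coeFn_toL2 1] with x h1 h2
  rw [inclL1, h1, h2]
  simp

lemma ae_Icc : ∀ᵐ x ∂periodMeasure, x ∈ Icc (0 : ℝ) 1 := by
  filter_upwards [ae_restrict_mem measurableSet_Ioc] with x hx using Ioc_subset_Icc_self hx

lemma integral_congr_period {f g : ℝ → ℝ} (h : f =ᵐ[periodMeasure] g) {x : ℝ}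
    (hx : x ∈ Icc (0 : ℝ) 1) : ∫ t in (0 : ℝ)..x, f t = ∫ t in (0 : ℝ)..x, g t := by
  rw [intervalIntegral.integral_of_le hx.1, intervalIntegral.integral_of_le hx.1]
  refine integral_congr_ae (ae_mono (Measure.restrict_mono ?_ le_rfl) h)
  exact Ioc_subset_Ioc_right hx.2

lemma integral_Iic_eq (f : ℝ → ℝ) {x : ℝ} (hx : x ∈ Icc (0 : ℝ) 1) :
    ∫ t in Iic x, f t ∂periodMeasure = ∫ t in (0 : ℝ)..x, f t := by
  rw [intervalIntegral.integral_of_le hx.1, periodMeasure,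
    Measure.restrict_restrict measurableSet_Iic]
  congr 2
  ext t
  simp only [mem_inter_iff, mem_Iic, mem_Ioc]
  constructor
  · rintro ⟨h1, h2, h3⟩; exact ⟨h2, h1⟩
  · rintro ⟨h1, h2⟩; exact ⟨h2, h1, h2.trans hx.2⟩

lemma integrable_L1T (f : L1T) : Integrable f periodMeasure :=
  memLp_one_iff_integrable.1 (Lp.memLp f)

lemma continuous_integral_Iic (f : L1T) :
    Continuous fun x => ∫ t in Iic x, f t ∂periodMeasure := by
  have h := (integrable_L1T f)
  have h2 : (fun x => ∫ t in Iic x, f t ∂periodMeasure)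
      = fun x => (∫ t in Iic (0 : ℝ), f t ∂periodMeasure) + ∫ t in (0 : ℝ)..x, f t ∂periodMeasure := by
    funext x
    rw [← intervalIntegral.integral_Iic_sub_Iic h.integrableOn h.integrableOn]
    ring
  rw [h2]
  exact continuous_const.add
    (intervalIntegral.continuous_primitive (fun a b => h.intervalIntegrable) 0)

lemma norm_setIntegral_L1T_le (f : L1T) (s : Set ℝ) :
    ‖∫ t in s, f t ∂periodMeasure‖ ≤ ‖f‖ := by
  rw [L1.norm_eq_integral_norm]
  exact (norm_integral_le_integral_norm _).trans
    (setIntegral_le_integral (integrable_L1T f).norm (Eventually.of_forall fun _ => norm_nonneg _))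

/-- The primitive `x ↦ ∫₀ˣ f` of an integrable function on `(0, 1)`. -/
def primitive : L1T →L[ℝ] (ℝ →ᵇ ℝ) :=
  LinearMap.mkContinuous
    { toFun := fun f => BoundedContinuousFunction.ofNormedAddCommGroup
        -- Integrating the restricted measure over `Iic x` makes the primitive constant outside [0,
        -- 1], hence bounded on the whole line, so it lives in the Banach algebra where `expB` is
        -- defined.
        (fun x => ∫ t in Iic x, f t ∂periodMeasure) (continuous_integral_Iic f) ‖f‖
        (fun x => norm_setIntegral_L1T_le f (Iic x))
      map_add' := fun f g => by
        ext x
        simp only [BoundedContinuousFunction.coe_ofNormedAddCommGroup,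
          BoundedContinuousFunction.coe_add, Pi.add_apply]
        rw [← integral_add (integrable_L1T f).integrableOn (integrable_L1T g).integrableOn]
        refine integral_congr_ae (ae_restrict_of_ae ?_)
        filter_upwards [Lp.coeFn_add f g] with t ht using ht
      map_smul' := fun c f => by
        ext x
        simp only [BoundedContinuousFunction.coe_ofNormedAddCommGroup, RingHom.id_apply,
          BoundedContinuousFunction.coe_smul]
        rw [← integral_smul]
        refine integral_congr_ae (ae_restrict_of_ae ?_)
        filter_upwards [Lp.coeFn_smul c f] with t ht using ht } 1
    (fun f => by
      rw [one_mul]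
      exact BoundedContinuousFunction.norm_ofNormedAddCommGroup_le _ (norm_nonneg _)
        (fun x => norm_setIntegral_L1T_le f (Iic x)))

lemma primitive_apply (f : L1T) {x : ℝ} (hx : x ∈ Icc (0 : ℝ) 1) :
    primitive f x = ∫ t in (0 : ℝ)..x, f t :=
  integral_Iic_eq _ hx

lemma primitive_of_ae {f : L1T} {g : ℝ → ℝ} (h : f =ᵐ[periodMeasure] g) {x : ℝ}
    (hx : x ∈ Icc (0 : ℝ) 1) : primitive f x = ∫ t in (0 : ℝ)..x, g t := by
  rw [primitive_apply f hx, integral_congr_period h hx]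

lemma primitive_zero_right (f : L1T) : primitive f 0 = 0 := by
  rw [primitive_apply f (by simp)]; simp

lemma primitive_one (f : L1T) : primitive f 1 = ∫ t in (0 : ℝ)..1, f t :=
  primitive_apply f (by simp)

lemma primitive_one_of_ae {f : L1T} {g : ℝ → ℝ} (h : f =ᵐ[periodMeasure] g) :
    primitive f 1 = ∫ t in (0 : ℝ)..1, g t := primitive_of_ae h (by simp)

lemma abs_primitive_le (f : L1T) (x : ℝ) : |primitive f x| ≤ ‖f‖ :=
  norm_setIntegral_L1T_le f (Iic x)

lemma primitive_toL1 (g : ℝ →ᵇ ℝ) {x : ℝ} (hx : x ∈ Icc (0 : ℝ) 1) :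
    primitive (toL1 g) x = ∫ t in (0 : ℝ)..x, g t := primitive_of_ae (coeFn_toL1 g) hx

lemma primitive_toL1_one {x : ℝ} (hx : x ∈ Icc (0 : ℝ) 1) : primitive (toL1 1) x = x := by
  rw [primitive_toL1 _ hx]; simp

lemma continuous_eval (x : ℝ) : Continuous fun g : ℝ →ᵇ ℝ => g x :=
  (BoundedContinuousFunction.evalCLM ℝ x).continuous

lemma hasDerivAt_integral (a : ℝ →ᵇ ℝ) (t : ℝ) :
    HasDerivAt (fun x => ∫ s in (0 : ℝ)..x, a s) (a t) t :=
  (a.continuous.integral_hasStrictDerivAt 0 t).hasDerivAt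

/-- The product rule for absolutely continuous functions. -/
lemma primitive_mul_primitive (a b : L1T) {x : ℝ} (hx : x ∈ Icc (0 : ℝ) 1) :
    primitive a x * primitive b x
      = primitive (mulBL1 (primitive a) b + mulBL1 (primitive b) a) x := by
  -- Both sides are continuous in (a, b) for the L¹ norm, so continuous a and b suffice, where the
  -- classical product rule applies.
  refine denseRange_toL1.induction_on₂ (p := fun a b => primitive a x * primitive b x
      = primitive (mulBL1 (primitive a) b + mulBL1 (primitive b) a) x) ?_ ?_ a b
  · refine isClosed_eq ?_ ?_
    · exact ((continuous_eval x).comp (primitive.continuous.comp continuous_fst)).mul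
        ((continuous_eval x).comp (primitive.continuous.comp continuous_snd))
    · refine (continuous_eval x).comp (primitive.continuous.comp ?_)
      fun_prop
  · intro a b
    have hae : (mulBL1 (primitive (toL1 a)) (toL1 b) + mulBL1 (primitive (toL1 b)) (toL1 a) : L1T)
        =ᵐ[periodMeasure] fun t => a t * (∫ s in (0 : ℝ)..t, b s) + (∫ s in (0 : ℝ)..t, a s) * b t := by
      filter_upwards [Lp.coeFn_add (mulBL1 (primitive (toL1 a)) (toL1 b))
        (mulBL1 (primitive (toL1 b)) (toL1 a)), coeFn_mulBL1 (primitive (toL1 a)) (toL1 b),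
        coeFn_mulBL1 (primitive (toL1 b)) (toL1 a), coeFn_toL1 a, coeFn_toL1 b, ae_Icc]
        with t h1 h2 h3 h4 h5 ht
      rw [h1, Pi.add_apply, h2, h3, h4, h5, primitive_toL1 _ ht, primitive_toL1 _ ht]
      ring
    rw [primitive_of_ae hae hx, primitive_toL1 _ hx, primitive_toL1 _ hx,
      intervalIntegral.integral_deriv_mul_eq_sub (fun t _ => hasDerivAt_integral a t)
        (fun t _ => hasDerivAt_integral b t) (a.continuous.intervalIntegrable _ _)
        (b.continuous.intervalIntegrable _ _)]
    simp

/-- The exponential in the Banach algebra of bounded continuous functions. -/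
def expB (g : ℝ →ᵇ ℝ) : ℝ →ᵇ ℝ := NormedSpace.exp g

/-- Evaluation at a point is a continuous ring homomorphism, so it commutes with the exponential
series. -/
lemma expB_apply (g : ℝ →ᵇ ℝ) (x : ℝ) : expB g x = Real.exp (g x) := by
  let ev : (ℝ →ᵇ ℝ) →+* ℝ :=
    { toFun := fun g => g x, map_one' := rfl, map_mul' := fun _ _ => rfl, map_zero' := rfl,
      map_add' := fun _ _ => rfl }
  let _ : NormedAlgebra ℚ (ℝ →ᵇ ℝ) := NormedAlgebra.restrictScalars ℚ ℝ (ℝ →ᵇ ℝ)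
  have := NormedSpace.map_exp ev (continuous_eval x) g
  rw [Real.exp_eq_exp_ℝ]
  exact this

lemma analyticAt_expB (g : ℝ →ᵇ ℝ) : AnalyticAt ℝ expB g := NormedSpace.exp_analytic g

lemma continuous_expB : Continuous expB :=
  continuous_iff_continuousAt.2 fun g => (analyticAt_expB g).continuousAt

lemma hasFDerivAt_expB (g : ℝ →ᵇ ℝ) :
    HasFDerivAt expB (expB g • (1 : (ℝ →ᵇ ℝ) →L[ℝ] (ℝ →ᵇ ℝ))) g := hasFDerivAt_exp

/-- The chain rule for the exponential of an absolutely continuous function. -/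
lemma exp_primitive (a : L1T) {x : ℝ} (hx : x ∈ Icc (0 : ℝ) 1) :
    Real.exp (primitive a x) = 1 + primitive (mulBL1 (expB (primitive a)) a) x := by
  refine denseRange_toL1.induction_on (p := fun a => Real.exp (primitive a x)
      = 1 + primitive (mulBL1 (expB (primitive a)) a) x) a ?_ ?_
  · refine isClosed_eq ?_ ?_
    · exact Real.continuous_exp.comp ((continuous_eval x).comp primitive.continuous)
    · refine continuous_const.add ((continuous_eval x).comp (primitive.continuous.comp ?_))
      exact (mulBL1.continuous.comp (continuous_expB.comp primitive.continuous)).clm_apply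
        continuous_id
  · intro a
    have hae : mulBL1 (expB (primitive (toL1 a))) (toL1 a) =ᵐ[periodMeasure]
        fun t => Real.exp (∫ s in (0 : ℝ)..t, a s) * a t := by
      filter_upwards [coeFn_mulBL1 (expB (primitive (toL1 a))) (toL1 a), coeFn_toL1 a, ae_Icc]
        with t h1 h2 ht
      rw [h1, h2, expB_apply, primitive_toL1 _ ht]
    rw [primitive_of_ae hae hx, primitive_toL1 _ hx,
      intervalIntegral.integral_eq_sub_of_hasDerivAt
        (f := fun t => Real.exp (∫ s in (0 : ℝ)..t, a s))
        (fun t _ => (hasDerivAt_integral a t).exp)]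
    · simp
    · refine Continuous.intervalIntegrable ?_ _ _
      exact (Real.continuous_exp.comp (continuous_iff_continuousAt.2 fun t =>
        (hasDerivAt_integral a t).continuousAt)).mul a.continuous

/-! ### Absolutely continuous representatives and weak derivatives -/

lemma integral_one_of_ae {f : L2T} {g : ℝ → ℝ} (h : f =ᵐ[periodMeasure] g) :
    ∫ x in (0 : ℝ)..1, f x = ∫ x in (0 : ℝ)..1, g x := integral_congr_period h (by simp)

lemma primitive_inclL1_one (g : L2T) : primitive (inclL1 g) 1 = ∫ x in (0 : ℝ)..1, g x :=
  primitive_one_of_ae (coeFn_inclL1 g)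

/-- A smooth periodic function, as a bounded continuous function. -/
lemma TestFn.exists_bcf {φ : ℝ → ℝ} (hφ : φ ∈ TestFn) : ∃ g : ℝ →ᵇ ℝ, ⇑g = φ := by
  obtain ⟨C, hC⟩ := (isCompact_Icc (a := (0 : ℝ)) (b := 1)).exists_bound_of_continuousOn
    hφ.1.continuous.continuousOn
  refine ⟨BoundedContinuousFunction.ofNormedAddCommGroup φ hφ.1.continuous C fun x => ?_, rfl⟩
  obtain ⟨y, hy, hxy⟩ := hφ.2.exists_mem_Ico₀ one_pos x
  rw [hxy]
  exact hC y (Ico_subset_Icc_self hy)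

/-- Integration by parts against a smooth periodic function. -/
lemma integral_primitive_mul_deriv (f : L1T) {φ : ℝ → ℝ} (hφ : φ ∈ TestFn) :
    ∫ x in (0 : ℝ)..1, primitive f x * deriv φ x
      = φ 1 * primitive f 1 - ∫ x in (0 : ℝ)..1, f x * φ x := by
  obtain ⟨ψ, hψ⟩ := TestFn.exists_bcf (TestFn.deriv_mem hφ)
  have hd (x : ℝ) : HasDerivAt φ (deriv φ x) x := (hφ.1.differentiable (by simp) x).hasDerivAt
  have hprim {x : ℝ} (hx : x ∈ Icc (0 : ℝ) 1) : primitive (toL1 ψ) x = φ x - φ 0 := by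
    rw [primitive_toL1 _ hx, hψ]
    exact intervalIntegral.integral_deriv_eq_sub (fun x _ => (hd x).differentiableAt)
      ((TestFn.deriv_mem hφ).1.continuous.intervalIntegrable _ _)
  have h := primitive_mul_primitive f (toL1 ψ) (x := 1) (by simp)
  have hae : (mulBL1 (primitive f) (toL1 ψ) + mulBL1 (primitive (toL1 ψ)) f : L1T)
      =ᵐ[periodMeasure] fun x => primitive f x * deriv φ x + (f x * φ x - f x * φ 0) := by
    filter_upwards [Lp.coeFn_add (mulBL1 (primitive f) (toL1 ψ)) (mulBL1 (primitive (toL1 ψ)) f),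
      coeFn_mulBL1 (primitive f) (toL1 ψ), coeFn_mulBL1 (primitive (toL1 ψ)) f, coeFn_toL1 ψ,
      ae_Icc] with x h1 h2 h3 h4 hx
    rw [h1, Pi.add_apply, h2, h3, h4, hprim hx, hψ]
    ring
  have hf : IntervalIntegrable f volume 0 1 := by
    rw [intervalIntegrable_iff_integrableOn_Ioc_of_le zero_le_one]
    exact integrable_L1T f
  have hfφ : IntervalIntegrable (fun x => f x * φ x) volume 0 1 :=
    hf.mul_continuousOn hφ.1.continuous.continuousOn
  have hfd : IntervalIntegrable (fun x => primitive f x * deriv φ x) volume 0 1 :=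
    ((primitive f).continuous.mul (TestFn.deriv_mem hφ).1.continuous).intervalIntegrable _ _
  rw [primitive_one_of_ae hae, hprim (by simp), intervalIntegral.integral_add hfd
    (hfφ.sub (hf.mul_const _)), intervalIntegral.integral_sub hfφ (hf.mul_const _),
    intervalIntegral.integral_mul_const, ← primitive_one] at h
  linarith

/-- A square integrable function on the circle has the weak derivative `g` if and only if it is,
up to a constant, the primitive of the mean-zero function `g`. -/
lemma isWeakDeriv_one_iff (q g : L2T) :
    IsWeakDeriv 1 q g ↔ ∫ x in (0 : ℝ)..1, g x = 0 ∧
      ∃ c : ℝ, q =ᵐ[periodMeasure] fun x => c + primitive (inclL1 g) x := by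
  -- The periodicity of φ and the vanishing mean of g cancel the constant and the boundary term in
  -- the integration by parts. The converse subtracts the primitive and uses that a mean-zero
  -- function with zero weak derivative vanishes.
  have key (g : L2T) (hg : ∫ x in (0 : ℝ)..1, g x = 0) (q : L2T) (c : ℝ)
      (hq : q =ᵐ[periodMeasure] fun x => c + primitive (inclL1 g) x) : IsWeakDeriv 1 q g := by
    intro φ hφ
    have hc := (TestFn.deriv_mem hφ).1.continuous
    have h1 : ∫ x in (0 : ℝ)..1, q x * iteratedDeriv 1 φ x
        = ∫ x in (0 : ℝ)..1, (c * deriv φ x + primitive (inclL1 g) x * deriv φ x) := by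
      refine integral_congr_period ?_ (by simp)
      filter_upwards [hq] with x hx
      rw [hx, iteratedDeriv_one]; ring
    have h2 : ∫ x in (0 : ℝ)..1, inclL1 g x * φ x = ∫ x in (0 : ℝ)..1, g x * φ x := by
      refine integral_congr_period ?_ (by simp)
      filter_upwards [coeFn_inclL1 g] with x hx
      rw [hx]
    have h3 : ∫ x in (0 : ℝ)..1, deriv φ x = 0 := by
      rw [intervalIntegral.integral_deriv_eq_sub
        (fun x _ => hφ.1.differentiable (by simp) x) (hc.intervalIntegrable _ _)]
      have := hφ.2 0
      rw [zero_add] at this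
      rw [this, sub_self]
    have h4 : IntervalIntegrable (fun x => primitive (inclL1 g) x * deriv φ x) volume 0 1 :=
      ((primitive (inclL1 g)).continuous.mul hc).intervalIntegrable _ _
    rw [h1, intervalIntegral.integral_add ((hc.intervalIntegrable _ _).const_mul _) h4,
      intervalIntegral.integral_const_mul, integral_primitive_mul_deriv _ hφ,
      primitive_inclL1_one, hg, h2, h3]
    ring
  constructor
  · intro h
    have hg : ∫ x in (0 : ℝ)..1, g x = 0 := by
      have := h (fun _ => 1) ⟨contDiff_const, fun _ => rfl⟩
      simpa using this.symm
    refine ⟨hg, ?_⟩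
    set c : ℝ := ∫ x in (0 : ℝ)..1, (q - toL2 (primitive (inclL1 g)) : L2T) x
    refine ⟨c, ?_⟩
    set r : L2T := toL2 (BoundedContinuousFunction.const ℝ c + primitive (inclL1 g))
    have hr : r =ᵐ[periodMeasure] fun x => c + primitive (inclL1 g) x := by
      filter_upwards [coeFn_toL2 (BoundedContinuousFunction.const ℝ c + primitive (inclL1 g))]
        with x hx
      exact hx
    have hd : IsWeakDeriv 1 (q - r) 0 := by
      have := h.add ((key g hg r c hr).smul (-1))
      simpa [sub_eq_add_neg] using this
    have hm : ∫ x in (0 : ℝ)..1, (q - r : L2T) x = 0 := by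
      have : (q - r : L2T) =ᵐ[periodMeasure]
          fun x => (q - toL2 (primitive (inclL1 g)) : L2T) x - c := by
        filter_upwards [Lp.coeFn_sub q r, Lp.coeFn_sub q (toL2 (primitive (inclL1 g))), hr,
          coeFn_toL2 (primitive (inclL1 g))] with x h1 h2 h3 h4
        rw [h1, h2, Pi.sub_apply, Pi.sub_apply, h3, h4]
        ring
      rw [integral_one_of_ae this, intervalIntegral.integral_sub (intervalIntegrable_L2T _)
        (by simp)]
      simp [c]
    have := hd.eq_zero hm
    rw [sub_eq_zero] at this
    rw [this]
    exact hr
  · rintro ⟨hg, c, hq⟩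
    exact key g hg q c hq

/-! ### The mean-zero primitive and its compactness -/

lemma inner_L2T (q r : L2T) : inner ℝ q r = ∫ x in (0 : ℝ)..1, q x * r x := by
  rw [L2.inner_def, intervalIntegral.integral_of_le zero_le_one]
  refine integral_congr_ae (Eventually.of_forall fun x => ?_)
  simp [mul_comm]

lemma norm_sq_L2T (q : L2T) : ‖q‖ ^ 2 = ∫ x in (0 : ℝ)..1, q x ^ 2 := by
  rw [← real_inner_self_eq_norm_sq, inner_L2T]
  simp only [pow_two]

lemma norm_sq_of_ae {q : L2T} {g : ℝ → ℝ} (h : q =ᵐ[periodMeasure] g) :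
    ‖q‖ ^ 2 = ∫ x in (0 : ℝ)..1, g x ^ 2 := by
  rw [norm_sq_L2T]
  refine integral_congr_period ?_ (by simp)
  filter_upwards [h] with x hx
  rw [hx]

lemma norm_L1T (f : L1T) : ‖f‖ = ∫ x in (0 : ℝ)..1, |f x| := by
  rw [L1.norm_eq_integral_norm, intervalIntegral.integral_of_le zero_le_one]
  rfl

lemma intervalIntegrable_L1T (f : L1T) : IntervalIntegrable f volume 0 1 := by
  rw [intervalIntegrable_iff_integrableOn_Ioc_of_le zero_le_one]
  exact integrable_L1T f

lemma IntervalIntegrable.mono_period {f : ℝ → ℝ} (h : IntervalIntegrable f volume 0 1) {x y : ℝ}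
    (hx : x ∈ Icc (0 : ℝ) 1) (hy : y ∈ Icc (0 : ℝ) 1) : IntervalIntegrable f volume x y := by
  refine h.mono_set ?_
  rw [uIcc_of_le zero_le_one]
  exact uIcc_subset_Icc hx hy

lemma primitive_sub_primitive (f : L1T) {x y : ℝ} (hx : x ∈ Icc (0 : ℝ) 1)
    (hy : y ∈ Icc (0 : ℝ) 1) : primitive f y - primitive f x = ∫ t in x..y, f t := by
  rw [primitive_apply f hx, primitive_apply f hy]
  exact intervalIntegral.integral_interval_sub_left
    ((intervalIntegrable_L1T f).mono_period (by simp) hy)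
    ((intervalIntegrable_L1T f).mono_period (by simp) hx)

/-- Approximation of the primitive by step functions with `n` steps. -/
def stepPrimitive (n : ℕ) : L1T →L[ℝ] L2T :=
  ∑ k ∈ Finset.range n,
    ((BoundedContinuousFunction.evalCLM ℝ ((k : ℝ) / n)).comp primitive).smulRight
      (indicatorConstLp 2 (μ := periodMeasure)
        (measurableSet_Ioc (a := (k : ℝ) / n) (b := ((k + 1 : ℕ) : ℝ) / n))
        (measure_ne_top _ _) (1 : ℝ))

lemma isCompactOperator_smulRight {E F : Type*} [NormedAddCommGroup E] [NormedSpace ℝ E]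
    [NormedAddCommGroup F] [NormedSpace ℝ F] (l : E →L[ℝ] ℝ) (v : F) :
    IsCompactOperator (l.smulRight v) := by
  have : (l.smulRight v : E → F) = (ContinuousLinearMap.toSpanSingleton ℝ v) ∘ l := by
    ext x; simp
  rw [this]
  exact (isCompactOperator_of_locallyCompactSpace_dom l).clm_comp
    (ContinuousLinearMap.toSpanSingleton ℝ v)

lemma isCompactOperator_stepPrimitive (n : ℕ) : IsCompactOperator (stepPrimitive n) := by
  have : stepPrimitive n ∈ compactOperator (RingHom.id ℝ) L1T L2T :=
    Submodule.sum_mem _ fun k _ => isCompactOperator_smulRight _ _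
  exact this

lemma coeFn_stepPrimitive (n : ℕ) (f : L1T) : stepPrimitive n f =ᵐ[periodMeasure]
    fun x => ∑ k ∈ Finset.range n, primitive f ((k : ℝ) / n) *
      (Ioc ((k : ℝ) / n) (((k + 1 : ℕ) : ℝ) / n)).indicator (fun _ => (1 : ℝ)) x := by
  rw [stepPrimitive, sum_apply]
  refine (Lp.coeFn_finsetSum _ _).trans ?_
  have (k : ℕ) := (Lp.coeFn_smul (primitive f ((k : ℝ) / n))
      (indicatorConstLp 2 (μ := periodMeasure)
        (measurableSet_Ioc (a := (k : ℝ) / n) (b := ((k + 1 : ℕ) : ℝ) / n))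
        (measure_ne_top _ _) (1 : ℝ))).and (indicatorConstLp_coeFn (p := 2) (μ := periodMeasure)
        (hs := measurableSet_Ioc (a := (k : ℝ) / n) (b := ((k + 1 : ℕ) : ℝ) / n))
        (hμs := measure_ne_top _ _) (c := (1 : ℝ)))
  filter_upwards [ae_all_iff.2 this] with x hx
  rw [Finset.sum_apply]
  refine Finset.sum_congr rfl fun k _ => ?_
  rw [← (hx k).2]
  exact (hx k).1

/-- On each interval of length 1/n the error is at most the variation A of the primitive there, so
it contributes at most A²/n ≤ ‖f‖A/n, and the variations add up to ‖f‖. Finite-rank operators thus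
approximate the primitive at rate n^{-1/2} in operator norm. -/
lemma norm_sub_stepPrimitive_le {n : ℕ} (hn : 0 < n) (f : L1T) :
    ‖toL2 (primitive f) - stepPrimitive n f‖ ^ 2 ≤ ‖f‖ ^ 2 / n := by
  have hn' : (0 : ℝ) < n := by exact_mod_cast hn
  set e : L2T := toL2 (primitive f) - stepPrimitive n f
  set a : ℕ → ℝ := fun k => (k : ℝ) / n with ha
  have hmono {k l : ℕ} (h : k ≤ l) : a k ≤ a l := by
    simp only [ha]; gcongr
  have hmem {k : ℕ} (hk : k ≤ n) : a k ∈ Icc (0 : ℝ) 1 := by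
    refine ⟨by positivity, ?_⟩
    simp only [ha]
    rw [div_le_one hn']
    exact_mod_cast hk
  have he : ∀ k < n, ∀ᵐ x ∂periodMeasure, x ∈ Ioc (a k) (a (k + 1)) →
      e x = primitive f x - primitive f (a k) := by
    intro k hk
    filter_upwards [Lp.coeFn_sub (toL2 (primitive f)) (stepPrimitive n f),
      coeFn_toL2 (primitive f), coeFn_stepPrimitive n f] with x h1 h2 h3 hx
    rw [h1, Pi.sub_apply, h2, h3]
    congr 1
    rw [Finset.sum_eq_single k]
    · rw [indicator_of_mem hx, mul_one]
    · intro l _ hl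
      rw [indicator_of_notMem, mul_zero]
      rintro ⟨hx1, hx2⟩
      rcases lt_or_gt_of_ne hl with h | h
      · exact absurd (hx2.trans (hmono (Nat.succ_le_of_lt h))) (not_le.2 hx.1)
      · exact absurd (hx.2.trans (hmono (Nat.succ_le_of_lt h))) (not_le.2 hx1)
    · intro h
      exact absurd (Finset.mem_range.2 hk) h
  have hint : IntervalIntegrable (fun x => e x ^ 2) volume 0 1 := by
    rw [intervalIntegrable_iff_integrableOn_Ioc_of_le zero_le_one]
    exact (Lp.memLp e).integrable_sq
  have hfi : IntervalIntegrable (fun x => |f x|) volume 0 1 := (intervalIntegrable_L1T f).abs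
  have hstep : ∀ k < n, ∫ x in a k..a (k + 1), e x ^ 2
      ≤ ‖f‖ / n * ∫ x in a k..a (k + 1), |f x| := by
    intro k hk
    have hk0 := hmem hk.le
    have hk1 := hmem (Nat.succ_le_of_lt hk)
    have hle := hmono k.le_succ
    set A := ∫ x in a k..a (k + 1), |f x|
    have hA0 : 0 ≤ A := intervalIntegral.integral_nonneg hle fun _ _ => abs_nonneg _
    have hAf : A ≤ ‖f‖ := by
      rw [norm_L1T]
      exact intervalIntegral.integral_mono_interval hk0.1 hle hk1.2
        (Eventually.of_forall fun _ => abs_nonneg _) hfi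
    have hb : ∫ x in a k..a (k + 1), e x ^ 2 ≤ ∫ x in a k..a (k + 1), A ^ 2 := by
      have hsub : Ioc (a k) (a (k + 1)) ⊆ Ioc 0 1 := Ioc_subset_Ioc hk0.1 hk1.2
      rw [intervalIntegral.integral_of_le hle, intervalIntegral.integral_of_le hle]
      refine setIntegral_mono_ae_restrict (hint.mono_period hk0 hk1).1
        (intervalIntegrable_const (μ := volume) (a := a k) (b := a (k + 1))).1 ?_
      filter_upwards [ae_mono (Measure.restrict_mono hsub le_rfl) (he k hk),
        ae_restrict_mem measurableSet_Ioc] with x hx hxm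
      have hx1 : x ∈ Icc (0 : ℝ) 1 := Ioc_subset_Icc_self (hsub hxm)
      rw [hx hxm, primitive_sub_primitive f hk0 hx1, sq_le_sq, abs_of_nonneg hA0]
      refine (intervalIntegral.abs_integral_le_integral_abs hxm.1.le).trans ?_
      exact intervalIntegral.integral_mono_interval le_rfl hxm.1.le hxm.2
        (Eventually.of_forall fun _ => abs_nonneg _) (hfi.mono_period hk0 hk1)
    refine hb.trans ?_
    have : a (k + 1) - a k = 1 / n := by simp only [ha]; push_cast; ring
    rw [intervalIntegral.integral_const, this, smul_eq_mul, pow_two]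
    calc 1 / (n : ℝ) * (A * A) ≤ 1 / n * (‖f‖ * A) := by gcongr
      _ = ‖f‖ / n * A := by ring
  have h0 : a 0 = 0 := by simp [ha]
  have h1 : a n = 1 := by simp [ha, hn'.ne']
  have hsum {g : ℝ → ℝ} (hg : IntervalIntegrable g volume 0 1) :
      ∑ k ∈ Finset.range n, ∫ x in a k..a (k + 1), g x = ∫ x in (0 : ℝ)..1, g x := by
    rw [intervalIntegral.sum_integral_adjacent_intervals, h0, h1]
    exact fun k hk => hg.mono_period (hmem hk.le) (hmem hk)
  calc ‖e‖ ^ 2 = ∑ k ∈ Finset.range n, ∫ x in a k..a (k + 1), e x ^ 2 := by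
        rw [hsum hint, norm_sq_L2T]
    _ ≤ ∑ k ∈ Finset.range n, ‖f‖ / n * ∫ x in a k..a (k + 1), |f x| :=
        Finset.sum_le_sum fun k hk => hstep k (Finset.mem_range.1 hk)
    _ = ‖f‖ ^ 2 / n := by
        rw [← Finset.mul_sum, hsum hfi, ← norm_L1T]; ring

/-- The primitive is a compact operator from `L¹(0, 1)` to `L²(0, 1)`. -/
lemma isCompactOperator_toL2_primitive : IsCompactOperator (toL2.comp primitive) := by
  refine isCompactOperator_of_tendsto (l := atTop) (F := stepPrimitive) ?_
    (Eventually.of_forall isCompactOperator_stepPrimitive)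
  rw [tendsto_iff_norm_sub_tendsto_zero]
  have hlim : Tendsto (fun n : ℕ => Real.sqrt (1 / (n : ℝ))) atTop (𝓝 0) := by
    have := (Real.continuous_sqrt.tendsto 0).comp (tendsto_one_div_atTop_nhds_zero_nat (𝕜 := ℝ))
    rwa [Real.sqrt_zero] at this
  refine squeeze_zero' (Eventually.of_forall fun _ => norm_nonneg _) ?_ hlim
  filter_upwards [eventually_gt_atTop 0] with n hn
  refine ContinuousLinearMap.opNorm_le_bound _ (Real.sqrt_nonneg _) fun f => ?_
  have := norm_sub_stepPrimitive_le hn f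
  rw [sub_apply, norm_sub_rev]
  refine le_of_sq_le_sq ?_ (by positivity)
  rw [mul_pow, Real.sq_sqrt (by positivity)]
  calc _ ≤ _ := this
    _ = _ := by ring

/-- The mean value of an integrable function. -/
def meanL1 : L1T →L[ℝ] ℝ := (BoundedContinuousFunction.evalCLM ℝ 1).comp primitive

lemma meanL1_apply (f : L1T) : meanL1 f = ∫ x in (0 : ℝ)..1, f x := primitive_one f

lemma meanL1_eq_primitive (f : L1T) : meanL1 f = primitive f 1 := rfl

lemma meanL1_of_ae {f : L1T} {g : ℝ → ℝ} (h : f =ᵐ[periodMeasure] g) :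
    meanL1 f = ∫ x in (0 : ℝ)..1, g x := primitive_one_of_ae h

lemma abs_meanL1_le (f : L1T) : |meanL1 f| ≤ ‖f‖ := abs_primitive_le f 1

lemma meanL1_one : meanL1 (toL1 1) = 1 := primitive_toL1_one (by simp)

/-- Subtraction of the mean value. -/
def center : L1T →L[ℝ] L1T := ContinuousLinearMap.id ℝ L1T - meanL1.smulRight (toL1 1)

lemma center_apply (f : L1T) : center f = f - meanL1 f • toL1 1 := rfl

lemma coeFn_center (f : L1T) : center f =ᵐ[periodMeasure] fun x => f x - meanL1 f := by
  filter_upwards [Lp.coeFn_sub f (meanL1 f • toL1 1), Lp.coeFn_smul (meanL1 f) (toL1 1),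
    coeFn_toL1 1] with x h1 h2 h3
  rw [center_apply, h1, Pi.sub_apply, h2, Pi.smul_apply, h3]
  simp

lemma meanL1_center (f : L1T) : meanL1 (center f) = 0 := by
  rw [center_apply, map_sub, map_smul, meanL1_one]; simp

/-- The periodic mean-zero primitive of `f - ∫₀¹ f`, as a bounded continuous function. -/
def periodicPrimitive : L1T →L[ℝ] (ℝ →ᵇ ℝ) :=
  primitive.comp center
    - ((meanL1.comp (toL1.comp (primitive.comp center))).smulRight (1 : ℝ →ᵇ ℝ))

lemma periodicPrimitive_apply (f : L1T) (x : ℝ) : periodicPrimitive f x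
    = primitive (center f) x - meanL1 (toL1 (primitive (center f))) := by
  simp [periodicPrimitive]

/-- The periodic mean-zero primitive of `f - ∫₀¹ f`, as an operator from `L¹` to `L²`. -/
def invDeriv : L1T →L[ℝ] L2T := toL2.comp periodicPrimitive

lemma coeFn_invDeriv (f : L1T) : invDeriv f =ᵐ[periodMeasure] periodicPrimitive f :=
  coeFn_toL2 _

lemma isCompactOperator_invDeriv : IsCompactOperator invDeriv := by
  have h1 := isCompactOperator_toL2_primitive.comp_clm center
  have h2 := isCompactOperator_smulRight
    (meanL1.comp (toL1.comp (primitive.comp center))) (toL2 1)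
  have : (invDeriv : L1T → L2T) = (toL2.comp primitive) ∘ center
      - (meanL1.comp (toL1.comp (primitive.comp center))).smulRight (toL2 1) := by
    ext1 f
    simp [invDeriv, periodicPrimitive]
  rw [this]
  exact h1.sub h2

lemma integral_invDeriv (f : L1T) : ∫ x in (0 : ℝ)..1, invDeriv f x = 0 := by
  have h : invDeriv f =ᵐ[periodMeasure]
      fun x => primitive (center f) x - meanL1 (toL1 (primitive (center f))) := by
    filter_upwards [coeFn_invDeriv f] with x hx
    rw [hx, periodicPrimitive_apply]
  rw [integral_one_of_ae h, intervalIntegral.integral_sub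
    ((primitive (center f)).continuous.intervalIntegrable _ _) (by simp),
    meanL1_of_ae (coeFn_toL1 _)]
  simp

lemma center_inclL1 {g : L2T} (hg : ∫ x in (0 : ℝ)..1, g x = 0) :
    center (inclL1 g) = inclL1 g := by
  rw [center_apply, meanL1_of_ae (coeFn_inclL1 g), hg, zero_smul, sub_zero]

/-- The mean-zero primitive inverts the weak derivative. -/
lemma isWeakDeriv_invDeriv {g : L2T} (hg : ∫ x in (0 : ℝ)..1, g x = 0) :
    IsWeakDeriv 1 (invDeriv (inclL1 g)) g := by
  rw [isWeakDeriv_one_iff]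
  refine ⟨hg, - meanL1 (toL1 (primitive (center (inclL1 g)))), ?_⟩
  filter_upwards [coeFn_invDeriv (inclL1 g)] with x hx
  rw [hx, periodicPrimitive_apply, center_inclL1 hg]
  ring

/-! ### A maximum principle -/

lemma exists_pos_right {g : ℝ → ℝ} (hg : Continuous g) (h0 : 0 < g 0) :
    ∃ δ > 0, δ ≤ 1 ∧ ∀ x ∈ Icc (0 : ℝ) δ, 0 < g x := by
  obtain ⟨ε, hε, h⟩ := Metric.eventually_nhds_iff.1 ((hg.tendsto 0).eventually (lt_mem_nhds h0))
  refine ⟨min (ε / 2) 1, by positivity, min_le_right _ _, fun x hx => h ?_⟩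
  rw [Real.dist_eq, sub_zero, abs_of_nonneg hx.1]
  linarith [hx.2.trans (min_le_left _ _)]

section MaximumPrinciple

variable {ρ E z : ℝ → ℝ} {m c : ℝ}

/-- The hypothesis `heq` is the integrated form of (Eρ)' = E(m - z). Let y be the primitive of ρ and
suppose it has a positive maximum at x₀, so that ρ(x₀) = 0. To the right of x₀, as long as y > 0, z
≤ 0 makes Eρ nondecreasing, so ρ ≥ 0 and y cannot decrease. But y must return to 0 at 1. -/
lemma integral_nonpos_of_oscillation (hρ : Continuous ρ) (hE : Continuous E) (hz : Continuous z)
    (hE0 : ∀ x, 0 < E x) (h1 : ∫ t in (0 : ℝ)..1, ρ t = 0)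
    (heq : ∀ x ∈ Icc (0 : ℝ) 1, E x * ρ x = c + ∫ t in (0 : ℝ)..x, E t * (m - z t))
    (hzy : ∀ x ∈ Icc (0 : ℝ) 1, z x * (∫ t in (0 : ℝ)..x, ρ t) ≤ 0) (hm : 0 ≤ m)
    {x : ℝ} (hx : x ∈ Icc (0 : ℝ) 1) : ∫ t in (0 : ℝ)..x, ρ t ≤ 0 := by
  set y : ℝ → ℝ := fun x => ∫ t in (0 : ℝ)..x, ρ t with hy
  have hyd (x : ℝ) : HasDerivAt y (ρ x) x := (hρ.integral_hasStrictDerivAt 0 x).hasDerivAt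
  have hyc : Continuous y := continuous_iff_continuousAt.2 fun x => (hyd x).continuousAt
  have hy0 : y 0 = 0 := by simp [hy]
  by_contra! hpos
  obtain ⟨x₀, hx₀, hmax⟩ := isCompact_Icc.exists_isMaxOn (nonempty_Icc.2 zero_le_one)
    hyc.continuousOn
  have hyx₀ : 0 < y x₀ := hpos.trans_le (hmax hx)
  have hx₀0 : 0 < x₀ := lt_of_le_of_ne hx₀.1 fun h => by rw [← h, hy0] at hyx₀; exact hyx₀.false
  have hx₀1 : x₀ < 1 := lt_of_le_of_ne hx₀.2 fun h => by
    rw [h] at hyx₀; exact absurd h1 hyx₀.ne'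
  have hρ0 : ρ x₀ = 0 := (hmax.isLocalMax (Icc_mem_nhds hx₀0 hx₀1)).hasDerivAt_eq_zero (hyd x₀)
  set S : Set ℝ := Icc x₀ 1 ∩ y ⁻¹' Iic 0
  have hSc : IsClosed S := isClosed_Icc.inter (isClosed_Iic.preimage hyc)
  have hSne : S.Nonempty := ⟨1, ⟨hx₀1.le, le_rfl⟩, h1.le⟩
  have hSb : BddBelow S := ⟨x₀, fun t ht => ht.1.1⟩
  -- The first point after x₀ where y is no longer positive.
  set b := sInf S
  have hb : b ∈ S := hSc.csInf_mem hSne hSb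
  have hypos {t : ℝ} (ht : t ∈ Ico x₀ b) : 0 < y t := by
    by_contra! h
    exact absurd (csInf_le hSb ⟨⟨ht.1, (ht.2.trans_le hb.1.2).le⟩, h⟩) (not_le.2 ht.2)
  have hmemI {t : ℝ} (ht : t ∈ Ico x₀ b) : t ∈ Icc (0 : ℝ) 1 :=
    ⟨hx₀.1.trans ht.1, (ht.2.trans_le hb.1.2).le⟩
  have hρnn {t : ℝ} (ht : t ∈ Ico x₀ b) : 0 ≤ ρ t := by
    have hint : 0 ≤ ∫ s in x₀..t, E s * (m - z s) := by
      refine intervalIntegral.integral_nonneg ht.1 fun s hs => ?_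
      have hs' : s ∈ Ico x₀ b := ⟨hs.1, hs.2.trans_lt ht.2⟩
      have : z s ≤ 0 := by
        by_contra! h
        exact absurd (hzy s (hmemI hs')) (not_le.2 (mul_pos h (hypos hs')))
      exact mul_nonneg (hE0 s).le (by linarith)
    have hcont : Continuous fun s => E s * (m - z s) := by fun_prop
    have : E t * ρ t = ∫ s in x₀..t, E s * (m - z s) := by
      rw [← intervalIntegral.integral_interval_sub_left (hcont.intervalIntegrable 0 t)
        (hcont.intervalIntegrable 0 x₀)]
      have e1 := heq t (hmemI ht)
      have e2 := heq x₀ hx₀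
      rw [hρ0] at e2
      linarith
    rw [← this] at hint
    exact nonneg_of_mul_nonneg_right hint (hE0 t)
  have hle : x₀ ≤ b := hb.1.1
  have h2 : 0 ≤ ∫ t in x₀..b, ρ t := by
    have := intervalIntegral.integral_mono_on_of_le_Ioo (f := fun _ => (0 : ℝ)) hle
      intervalIntegrable_const (hρ.intervalIntegrable (μ := volume) x₀ b)
      fun t ht => hρnn ⟨ht.1.le, ht.2⟩
    simpa using this
  have h3 : ∫ t in x₀..b, ρ t = y b - y x₀ :=
    (intervalIntegral.integral_interval_sub_left (hρ.intervalIntegrable 0 b)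
        (hρ.intervalIntegrable 0 x₀)).symm
  have h4 : y b ≤ 0 := hb.2
  linarith

/-- Since y ≤ 0 vanishes at both ends, ρ(0) ≤ 0 ≤ ρ(1), and periodicity gives ρ(0) = 0, that is c =
0. If m were positive, Eρ would increase from 0 and make y positive to the right of 0, so m = 0.
With m = 0 the problem is odd in (ρ, z), and the one-sided bound also applies to -ρ. -/
lemma integral_eq_zero_of_nonneg (hρ : Continuous ρ) (hE : Continuous E) (hz : Continuous z)
    (hE0 : ∀ x, 0 < E x) (h1 : ∫ t in (0 : ℝ)..1, ρ t = 0) (hper : ρ 0 = ρ 1)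
    (heq : ∀ x ∈ Icc (0 : ℝ) 1, E x * ρ x = c + ∫ t in (0 : ℝ)..x, E t * (m - z t))
    (hzy : ∀ x ∈ Icc (0 : ℝ) 1, z x * (∫ t in (0 : ℝ)..x, ρ t) ≤ 0) (hz0 : z 0 = 0) (hm : 0 ≤ m)
    {x : ℝ} (hx : x ∈ Icc (0 : ℝ) 1) : ∫ t in (0 : ℝ)..x, ρ t = 0 := by
  have hle {x : ℝ} (hx : x ∈ Icc (0 : ℝ) 1) :=
    integral_nonpos_of_oscillation hρ hE hz hE0 h1 heq hzy hm hx
  have hnot {δ : ℝ} (hδ : 0 < δ) (hδ1 : δ ≤ 1) (h : ∀ x ∈ Ioo (0 : ℝ) δ, 0 < ρ x) : False :=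
    absurd (hle ⟨hδ.le, hδ1⟩) (not_le.2 (intervalIntegral.intervalIntegral_pos_of_pos_on
      (hρ.intervalIntegrable _ _) h hδ))
  have hρ0 : ρ 0 ≤ 0 := by
    by_contra! h
    obtain ⟨δ, hδ, hδ1, h⟩ := exists_pos_right hρ h
    exact hnot hδ hδ1 fun x hx => h x (Ioo_subset_Icc_self hx)
  have hρ1 : 0 ≤ ρ 1 := by
    by_contra! h
    obtain ⟨δ, hδ, hδ1, h⟩ := exists_pos_right (g := fun x => - ρ (1 - x)) (by fun_prop)
      (by simpa using h)
    have h2 : 0 < ∫ t in (1 - δ)..1, - ρ t :=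
      intervalIntegral.intervalIntegral_pos_of_pos_on (hρ.neg.intervalIntegrable _ _)
        (fun x hx => by
          simpa using h (1 - x) ⟨by linarith [hx.2], by linarith [hx.1]⟩) (by linarith)
    rw [intervalIntegral.integral_neg, ← intervalIntegral.integral_interval_sub_left
      (hρ.intervalIntegrable 0 1) (hρ.intervalIntegrable 0 (1 - δ)), h1] at h2
    linarith [hle (x := 1 - δ) ⟨by linarith, by linarith⟩]
  have hρ00 : ρ 0 = 0 := le_antisymm hρ0 (hper ▸ hρ1)
  have hc : c = 0 := by
    have := heq 0 (by simp)
    simpa [hρ00] using this.symm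
  have hcont : Continuous fun s => E s * (m - z s) := by fun_prop
  have hm0 : m = 0 := by
    by_contra hne
    have hmpos : 0 < m := lt_of_le_of_ne hm (Ne.symm hne)
    obtain ⟨δ, hδ, hδ1, h⟩ := exists_pos_right hcont (by
      rw [hz0, sub_zero]; exact mul_pos (hE0 0) hmpos)
    refine hnot hδ hδ1 fun x hx => ?_
    have h2 : 0 < ∫ t in (0 : ℝ)..x, E t * (m - z t) :=
      intervalIntegral.intervalIntegral_pos_of_pos_on (hcont.intervalIntegrable _ _)
        (fun t ht => h t ⟨ht.1.le, (ht.2.trans hx.2).le⟩) hx.1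
    have h3 := heq x ⟨hx.1.le, hx.2.le.trans hδ1⟩
    rw [hc, zero_add] at h3
    rw [← h3] at h2
    exact pos_of_mul_pos_right h2 (hE0 x).le
  refine le_antisymm (hle hx) ?_
  have := integral_nonpos_of_oscillation (ρ := fun t => - ρ t) (E := E) (z := fun t => - z t)
    (m := 0) (c := 0) hρ.neg hE hz.neg hE0 (by rw [intervalIntegral.integral_neg, h1, neg_zero])
    (fun x hx => by
      have := heq x hx
      rw [hc, hm0] at this
      rw [mul_neg, this, zero_add, zero_add, ← intervalIntegral.integral_neg]
      congr 1; funext t; ring)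
    (fun x hx => by
      rw [intervalIntegral.integral_neg, neg_mul_neg]; exact hzy x hx) le_rfl hx
  rw [intervalIntegral.integral_neg] at this
  linarith

/-- Changing the signs of ρ, z, m and c preserves the problem, so one may assume m ≥ 0. -/
lemma integral_eq_zero_of_periodic (hρ : Continuous ρ) (hE : Continuous E) (hz : Continuous z)
    (hE0 : ∀ x, 0 < E x) (h1 : ∫ t in (0 : ℝ)..1, ρ t = 0) (hper : ρ 0 = ρ 1)
    (heq : ∀ x ∈ Icc (0 : ℝ) 1, E x * ρ x = c + ∫ t in (0 : ℝ)..x, E t * (m - z t))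
    (hzy : ∀ x ∈ Icc (0 : ℝ) 1, z x * (∫ t in (0 : ℝ)..x, ρ t) ≤ 0) (hz0 : z 0 = 0)
    {x : ℝ} (hx : x ∈ Icc (0 : ℝ) 1) : ∫ t in (0 : ℝ)..x, ρ t = 0 := by
  rcases le_total 0 m with hm | hm
  · exact integral_eq_zero_of_nonneg hρ hE hz hE0 h1 hper heq hzy hz0 hm hx
  · have := integral_eq_zero_of_nonneg (ρ := fun t => - ρ t) (E := E) (z := fun t => - z t)
      (m := -m) (c := -c) hρ.neg hE hz.neg hE0
      (by rw [intervalIntegral.integral_neg, h1, neg_zero]) (by rw [hper])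
      (fun x hx => by
        rw [mul_neg, heq x hx, neg_add, ← intervalIntegral.integral_neg]
        congr 2; funext t; ring)
      (fun x hx => by
        rw [intervalIntegral.integral_neg, neg_mul_neg]; exact hzy x hx) (by simp [hz0])
      (by linarith) hx
    rw [intervalIntegral.integral_neg] at this
    linarith

end MaximumPrinciple

lemma periodicPrimitive_zero_eq_one (f : L1T) :
    periodicPrimitive f 0 = periodicPrimitive f 1 := by
  rw [periodicPrimitive_apply, periodicPrimitive_apply, primitive_zero_right,
    ← meanL1_eq_primitive, meanL1_center]

/-- Uniqueness for the linear first order problem `r' + p r + z = const` on the circle, with `z`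
of the sign opposite to that of the primitive of `r`. -/
lemma eq_zero_of_add_invDeriv_eq_zero {r p : L2T} {z : ℝ →ᵇ ℝ}
    (hz0 : z 0 = 0)
    (hz : ∀ x ∈ Icc (0 : ℝ) 1, z x * primitive (inclL1 r) x ≤ 0)
    (h : r + invDeriv (mulL2 p r + toL1 z) = 0) : r = 0 := by
  set f : L1T := mulL2 p r + toL1 z with hf
  -- The equation itself supplies a continuous representative of r.
  set ρ : ℝ →ᵇ ℝ := - periodicPrimitive f with hρ
  have hrρ : r =ᵐ[periodMeasure] ρ := by
    have : r = - invDeriv f := eq_neg_of_add_eq_zero_left h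
    rw [this]
    filter_upwards [Lp.coeFn_neg (invDeriv f), coeFn_invDeriv f] with x h1 h2
    rw [h1, Pi.neg_apply, h2]
    rfl
  have hy {x : ℝ} (hx : x ∈ Icc (0 : ℝ) 1) :
      primitive (inclL1 r) x = ∫ t in (0 : ℝ)..x, ρ t :=
    primitive_of_ae ((coeFn_inclL1 r).trans hrρ) hx
  have h1 : ∫ t in (0 : ℝ)..1, ρ t = 0 := by
    rw [← hy (by simp), primitive_inclL1_one]
    have : r = (-1 : ℝ) • invDeriv f := by rw [neg_one_smul]; exact eq_neg_of_add_eq_zero_left h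
    rw [this]
    simpa [integral_invDeriv] using integral_smul_mul (-1) (invDeriv f) fun _ => 1
  set c : ℝ := meanL1 (toL1 (primitive (center f)))
  have hρc (x : ℝ) : ρ x = c - primitive (center f) x := by
    have : ρ x = - periodicPrimitive f x := rfl
    rw [this, periodicPrimitive_apply, neg_sub]
  -- The integrating factor e^{∫p} of ρ' + pρ = mean - z. Since p is only in L², the identity is
  -- derived in integrated form.
  set E : ℝ →ᵇ ℝ := expB (primitive (inclL1 p))
  have hE {x : ℝ} (hx : x ∈ Icc (0 : ℝ) 1) : E x = 1 + primitive (mulBL1 E (inclL1 p)) x := by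
    rw [← exp_primitive _ hx, ← expB_apply]
  -- With ρ = c - C and E = 1 + G, where C and G are primitives, the left side is the derivative of
  -- cG - C - GC = Eρ - c.
  have hae : (c • mulBL1 E (inclL1 p) - center f
      - (mulBL1 (primitive (mulBL1 E (inclL1 p))) (center f)
        + mulBL1 (primitive (center f)) (mulBL1 E (inclL1 p))) : L1T)
      =ᵐ[periodMeasure] fun x => E x * (meanL1 f - z x) := by
    filter_upwards [Lp.coeFn_sub (c • mulBL1 E (inclL1 p) - center f)
        (mulBL1 (primitive (mulBL1 E (inclL1 p))) (center f)
        + mulBL1 (primitive (center f)) (mulBL1 E (inclL1 p))),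
      Lp.coeFn_sub (c • mulBL1 E (inclL1 p)) (center f),
      Lp.coeFn_add (mulBL1 (primitive (mulBL1 E (inclL1 p))) (center f))
        (mulBL1 (primitive (center f)) (mulBL1 E (inclL1 p))),
      Lp.coeFn_smul c (mulBL1 E (inclL1 p)), coeFn_mulBL1 E (inclL1 p),
      coeFn_mulBL1 (primitive (mulBL1 E (inclL1 p))) (center f),
      coeFn_mulBL1 (primitive (center f)) (mulBL1 E (inclL1 p)),
      coeFn_inclL1 p, coeFn_center f, Lp.coeFn_add (mulL2 p r) (toL1 z), coeFn_mulL2 p r,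
      coeFn_toL1 z, hrρ, ae_Icc] with x e1 e2 e3 e4 e5 e6 e7 e8 e9 e10 e11 e12 e13 hx
    have e14 : f x = p x * ρ x + z x := by rw [hf, e10, Pi.add_apply, e11, e12, e13]
    have e15 := hE hx
    have e16 := hρc x
    rw [e1, Pi.sub_apply, e2, Pi.sub_apply, e3, Pi.add_apply, e4, Pi.smul_apply, e6, e7, e5, e8,
      e9, e14, smul_eq_mul]
    have e17 : primitive (mulBL1 E (inclL1 p)) x = E x - 1 := by linarith
    have e18 : primitive (center f) x = c - ρ x := by linarith
    rw [e17, e18]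
    ring
  have heq (x : ℝ) (hx : x ∈ Icc (0 : ℝ) 1) :
      E x * ρ x = c + ∫ t in (0 : ℝ)..x, E t * (meanL1 f - z t) := by
    rw [← primitive_of_ae hae hx, hρc]
    simp only [map_sub, map_smul, BoundedContinuousFunction.coe_sub, Pi.sub_apply,
      BoundedContinuousFunction.coe_smul, smul_eq_mul]
    rw [← primitive_mul_primitive _ _ hx, hE hx]
    ring
  have hzero {x : ℝ} (hx : x ∈ Icc (0 : ℝ) 1) : ∫ t in (0 : ℝ)..x, ρ t = 0 := by
    refine integral_eq_zero_of_periodic ρ.continuous E.continuous z.continuous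
      (fun x => ?_) h1 ?_ heq ?_ hz0 hx
    · rw [expB_apply]; exact Real.exp_pos _
    · change - periodicPrimitive f 0 = - periodicPrimitive f 1
      rw [periodicPrimitive_zero_eq_one]
    · intro x hx
      rw [← hy hx]
      exact hz x hx
  rw [Lp.eq_zero_iff_ae_eq_zero]
  have hIoo : ∀ᵐ x ∂periodMeasure, x ∈ Ioo (0 : ℝ) 1 := by
    rw [periodMeasure, ← restrict_Ioo_eq_restrict_Ioc]
    exact ae_restrict_mem measurableSet_Ioo
  filter_upwards [hrρ, hIoo] with x hx1 hx2
  rw [hx1, Pi.zero_apply]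
  -- The primitive of ρ vanishes identically near an interior point, and so does its derivative ρ.
  have hev : (fun x => ∫ t in (0 : ℝ)..x, ρ t) =ᶠ[𝓝 x] fun _ => 0 := by
    filter_upwards [Ioo_mem_nhds hx2.1 hx2.2] with t ht using hzero (Ioo_subset_Icc_self ht)
  exact ((hasDerivAt_integral ρ x).congr_of_eventuallyEq hev.symm).unique
    (hasDerivAt_const x (0 : ℝ))

section

/-! ### The Riccati map on `L²` -/

variable (α β A : ℝ)

/-- The function `u = A e^{-β Q}`. -/
def expTerm (q : L2T) : ℝ →ᵇ ℝ := A • expB ((-β) • primitive (inclL1 q))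

/-- The function `α q² + u` in `L¹`. -/
def lowerL1 (q : L2T) : L1T := α • mulL2 q q + toL1 (expTerm β A q)

/-- The map `q ↦ q + D⁻¹(α q² + u - c₀)` on `L²`, of which `P` is the derivative. -/
def riccati (q : L2T) : L2T := q + invDeriv (lowerL1 α β A q)

lemma expTerm_apply (q : L2T) (x : ℝ) :
    expTerm β A q x = A * Real.exp (-β * primitive (inclL1 q) x) := by
  simp [expTerm, expB_apply]

lemma primitive_inclL1_eq_primQ (q : L2T) {x : ℝ} (hx : x ∈ Icc (0 : ℝ) 1) :
    primitive (inclL1 q) x = primQ q x := primitive_of_ae (coeFn_inclL1 q) hx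

lemma coeFn_lowerL1 (q : L2T) : lowerL1 α β A q =ᵐ[periodMeasure] lowerTerm α β A q := by
  filter_upwards [Lp.coeFn_add (α • mulL2 q q) (toL1 (expTerm β A q)),
    Lp.coeFn_smul α (mulL2 q q), coeFn_mulL2 q q, coeFn_toL1 (expTerm β A q), ae_Icc]
    with x h1 h2 h3 h4 hx
  rw [lowerL1, h1, Pi.add_apply, h2, Pi.smul_apply, h3, h4, expTerm_apply,
    primitive_inclL1_eq_primQ q hx, lowerTerm, smul_eq_mul]
  ring

lemma meanL1_lowerL1 (q : L2T) : meanL1 (lowerL1 α β A q) = meanTerm α β A q :=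
  meanL1_of_ae (coeFn_lowerL1 α β A q)

lemma AnalyticAt.clm_apply₂ {E F G H : Type*} [NormedAddCommGroup E] [NormedSpace ℝ E]
    [NormedAddCommGroup F] [NormedSpace ℝ F] [NormedAddCommGroup G] [NormedSpace ℝ G]
    [NormedAddCommGroup H] [NormedSpace ℝ H] (B : F →L[ℝ] G →L[ℝ] H) {f : E → F} {g : E → G}
    {x : E} (hf : AnalyticAt ℝ f x) (hg : AnalyticAt ℝ g x) :
    AnalyticAt ℝ (fun y => B (f y) (g y)) x :=
  (B.analyticAt_bilinear (f x, g x)).comp₂ hf hg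

lemma AnalyticAt.clm_comp {E F G : Type*} [NormedAddCommGroup E] [NormedSpace ℝ E]
    [NormedAddCommGroup F] [NormedSpace ℝ F] [NormedAddCommGroup G] [NormedSpace ℝ G]
    (L : F →L[ℝ] G) {f : E → F} {x : E} (hf : AnalyticAt ℝ f x) :
    AnalyticAt ℝ (fun y => L (f y)) x :=
  (L.analyticAt (f x)).comp hf

lemma analyticAt_expTerm (q : L2T) : AnalyticAt ℝ (expTerm β A) q := by
  have h1 : AnalyticAt ℝ (fun q : L2T => ((-β) • primitive.comp inclL1) q) q :=
    ContinuousLinearMap.analyticAt _ _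
  have h2 : AnalyticAt ℝ (fun q : L2T => expB (((-β) • primitive.comp inclL1) q)) q :=
    AnalyticAt.comp (analyticAt_expB _) h1
  exact AnalyticAt.clm_comp (A • ContinuousLinearMap.id ℝ (ℝ →ᵇ ℝ)) h2

lemma analyticAt_lowerL1 (q : L2T) : AnalyticAt ℝ (lowerL1 α β A) q :=
  (AnalyticAt.clm_comp (α • ContinuousLinearMap.id ℝ L1T)
    (AnalyticAt.clm_apply₂ mulL2 analyticAt_id analyticAt_id)).add
    (AnalyticAt.clm_comp toL1 (analyticAt_expTerm β A q))

lemma analyticAt_riccati (q : L2T) : AnalyticAt ℝ (riccati α β A) q :=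
  analyticAt_id.add (AnalyticAt.clm_comp invDeriv (analyticAt_lowerL1 α β A q))

lemma continuous_riccati : Continuous (riccati α β A) :=
  continuous_iff_continuousAt.2 fun q => (analyticAt_riccati α β A q).continuousAt

/-- The derivative of `q ↦ α q² + u`. -/
def lowerDeriv (q : L2T) : L2T →L[ℝ] L1T :=
  α • (mulL2 q + mulL2.flip q)
    + toL1.comp (A • (expB ((-β) • primitive (inclL1 q))
        • (1 : (ℝ →ᵇ ℝ) →L[ℝ] (ℝ →ᵇ ℝ))).comp ((-β) • primitive.comp inclL1))

lemma hasFDerivAt_lowerL1 (q : L2T) :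
    HasFDerivAt (lowerL1 α β A) (lowerDeriv α β A q) q := by
  have h1 : HasFDerivAt (fun q : L2T => mulL2 q q) (mulL2 q + mulL2.flip q) q := by
    have := mulL2.hasFDerivAt_of_bilinear (hasFDerivAt_id q) (hasFDerivAt_id q)
    refine this.congr_fderiv ?_
    ext1 h
    simp
  have h2 : HasFDerivAt (fun q : L2T => ((-β) • primitive.comp inclL1) q)
      ((-β) • primitive.comp inclL1) q := ContinuousLinearMap.hasFDerivAt _
  have h3 := ((hasFDerivAt_expB (((-β) • primitive.comp inclL1) q)).comp q h2).const_smul A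
  have h4 := toL1.hasFDerivAt.comp q h3
  exact (h1.const_smul α).add h4

/-- This puts the kernel equation of the derivative of `riccati` into the form p h + z required by
`eq_zero_of_add_invDeriv_eq_zero`. -/
lemma lowerDeriv_apply (q h : L2T) : lowerDeriv α β A q h
    = mulL2 ((2 * α) • q) h + toL1 ((-β) • (expTerm β A q * primitive (inclL1 h))) := by
  have : lowerDeriv α β A q h = α • (mulL2 q h + mulL2 h q)
      + toL1 (A • (expB ((-β) • primitive (inclL1 q)) * ((-β) • primitive (inclL1 h)))) := rfl
  rw [this, mulL2_comm h q, map_smul mulL2, smul_apply, ← two_smul ℝ (mulL2 q h),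
    smul_smul, mul_comm α 2]
  congr 2
  ext x
  simp only [expTerm, BoundedContinuousFunction.coe_smul, BoundedContinuousFunction.coe_mul,
    Pi.mul_apply, smul_eq_mul]
  ring

/-! ### Injectivity, invertibility of the derivative, local inverse. -/

lemma expTerm_nonneg (hA : 0 ≤ A) (q : L2T) (x : ℝ) : 0 ≤ expTerm β A q x := by
  rw [expTerm_apply]; positivity

/-- The Riccati map preserves the mean value. -/
lemma integral_riccati (q : L2T) :
    ∫ x in (0 : ℝ)..1, riccati α β A q x = ∫ x in (0 : ℝ)..1, q x := by
  have := integral_add_mul q (invDeriv (lowerL1 α β A q)) (continuous_const (y := (1 : ℝ)))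
  simp only [mul_one, integral_invDeriv, add_zero] at this
  exact this

/-- The difference of the squares factors as (q₁ + q₂)(q₁ - q₂), and u is a decreasing function of
the primitive of q, which is the sign condition of `eq_zero_of_add_invDeriv_eq_zero`. -/
lemma riccati_injective (hβ : 0 ≤ β) (hA : 0 ≤ A) : Function.Injective (riccati α β A) := by
  intro q₁ q₂ h
  have hz : lowerL1 α β A q₁ - lowerL1 α β A q₂
      = mulL2 (α • (q₁ + q₂)) (q₁ - q₂) + toL1 (expTerm β A q₁ - expTerm β A q₂) := by
    simp only [lowerL1, map_sub, map_add, map_smul, add_apply, smul_apply, mulL2_comm q₂ q₁]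
    module
  have h0 : (q₁ - q₂) + invDeriv (mulL2 (α • (q₁ + q₂)) (q₁ - q₂)
      + toL1 (expTerm β A q₁ - expTerm β A q₂)) = 0 := by
    rw [← hz, map_sub]
    have := sub_eq_zero.2 h
    simp only [riccati] at this
    rw [← this]; abel
  refine sub_eq_zero.1 (eq_zero_of_add_invDeriv_eq_zero ?_ ?_ h0)
  · simp [expTerm_apply, primitive_zero_right]
  · intro x _
    simp only [BoundedContinuousFunction.coe_sub, Pi.sub_apply, expTerm_apply, map_sub]
    set a := primitive (inclL1 q₁) x
    set b := primitive (inclL1 q₂) x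
    rw [← mul_sub]
    rcases le_total a b with hab | hab
    · refine mul_nonpos_of_nonneg_of_nonpos (mul_nonneg hA (sub_nonneg.2 ?_)) (by linarith)
      exact Real.exp_le_exp.2 (by nlinarith)
    · refine mul_nonpos_of_nonpos_of_nonneg
        (mul_nonpos_of_nonneg_of_nonpos hA (sub_nonpos.2 ?_)) (by linarith)
      exact Real.exp_le_exp.2 (by nlinarith)

lemma hasFDerivAt_riccati (q : L2T) : HasFDerivAt (riccati α β A)
    (ContinuousLinearMap.id ℝ L2T + invDeriv.comp (lowerDeriv α β A q)) q :=
  (hasFDerivAt_id q).add (invDeriv.hasFDerivAt.comp q (hasFDerivAt_lowerL1 α β A q))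

/-- The derivative of the Riccati map is invertible. -/
lemma exists_fderiv_riccati_eq (hβ : 0 ≤ β) (hA : 0 ≤ A) (q : L2T) :
    ∃ i : L2T ≃L[ℝ] L2T, fderiv ℝ (riccati α β A) q = i := by
  set T : L2T →L[ℝ] L2T := invDeriv.comp (lowerDeriv α β A q)
  have hT : IsCompactOperator T := isCompactOperator_invDeriv.comp_clm (lowerDeriv α β A q)
  have hinj : ¬ Module.End.HasEigenvalue (T : Module.End ℝ L2T) (-1) := by
    intro hev
    obtain ⟨h, hh⟩ := hev.exists_hasEigenvector
    refine hh.2 ?_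
    have h1 : T h = (-1 : ℝ) • h := hh.apply_eq_smul
    have h2 : h + invDeriv (mulL2 ((2 * α) • q) h
        + toL1 ((-β) • (expTerm β A q * primitive (inclL1 h)))) = 0 := by
      rw [← lowerDeriv_apply]
      change h + T h = 0
      rw [h1]; simp
    refine eq_zero_of_add_invDeriv_eq_zero ?_ ?_ h2
    · simp [primitive_zero_right]
    · intro x _
      simp only [BoundedContinuousFunction.coe_smul, BoundedContinuousFunction.coe_mul,
        Pi.mul_apply, smul_eq_mul]
      have := mul_nonneg (mul_nonneg hβ (expTerm_nonneg β A hA q x))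
        (sq_nonneg (primitive (inclL1 h) x))
      linarith
  -- Fredholm alternative: the derivative is 1 + T with T compact, so excluding the eigenvalue -1
  -- makes it invertible.
  have hres := (hT.hasEigenvalue_or_mem_resolventSet (μ := (-1 : ℝ)) (by norm_num)).resolve_left
    hinj
  rw [spectrum.mem_resolventSet_iff, ← IsUnit.neg_iff] at hres
  obtain ⟨u, hu⟩ := hres
  refine ⟨ContinuousLinearEquiv.ofUnit u, ?_⟩
  rw [(hasFDerivAt_riccati α β A q).fderiv]
  change _ = (u : L2T →L[ℝ] L2T)
  rw [hu]
  ext1 h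
  simp [T]
  abel

/-- The inverse of the Riccati map on its range. -/
def riccatiInv : L2T → L2T := Function.invFun (riccati α β A)

lemma riccatiInv_riccati (hβ : 0 ≤ β) (hA : 0 ≤ A) (q : L2T) :
    riccatiInv α β A (riccati α β A q) = q :=
  Function.leftInverse_invFun (riccati_injective α β A hβ hA) q

lemma riccati_riccatiInv {p : L2T} (hp : p ∈ range (riccati α β A)) :
    riccati α β A (riccatiInv α β A p) = p := Function.invFun_eq hp

/-- Inverse function theorem at q. By global injectivity the local inverse agrees with `riccatiInv`
near the image point, so analyticity passes to the latter. -/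
lemma range_riccati_nhds_and_analyticAt (hβ : 0 ≤ β) (hA : 0 ≤ A) (q : L2T) :
    range (riccati α β A) ∈ 𝓝 (riccati α β A q)
      ∧ AnalyticAt ℝ (riccatiInv α β A) (riccati α β A q) := by
  obtain ⟨i, hi⟩ := exists_fderiv_riccati_eq α β A hβ hA q
  have han := analyticAt_riccati α β A q
  have hs : HasStrictFDerivAt (riccati α β A) (i : L2T →L[ℝ] L2T) q := hi ▸ han.hasStrictFDerivAt
  set R := hs.toOpenPartialHomeomorph (riccati α β A)
  have hq : q ∈ R.source := hs.mem_toOpenPartialHomeomorph_source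
  have hsymm : AnalyticAt ℝ R.symm (riccati α β A q) := R.analyticAt_symm' hq han hi
  have htarget : R.target ∈ 𝓝 (riccati α β A q) := R.open_target.mem_nhds (R.map_source hq)
  have hR {p : L2T} (hp : p ∈ R.target) : riccati α β A (R.symm p) = p := R.right_inv hp
  refine ⟨mem_of_superset htarget fun p hp => ⟨R.symm p, hR hp⟩, hsymm.congr ?_⟩
  filter_upwards [htarget] with p hp
  conv_rhs => rw [← hR hp]
  exact (riccatiInv_riccati α β A hβ hA _).symm

lemma isOpen_range_riccati (hβ : 0 ≤ β) (hA : 0 ≤ A) : IsOpen (range (riccati α β A)) := by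
  rw [isOpen_iff_mem_nhds]
  rintro _ ⟨q, rfl⟩
  exact (range_riccati_nhds_and_analyticAt α β A hβ hA q).1

lemma analyticAt_riccatiInv (hβ : 0 ≤ β) (hA : 0 ≤ A) {p : L2T}
    (hp : p ∈ range (riccati α β A)) : AnalyticAt ℝ (riccatiInv α β A) p := by
  obtain ⟨q, rfl⟩ := hp
  exact (range_riccati_nhds_and_analyticAt α β A hβ hA q).2

/-! ### Elementary bounds and the continuity method. -/

lemma norm_toL2_one : ‖toL2 1‖ = 1 := by
  have := norm_sq_of_ae (coeFn_toL2 1)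
  simp only [BoundedContinuousFunction.coe_one, Pi.one_apply, one_pow,
    intervalIntegral.integral_const, sub_zero, smul_eq_mul, mul_one] at this
  exact (pow_eq_one_iff_of_nonneg (norm_nonneg _) two_ne_zero).1 this

lemma norm_inclL1_le (q : L2T) : ‖inclL1 q‖ ≤ ‖q‖ := by
  refine (norm_mulL2_le _ _).trans ?_
  rw [norm_toL2_one, one_mul]

lemma abs_primitive_inclL1_le (q : L2T) (x : ℝ) : |primitive (inclL1 q) x| ≤ ‖q‖ :=
  (abs_primitive_le _ _).trans (norm_inclL1_le q)

lemma norm_toL1_le (g : ℝ →ᵇ ℝ) {C : ℝ} (hg : ∀ x, |g x| ≤ C) : ‖toL1 g‖ ≤ C := by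
  rw [norm_L1T, integral_congr_period (g := fun x => |g x|)
    (by filter_upwards [coeFn_toL1 g] with x hx; rw [hx]) (by simp)]
  refine (intervalIntegral.integral_mono_on zero_le_one
    (g.continuous.abs.intervalIntegrable _ _) intervalIntegrable_const
    fun x _ => hg x).trans ?_
  simp

lemma expTerm_le (hβ : 0 ≤ β) (hA : 0 ≤ A) (q : L2T) (x : ℝ) :
    expTerm β A q x ≤ A * Real.exp (β * ‖q‖) := by
  rw [expTerm_apply]
  refine mul_le_mul_of_nonneg_left (Real.exp_le_exp.2 ?_) hA
  have := (abs_le.1 (abs_primitive_inclL1_le q x)).1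
  nlinarith

lemma norm_lowerL1_le (hα : 0 ≤ α) (hβ : 0 ≤ β) (hA : 0 ≤ A) (q : L2T) :
    ‖lowerL1 α β A q‖ ≤ α * ‖q‖ ^ 2 + A * Real.exp (β * ‖q‖) := by
  refine (norm_add_le _ _).trans (add_le_add ?_ ?_)
  · rw [norm_smul, Real.norm_eq_abs, abs_of_nonneg hα, pow_two]
    exact mul_le_mul_of_nonneg_left (norm_mulL2_le q q) hα
  · refine norm_toL1_le _ fun x => ?_
    rw [abs_of_nonneg (expTerm_nonneg β A hA q x)]
    exact expTerm_le β A hβ hA q x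

lemma invDeriv_toL1_one : invDeriv (toL1 1) = 0 := by
  have hc : center (toL1 1) = 0 := by rw [center_apply, meanL1_one, one_smul, sub_self]
  simp [invDeriv, periodicPrimitive, hc]

lemma riccati_zero : riccati α β A 0 = 0 := by
  have h : lowerL1 α β A 0 = A • toL1 1 := by
    rw [lowerL1, map_zero, smul_zero, zero_add, ← map_smul]
    congr 1
    ext x
    rw [expTerm_apply]
    simp
  rw [riccati, h, map_smul, zero_add, invDeriv_toL1_one, smul_zero]

/-- The continuity method: an a priori bound on the segment `[0, p]` gives solvability. -/
lemma mem_range_riccati_of_bound (hα : 0 ≤ α) (hβ : 0 ≤ β) (hA : 0 ≤ A) (p : L2T) (R : ℝ)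
    (hR : ∀ t ∈ Icc (0 : ℝ) 1, ∀ q, riccati α β A q = t • p → ‖q‖ ≤ R) :
    p ∈ range (riccati α β A) := by
  set S : Set ℝ := {t | t • p ∈ range (riccati α β A)} with hS
  have hopen : IsOpen S :=
    (isOpen_range_riccati α β A hβ hA).preimage (continuous_id.smul continuous_const)
  -- The bounded solutions qₙ have lower terms bounded in L¹, whose images under the compact D⁻¹
  -- converge along a subsequence. Then qₙ = tₙp - D⁻¹(lower term) converges too, and its limit
  -- solves the limit equation.
  have hclosed : IsClosed (S ∩ Icc 0 1) := by
    refine IsSeqClosed.isClosed fun t s ht hts => ?_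
    have hs : s ∈ Icc (0 : ℝ) 1 := isClosed_Icc.mem_of_tendsto hts
      (Eventually.of_forall fun n => (ht n).2)
    refine ⟨?_, hs⟩
    choose q hq using fun n => (ht n).1
    set K : ℝ := α * R ^ 2 + A * Real.exp (β * R)
    have hbd (n : ℕ) : lowerL1 α β A (q n) ∈ Metric.closedBall 0 K := by
      have hqR := hR (t n) (ht n).2 (q n) (hq n)
      rw [mem_closedBall_zero_iff]
      refine (norm_lowerL1_le α β A hα hβ hA (q n)).trans ?_
      change _ ≤ α * R ^ 2 + A * Real.exp (β * R)
      gcongr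
    obtain ⟨C, hC, hsub⟩ := isCompactOperator_invDeriv.image_closedBall_subset_compact K
    obtain ⟨k, -, φ, hφ, hlim⟩ := hC.tendsto_subseq
      (x := fun n => invDeriv (lowerL1 α β A (q n)))
      fun n => hsub ⟨_, hbd n, rfl⟩
    have hqlim : Tendsto (fun n => q (φ n)) atTop (𝓝 (s • p - k)) := by
      have h1 : Tendsto (fun n => t (φ n) • p - invDeriv (lowerL1 α β A (q (φ n)))) atTop
          (𝓝 (s • p - k)) :=
        ((hts.comp hφ.tendsto_atTop).smul_const p).sub hlim
      refine h1.congr fun n => ?_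
      rw [← hq (φ n), riccati, add_sub_cancel_right]
    refine ⟨s • p - k, ?_⟩
    refine tendsto_nhds_unique ((continuous_riccati α β A).tendsto _ |>.comp hqlim) ?_
    refine ((hts.comp hφ.tendsto_atTop).smul_const p).congr fun n => ?_
    exact (hq (φ n)).symm
  have h0 : (0 : ℝ) ∈ S := ⟨0, by rw [riccati_zero, zero_smul]⟩
  have hsub : Icc (0 : ℝ) 1 ⊆ S := hclosed.Icc_subset_of_forall_mem_nhdsWithin h0
    fun t ht => mem_nhdsWithin_of_mem_nhds (hopen.mem_nhds ht.1)
  have := hsub (right_mem_Icc.2 zero_le_one)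
  simpa [hS] using this

end

section

/-! ### Estimates -/

lemma integral_period_congr {f g : ℝ → ℝ} (h : f =ᵐ[periodMeasure] g) :
    ∫ x in (0 : ℝ)..1, f x = ∫ x in (0 : ℝ)..1, g x := integral_congr_period h (by simp)

/-- Integration by parts on the circle. -/
lemma integral_primitive_mul (a b : L1T) (ha : meanL1 a = 0) :
    ∫ x in (0 : ℝ)..1, primitive a x * b x = - ∫ x in (0 : ℝ)..1, primitive b x * a x := by
  have h := primitive_mul_primitive a b (x := 1) (by simp)
  rw [← meanL1_eq_primitive a, ha, zero_mul, map_add] at h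
  simp only [BoundedContinuousFunction.coe_add, Pi.add_apply] at h
  rw [primitive_one_of_ae (coeFn_mulBL1 _ _), primitive_one_of_ae (coeFn_mulBL1 _ _)] at h
  linarith

/-- A periodic absolutely continuous function oscillates by at most half its total variation. -/
lemma abs_primitive_sub_primitive_le (f : L1T) (hf : meanL1 f = 0) {x y : ℝ}
    (hx : x ∈ Icc (0 : ℝ) 1) (hy : y ∈ Icc (0 : ℝ) 1) :
    |primitive f y - primitive f x| ≤ 1 / 2 * ‖f‖ := by
  wlog h : x ≤ y generalizing x y
  · rw [abs_sub_comm]; exact this hy hx (le_of_not_ge h)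
  have h0 : (0 : ℝ) ∈ Icc (0 : ℝ) 1 := by simp
  have h1 : (1 : ℝ) ∈ Icc (0 : ℝ) 1 := by simp
  have hi := (intervalIntegrable_L1T f).abs
  have i0 := hi.mono_period h0 hx
  have i1 := hi.mono_period hx hy
  have i2 := hi.mono_period hy h1
  have hn : ‖f‖ = (∫ t in (0 : ℝ)..x, |f t|) + (∫ t in x..y, |f t|) + ∫ t in y..1, |f t| := by
    rw [norm_L1T, intervalIntegral.integral_add_adjacent_intervals i0 i1,
      intervalIntegral.integral_add_adjacent_intervals (i0.trans i1) i2]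
  have a0 := intervalIntegral.abs_integral_le_integral_abs (f := f) (μ := volume) hx.1
  have a1 := intervalIntegral.abs_integral_le_integral_abs (f := f) (μ := volume) h
  have a2 := intervalIntegral.abs_integral_le_integral_abs (f := f) (μ := volume) hy.2
  rw [← primitive_sub_primitive f h0 hx, primitive_zero_right, sub_zero] at a0
  rw [← primitive_sub_primitive f hx hy] at a1
  rw [← primitive_sub_primitive f hy h1, ← meanL1_eq_primitive, hf, zero_sub, abs_neg] at a2
  have a3 := abs_sub (primitive f y) (primitive f x)
  linarith

lemma norm_toL2_le (g : ℝ →ᵇ ℝ) {C : ℝ} (hC : 0 ≤ C) (hg : ∀ x ∈ Icc (0 : ℝ) 1, |g x| ≤ C) :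
    ‖toL2 g‖ ≤ C := by
  refine le_of_sq_le_sq ?_ hC
  rw [norm_sq_of_ae (coeFn_toL2 g)]
  refine (intervalIntegral.integral_mono_on (g := fun _ => C ^ 2) zero_le_one
    ((g.continuous.pow 2).intervalIntegrable _ _) intervalIntegrable_const
    fun x hx => ?_).trans (by simp)
  exact sq_le_sq.2 ((hg x hx).trans_eq (abs_of_nonneg hC).symm)

lemma inner_toL2 (g : L2T) (w : ℝ →ᵇ ℝ) :
    inner ℝ g (toL2 w) = ∫ x in (0 : ℝ)..1, g x * w x := by
  rw [inner_L2T]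
  refine integral_period_congr ?_
  filter_upwards [coeFn_toL2 w] with x hx
  rw [hx]

/-- Pythagoras: the constant function 1 is a unit vector. -/
lemma norm_sub_mean_sq (g : L2T) :
    ‖g - (∫ x in (0 : ℝ)..1, g x) • toL2 1‖ ^ 2 = ‖g‖ ^ 2 - (∫ x in (0 : ℝ)..1, g x) ^ 2 := by
  rw [norm_sub_sq_real, inner_smul_right, inner_toL2, norm_smul, norm_toL2_one]
  simp only [BoundedContinuousFunction.coe_one, Pi.one_apply, mul_one, Real.norm_eq_abs, sq_abs]
  ring

lemma norm_sub_mean_le (g : L2T) : ‖g - (∫ x in (0 : ℝ)..1, g x) • toL2 1‖ ≤ ‖g‖ := by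
  refine le_of_sq_le_sq ?_ (norm_nonneg _)
  rw [norm_sub_mean_sq]
  linarith [sq_nonneg (∫ x in (0 : ℝ)..1, g x)]

/-- Removing the mean does not increase the L² norm, and the primitive is bounded in sup norm by the
L¹ norm of its integrand. -/
lemma norm_invDeriv_le_center (f : L1T) : ‖invDeriv f‖ ≤ ‖center f‖ := by
  have h : invDeriv f = toL2 (primitive (center f))
      - (∫ x in (0 : ℝ)..1, toL2 (primitive (center f)) x) • toL2 1 := by
    rw [integral_period_congr (coeFn_toL2 (primitive (center f))),
      ← meanL1_of_ae (coeFn_toL1 (primitive (center f)))]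
    simp [invDeriv, periodicPrimitive]
  rw [h]
  refine (norm_sub_mean_le _).trans (norm_toL2_le _ (norm_nonneg _) fun x _ => ?_)
  exact abs_primitive_le _ x

lemma norm_toL1_one_le : ‖toL1 1‖ ≤ 1 := norm_toL1_le _ fun x => by simp

lemma norm_invDeriv_le (f : L1T) : ‖invDeriv f‖ ≤ 2 * ‖f‖ := by
  refine (norm_invDeriv_le_center f).trans ?_
  rw [center_apply]
  refine (norm_sub_le _ _).trans ?_
  rw [norm_smul, Real.norm_eq_abs]
  have := mul_le_mul (abs_meanL1_le f) norm_toL1_one_le (norm_nonneg _) (norm_nonneg _)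
  linarith

lemma inclL1_toL2 (g : ℝ →ᵇ ℝ) : inclL1 (toL2 g) = toL1 g := by
  refine Lp.ext ?_
  filter_upwards [coeFn_inclL1 (toL2 g), coeFn_toL2 g, coeFn_toL1 g] with x h1 h2 h3
  rw [h1, h2, h3]

/-- Centering may double the L¹ norm but is an orthogonal projection in L²; hence the constant 1
here against 2 in `norm_invDeriv_le`. -/
lemma norm_invDeriv_inclL1_le (g : L2T) : ‖invDeriv (inclL1 g)‖ ≤ ‖g‖ := by
  have h : center (inclL1 g) = inclL1 (g - (∫ x in (0 : ℝ)..1, g x) • toL2 1) := by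
    rw [center_apply, map_sub, map_smul, inclL1_toL2, meanL1_of_ae (coeFn_inclL1 g)]
  refine (norm_invDeriv_le_center _).trans ?_
  rw [h]
  exact (norm_inclL1_le _).trans (norm_sub_mean_le g)

lemma abs_exp_sub_one_le (t : ℝ) : |Real.exp t - 1| ≤ |t| * Real.exp |t| := by
  rcases le_total 0 t with h | h
  · rw [abs_of_nonneg (by linarith [Real.one_le_exp h]), abs_of_nonneg h]
    have h1 := Real.add_one_le_exp (-t)
    have h2 : Real.exp (-t) * Real.exp t = 1 := by rw [← Real.exp_add]; simp
    nlinarith [Real.exp_pos t]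
  · rw [abs_of_nonpos (by linarith [Real.exp_le_one_iff.2 h]), abs_of_nonpos h]
    have h1 := Real.add_one_le_exp t
    have h2 : 1 ≤ Real.exp (-t) := Real.one_le_exp (by linarith)
    nlinarith

variable {α β A : ℝ}

lemma abs_expTerm_sub_le (hβ : 0 ≤ β) (hA : 0 ≤ A) (q : L2T) (x : ℝ) :
    |expTerm β A q x - A| ≤ β * A * ‖q‖ * Real.exp (β * ‖q‖) := by
  set y := primitive (inclL1 q) x
  have h1 : |(-β) * y| ≤ β * ‖q‖ := by
    rw [abs_mul, abs_neg, abs_of_nonneg hβ]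
    exact mul_le_mul_of_nonneg_left (abs_primitive_inclL1_le q x) hβ
  have h2 : expTerm β A q x - A = A * (Real.exp (-β * y) - 1) := by rw [expTerm_apply]; ring
  rw [h2, abs_mul, abs_of_nonneg hA]
  calc A * |Real.exp (-β * y) - 1| ≤ A * (|(-β) * y| * Real.exp |(-β) * y|) :=
        mul_le_mul_of_nonneg_left (abs_exp_sub_one_le _) hA
    _ ≤ A * (β * ‖q‖ * Real.exp (β * ‖q‖)) := by gcongr
    _ = _ := by ring

/-- D⁻¹ kills constants, so u may be replaced by u - A, which is O(‖q‖) uniformly. The quadratic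
term is estimated through L¹ with constant 2, and u - A through L² with constant 1. The bound
obtained has 1 in place of 3. -/
lemma norm_riccati_le (hα : 0 ≤ α) (hβ : 0 ≤ β) (hA : 0 ≤ A) (q : L2T) :
    ‖riccati α β A q‖ ≤ ‖q‖ * (3 + 2 * α * ‖q‖ + β * A * Real.exp (β * ‖q‖)) := by
  have h1 : riccati α β A q = q + α • invDeriv (mulL2 q q)
      + invDeriv (inclL1 (toL2 (expTerm β A q - A • 1))) := by
    rw [riccati, lowerL1, inclL1_toL2, map_add, map_smul, map_sub toL1, map_smul, map_sub,
      map_smul, invDeriv_toL1_one, smul_zero, sub_zero, add_assoc]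
  have h2 : ‖invDeriv (mulL2 q q)‖ ≤ 2 * (‖q‖ * ‖q‖) :=
    (norm_invDeriv_le _).trans (mul_le_mul_of_nonneg_left (norm_mulL2_le q q) (by norm_num))
  have h3 : ‖invDeriv (inclL1 (toL2 (expTerm β A q - A • 1)))‖
      ≤ β * A * ‖q‖ * Real.exp (β * ‖q‖) := by
    refine (norm_invDeriv_inclL1_le _).trans (norm_toL2_le _ (by positivity) fun x _ => ?_)
    have := abs_expTerm_sub_le hβ hA q x
    simpa using this
  rw [h1]
  refine (norm_add₃_le).trans ?_
  rw [norm_smul, Real.norm_eq_abs, abs_of_nonneg hα]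
  have := mul_le_mul_of_nonneg_left h2 hα
  nlinarith [norm_nonneg q]

/-- The integrated form of u' = -βqu with u(0) = A. -/
lemma expTerm_eq_add_primitive (q : L2T) {x : ℝ} (hx : x ∈ Icc (0 : ℝ) 1) :
    expTerm β A q x = A + primitive ((-β) • mulBL1 (expTerm β A q) (inclL1 q)) x := by
  have h := exp_primitive ((-β) • inclL1 q) hx
  have h2 : mulBL1 (expB (primitive ((-β) • inclL1 q))) ((-β) • inclL1 q)
      = (-β) • mulBL1 (expB ((-β) • primitive (inclL1 q))) (inclL1 q) := by
    rw [map_smul, map_smul]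
  have h3 : mulBL1 (expTerm β A q) (inclL1 q)
      = A • mulBL1 (expB ((-β) • primitive (inclL1 q))) (inclL1 q) := by
    rw [expTerm, map_smul, smul_apply]
  rw [h2] at h
  rw [h3, smul_comm, map_smul, expTerm_apply]
  rw [map_smul primitive] at h
  simp only [BoundedContinuousFunction.coe_smul, smul_eq_mul] at h ⊢
  rw [h]
  ring

lemma primitive_inclL1_one_eq_zero {q : L2T} (hq : ∫ x in (0 : ℝ)..1, q x = 0) :
    primitive (inclL1 q) 1 = 0 := by rw [primitive_inclL1_one, hq]

lemma expTerm_one {q : L2T} (hq : ∫ x in (0 : ℝ)..1, q x = 0) : expTerm β A q 1 = A := by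
  rw [expTerm_apply, primitive_inclL1_one_eq_zero hq]; simp

/-! ### Energy identities for a mean-zero function with a weak derivative in L². -/

section Energy

variable {q dq : L2T} {ρ : ℝ →ᵇ ℝ} {c : ℝ}

/-- The integrand is (ρ³/3)' with ρ periodic. For absolutely continuous ρ this is reached by writing
ρ = c + v and integrating v dq and v² dq by parts. -/
lemma integral_deriv_mul_sq (hd0 : ∫ x in (0 : ℝ)..1, dq x = 0)
    (hρ : ∀ x, ρ x = c + primitive (inclL1 dq) x) :
    ∫ x in (0 : ℝ)..1, dq x * ρ x ^ 2 = 0 := by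
  set v := primitive (inclL1 dq)
  have hm : meanL1 (inclL1 dq) = 0 := by rw [meanL1_eq_primitive, primitive_inclL1_one, hd0]
  set b : L1T := (2 : ℝ) • mulBL1 v (inclL1 dq)
  have hb : b =ᵐ[periodMeasure] fun x => 2 * (v x * dq x) := by
    filter_upwards [Lp.coeFn_smul (2 : ℝ) (mulBL1 v (inclL1 dq)), coeFn_mulBL1 v (inclL1 dq),
      coeFn_inclL1 dq] with x h1 h2 h3
    rw [h1, Pi.smul_apply, h2, h3, smul_eq_mul]
  have hvb {x : ℝ} (hx : x ∈ Icc (0 : ℝ) 1) : primitive b x = v x ^ 2 := by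
    rw [pow_two, primitive_mul_primitive _ _ hx, map_smul, map_add,
      BoundedContinuousFunction.smul_apply, BoundedContinuousFunction.coe_add, Pi.add_apply,
      smul_eq_mul, two_mul]
  have h1 : ∫ x in (0 : ℝ)..1, v x * dq x = 0 := by
    have e := hvb (x := 1) (by simp)
    rw [primitive_one_of_ae hb, intervalIntegral.integral_const_mul] at e
    have e2 : v 1 = 0 := hm
    rw [e2] at e
    linarith
  have h2 : ∫ x in (0 : ℝ)..1, v x ^ 2 * dq x = 0 := by
    have e := integral_primitive_mul (inclL1 dq) b hm
    have e1 : ∫ x in (0 : ℝ)..1, v x * b x = 2 * ∫ x in (0 : ℝ)..1, v x ^ 2 * dq x := by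
      rw [← intervalIntegral.integral_const_mul]
      refine integral_period_congr ?_
      filter_upwards [hb] with x hx
      rw [hx]; ring
    have e2 : ∫ x in (0 : ℝ)..1, primitive b x * inclL1 dq x
        = ∫ x in (0 : ℝ)..1, v x ^ 2 * dq x := by
      refine integral_period_congr ?_
      filter_upwards [coeFn_inclL1 dq, ae_Icc] with x hx hx2
      rw [hx, hvb hx2]
    rw [e1, e2] at e
    linarith
  have i1 := intervalIntegrable_mul dq v.continuous
  have i2 : IntervalIntegrable (fun x => dq x * v x ^ 2) volume 0 1 :=
    intervalIntegrable_mul dq (v.continuous.pow 2)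
  have e : ∀ x, dq x * ρ x ^ 2
      = c ^ 2 * dq x + (2 * c * (dq x * v x) + dq x * v x ^ 2) := by
    intro x; rw [hρ]; ring
  simp only [e]
  rw [intervalIntegral.integral_add ((intervalIntegrable_L2T dq).const_mul _)
    ((i1.const_mul _).add i2), intervalIntegral.integral_add (i1.const_mul _) i2,
    intervalIntegral.integral_const_mul, intervalIntegral.integral_const_mul, hd0]
  simp only [mul_comm (dq _)]
  rw [h1, h2]
  ring

/-- Integration by parts with u' = -βqu. The boundary terms vanish because u, like q, is periodic
when q has mean zero. -/
lemma integral_deriv_mul_expTerm (hq0 : ∫ x in (0 : ℝ)..1, q x = 0)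
    (hd0 : ∫ x in (0 : ℝ)..1, dq x = 0) (hqρ : q =ᵐ[periodMeasure] ρ)
    (hρ : ∀ x, ρ x = c + primitive (inclL1 dq) x) :
    ∫ x in (0 : ℝ)..1, dq x * expTerm β A q x
      = β * ∫ x in (0 : ℝ)..1, expTerm β A q x * ρ x ^ 2 := by
  set u := expTerm β A q
  set v := primitive (inclL1 dq)
  have hm : meanL1 (inclL1 dq) = 0 := by rw [meanL1_eq_primitive, primitive_inclL1_one, hd0]
  set b : L1T := (-β) • mulBL1 u (inclL1 q)
  have hb : b =ᵐ[periodMeasure] fun x => -β * (u x * ρ x) := by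
    filter_upwards [Lp.coeFn_smul (-β) (mulBL1 u (inclL1 q)), coeFn_mulBL1 u (inclL1 q),
      coeFn_inclL1 q, hqρ] with x h1 h2 h3 h4
    rw [h1, Pi.smul_apply, h2, h3, h4, smul_eq_mul]
  have hub {x : ℝ} (hx : x ∈ Icc (0 : ℝ) 1) : u x = A + primitive b x :=
    expTerm_eq_add_primitive q hx
  have h0 : ∫ x in (0 : ℝ)..1, -β * (u x * ρ x) = 0 := by
    rw [← primitive_one_of_ae hb]
    have := hub (x := 1) (by simp)
    rw [expTerm_one hq0] at this
    linarith
  have h1 := integral_primitive_mul (inclL1 dq) b hm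
  have e1 : ∫ x in (0 : ℝ)..1, v x * b x
      = ∫ x in (0 : ℝ)..1, (-β * (u x * ρ x ^ 2) - c * (-β * (u x * ρ x))) := by
    refine integral_period_congr ?_
    filter_upwards [hb] with x hx
    have := hρ x
    rw [hx, show v x = ρ x - c by linarith]; ring
  have e2 : ∫ x in (0 : ℝ)..1, primitive b x * inclL1 dq x
      = ∫ x in (0 : ℝ)..1, (dq x * u x - dq x * A) := by
    refine integral_period_congr ?_
    filter_upwards [coeFn_inclL1 dq, ae_Icc] with x hx hx2
    rw [hx, hub hx2]; ring
  have c1 : Continuous fun x => -β * (u x * ρ x ^ 2) := by fun_prop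
  have c2 : Continuous fun x => c * (-β * (u x * ρ x)) := by fun_prop
  rw [e1, e2, intervalIntegral.integral_sub (c1.intervalIntegrable _ _)
    (c2.intervalIntegrable _ _), intervalIntegral.integral_const_mul c, h0,
    intervalIntegral.integral_sub (intervalIntegrable_mul dq u.continuous)
      ((intervalIntegrable_L2T dq).mul_const _), intervalIntegral.integral_mul_const, hd0,
    intervalIntegral.integral_const_mul] at h1
  linarith

/-- A mean-zero continuous function has a zero y, and ρ² has derivative 2q·dq. Going from y to x
along the better of the two arcs of the circle costs half the total variation, which removes the
factor 2. -/
lemma sq_le_of_integral_eq_zero (h0 : ∫ x in (0 : ℝ)..1, q x = 0)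
    (hd0 : ∫ x in (0 : ℝ)..1, dq x = 0) (hqρ : q =ᵐ[periodMeasure] ρ)
    (hρ : ∀ x, ρ x = c + primitive (inclL1 dq) x) {x : ℝ} (hx : x ∈ Icc (0 : ℝ) 1) :
    ρ x ^ 2 ≤ ‖q‖ * ‖dq‖ := by
  obtain ⟨y, hy, hy0⟩ : ∃ y ∈ Ioo (0 : ℝ) 1, ρ y = 0 := by
    refine exists_hasDerivAt_eq_zero (f := fun x => ∫ t in (0 : ℝ)..x, ρ t) zero_lt_one
      (continuous_iff_continuousAt.2 fun x => (hasDerivAt_integral ρ x).continuousAt).continuousOn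
      ?_ fun x _ => hasDerivAt_integral ρ x
    simp only [intervalIntegral.integral_same]
    rw [← integral_period_congr hqρ, h0]
  set v := primitive (inclL1 dq)
  set b : L1T := (2 : ℝ) • mulL2 q dq
  have hvb {x : ℝ} (hx : x ∈ Icc (0 : ℝ) 1) : primitive b x = ρ x ^ 2 - c ^ 2 := by
    have e : b = (2 * c) • inclL1 dq + (mulBL1 v (inclL1 dq) + mulBL1 v (inclL1 dq)) := by
      refine Lp.ext ?_
      filter_upwards [Lp.coeFn_smul (2 : ℝ) (mulL2 q dq), coeFn_mulL2 q dq,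
        Lp.coeFn_add ((2 * c) • inclL1 dq) (mulBL1 v (inclL1 dq) + mulBL1 v (inclL1 dq)),
        Lp.coeFn_add (mulBL1 v (inclL1 dq)) (mulBL1 v (inclL1 dq)),
        Lp.coeFn_smul (2 * c) (inclL1 dq), coeFn_mulBL1 v (inclL1 dq), coeFn_inclL1 dq, hqρ]
        with x h1 h2 h3 h4 h5 h6 h7 h8
      rw [h1, Pi.smul_apply, h2, h3, Pi.add_apply, h4, Pi.add_apply, h5, Pi.smul_apply, h6, h7,
        h8, hρ]
      simp only [smul_eq_mul]
      ring
    rw [e, map_add, BoundedContinuousFunction.coe_add, Pi.add_apply,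
      ← primitive_mul_primitive _ _ hx, map_smul, BoundedContinuousFunction.smul_apply,
      smul_eq_mul, hρ]
    ring
  have h1 : ρ x ^ 2 = primitive b x - primitive b y := by
    rw [hvb hx, hvb (Ioo_subset_Icc_self hy), hy0]; ring
  have hb1 : meanL1 b = 0 := by
    rw [meanL1_eq_primitive, hvb (by simp), hρ, primitive_inclL1_one, hd0]; ring
  have h2 := (le_abs_self _).trans
    (abs_primitive_sub_primitive_le b hb1 (Ioo_subset_Icc_self hy) hx)
  rw [norm_smul, Real.norm_ofNat, ← mul_assoc, one_div, inv_mul_cancel₀ two_ne_zero,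
    one_mul] at h2
  rw [h1]
  exact h2.trans (norm_mulL2_le q dq)

end Energy

end

/-! ### The two a priori estimates. -/

section

variable {α β A : ℝ}

lemma lowerTerm_ae_eq {q : L2T} {ρ : ℝ →ᵇ ℝ} (hqρ : q =ᵐ[periodMeasure] ρ) :
    lowerTerm α β A q =ᵐ[periodMeasure] (α • ρ ^ 2 + expTerm β A q : ℝ →ᵇ ℝ) := by
  filter_upwards [hqρ, ae_Icc] with x hx hx1
  rw [lowerTerm, hx, ← primitive_inclL1_eq_primQ q hx1, ← expTerm_apply]
  rfl

/-- The two-sided estimate of `‖q' + α q² + u - c₀‖` in terms of `‖q'‖` and `‖q‖`. -/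
lemma norm_sq_riccati_bounds (hα : 0 ≤ α) (hβ : 0 ≤ β) (hA : 0 ≤ A) {q dq p : L2T}
    (hq0 : ∫ x in (0 : ℝ)..1, q x = 0) (hd : IsWeakDeriv 1 q dq)
    (hp : ∀ᵐ x ∂periodMeasure, p x = dq x + lowerTerm α β A q x - meanTerm α β A q) :
    ‖dq‖ ^ 2 ≤ ‖p‖ ^ 2 ∧ ‖p‖ ^ 2 ≤ ‖dq‖ ^ 2 + 2 * α ^ 2 * ‖q‖ ^ 3 * ‖dq‖
      + A * (β + α) * (2 + β * A) * ‖q‖ ^ 2 * Real.exp (2 * β * ‖q‖) := by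
  obtain ⟨hd0, c, hqc⟩ := (isWeakDeriv_one_iff q dq).1 hd
  set ρ : ℝ →ᵇ ℝ := BoundedContinuousFunction.const ℝ c + primitive (inclL1 dq)
  have hρ (x : ℝ) : ρ x = c + primitive (inclL1 dq) x := rfl
  have hqρ : q =ᵐ[periodMeasure] ρ := hqc
  set u := expTerm β A q with hu
  set w : ℝ →ᵇ ℝ := α • ρ ^ 2 + u
  have hwx (x : ℝ) : w x = α * ρ x ^ 2 + u x := rfl
  have hlw := lowerTerm_ae_eq (α := α) (β := β) (A := A) hqρ
  set m := meanTerm α β A q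
  have hm : ∫ x in (0 : ℝ)..1, w x = m := (integral_period_congr hlw).symm
  have hpw : p = dq + (toL2 w - m • toL2 1) := by
    refine Lp.ext ?_
    filter_upwards [hp, hlw, Lp.coeFn_add dq (toL2 w - m • toL2 1),
      Lp.coeFn_sub (toL2 w) (m • toL2 1), Lp.coeFn_smul m (toL2 1), coeFn_toL2 w, coeFn_toL2 1]
      with x h1 h2 h3 h4 h5 h6 h7
    rw [h1, h2, h3, Pi.add_apply, h4, Pi.sub_apply, h5, Pi.smul_apply, h6, h7]
    simp only [BoundedContinuousFunction.coe_one, Pi.one_apply, smul_eq_mul, mul_one]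
    ring
  set I := ∫ x in (0 : ℝ)..1, u x * ρ x ^ 2
  -- The cross term of the energy identity: q² contributes nothing, and u contributes the
  -- nonnegative βI. This gives the lower bound.
  have hinner : inner ℝ dq (toL2 w - m • toL2 1) = β * I := by
    have i2 : IntervalIntegrable (fun x => dq x * ρ x ^ 2) volume 0 1 :=
      intervalIntegrable_mul dq (ρ.continuous.pow 2)
    rw [inner_sub_right, inner_smul_right, inner_toL2, inner_toL2,
      ← integral_deriv_mul_expTerm hq0 hd0 hqρ hρ]
    simp only [BoundedContinuousFunction.coe_one, Pi.one_apply, mul_one, hd0, mul_zero, sub_zero]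
    have e : ∀ x, dq x * w x = α * (dq x * ρ x ^ 2) + dq x * u x := by
      intro x; rw [hwx]; ring
    simp only [e]
    rw [intervalIntegral.integral_add (i2.const_mul _) (intervalIntegrable_mul dq u.continuous),
      intervalIntegral.integral_const_mul, integral_deriv_mul_sq hd0 hρ]
    ring
  have hI0 : 0 ≤ I := intervalIntegral.integral_nonneg zero_le_one fun x _ =>
    mul_nonneg (expTerm_nonneg β A hA q x) (sq_nonneg _)
  have hqq : ‖q‖ ^ 2 = ∫ x in (0 : ℝ)..1, ρ x ^ 2 := norm_sq_of_ae hqρ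
  set e := Real.exp (β * ‖q‖)
  have he0 : 0 < e := Real.exp_pos _
  have he1 : 1 ≤ e := Real.one_le_exp (by positivity)
  have hiρ : IntervalIntegrable (fun x => ρ x ^ 2) volume 0 1 :=
    (ρ.continuous.pow 2).intervalIntegrable _ _
  have hI1 : I ≤ A * e * ‖q‖ ^ 2 := by
    rw [hqq, ← intervalIntegral.integral_const_mul]
    refine intervalIntegral.integral_mono_on zero_le_one
      ((u.continuous.mul (ρ.continuous.pow 2)).intervalIntegrable _ _) (hiρ.const_mul _)
      fun x _ => mul_le_mul_of_nonneg_right (expTerm_le β A hβ hA q x) (sq_nonneg _)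
  have hW : ‖toL2 w - m • toL2 1‖ ^ 2 ≤ α ^ 2 * (‖q‖ * ‖dq‖) * ‖q‖ ^ 2
      + 2 * α * (A * e) * ‖q‖ ^ 2 + (β * A * ‖q‖ * e) ^ 2 := by
    -- The variance of w is at most its mean square distance to any constant. The constant A is
    -- chosen because u - A is small with ‖q‖.
    have h1 : toL2 w - m • toL2 1 = toL2 (w - A • 1)
        - (∫ x in (0 : ℝ)..1, toL2 (w - A • 1) x) • toL2 1 := by
      have : ∫ x in (0 : ℝ)..1, toL2 (w - A • 1) x = m - A := by
        rw [integral_period_congr (coeFn_toL2 (w - A • 1)), ← hm]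
        simp only [BoundedContinuousFunction.coe_sub, Pi.sub_apply,
          BoundedContinuousFunction.smul_apply, BoundedContinuousFunction.coe_one, Pi.one_apply,
          smul_eq_mul, mul_one]
        rw [intervalIntegral.integral_sub (w.continuous.intervalIntegrable _ _) (by simp)]
        simp
      rw [this, map_sub, map_smul, sub_smul]; abel
    have h2 : ‖toL2 w - m • toL2 1‖ ^ 2 ≤ ‖toL2 (w - A • 1)‖ ^ 2 := by
      rw [h1]
      exact pow_le_pow_left₀ (norm_nonneg _) (norm_sub_mean_le _) 2
    refine h2.trans ?_
    rw [norm_sq_of_ae (coeFn_toL2 _)]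
    have h3 : ∀ x ∈ Icc (0 : ℝ) 1, (w - A • 1 : ℝ →ᵇ ℝ) x ^ 2 ≤
        (α ^ 2 * (‖q‖ * ‖dq‖) + 2 * α * (A * e)) * ρ x ^ 2 + (β * A * ‖q‖ * e) ^ 2 := by
      intro x hx
      have e1 : (w - A • 1 : ℝ →ᵇ ℝ) x = α * ρ x ^ 2 + (u x - A) := by
        simp [hwx]; ring
      have e2 := sq_le_of_integral_eq_zero hq0 hd0 hqρ hρ hx
      have e3 : (u x - A) ^ 2 ≤ (β * A * ‖q‖ * e) ^ 2 :=
        sq_le_sq.2 ((abs_expTerm_sub_le hβ hA q x).trans (le_abs_self _))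
      have e4 : u x - A ≤ A * e := by linarith [expTerm_le β A hβ hA q x]
      have e5 := mul_le_mul_of_nonneg_left e4 (mul_nonneg hα (sq_nonneg (ρ x)))
      have e6 := mul_le_mul_of_nonneg_left e2 (mul_nonneg (sq_nonneg α) (sq_nonneg (ρ x)))
      rw [e1]
      nlinarith
    refine (intervalIntegral.integral_mono_on zero_le_one
      (((w - A • 1 : ℝ →ᵇ ℝ).continuous.pow 2).intervalIntegrable _ _)
      ((hiρ.const_mul _).add intervalIntegrable_const) h3).trans (le_of_eq ?_)
    rw [intervalIntegral.integral_add (hiρ.const_mul _) intervalIntegrable_const,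
      intervalIntegral.integral_const_mul, ← hqq]
    simp
    ring
  have hnorm : ‖p‖ ^ 2 = ‖dq‖ ^ 2 + 2 * (β * I) + ‖toL2 w - m • toL2 1‖ ^ 2 := by
    rw [hpw, norm_add_sq_real, hinner]
  have hβI := mul_nonneg hβ hI0
  refine ⟨by rw [hnorm]; nlinarith [sq_nonneg ‖toL2 w - m • toL2 1‖], ?_⟩
  have he2 : Real.exp (2 * β * ‖q‖) = e ^ 2 := by
    rw [← Real.exp_nat_mul]; congr 1; push_cast; ring
  rw [hnorm, he2]
  have h1 := mul_le_mul_of_nonneg_left hI1 hβ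
  have h2 : 0 ≤ α ^ 2 * ‖q‖ ^ 3 * ‖dq‖ := by positivity
  have h3 : A * (β + α) * ‖q‖ ^ 2 * e ≤ A * (β + α) * ‖q‖ ^ 2 * e ^ 2 := by
    refine mul_le_mul_of_nonneg_left ?_ (by positivity)
    nlinarith
  have h4 : 0 ≤ A ^ 2 * (β * α) * ‖q‖ ^ 2 * e ^ 2 := by positivity
  -- The constant expands as A(β + α)(2 + βA) = 2A(β + α) + β²A² + αβA². The first part absorbs the
  -- two terms linear in e through e ≤ e², and the second is the square of the bound for u - A. The
  -- term αβA² is slack (`h4`), as is half of the cubic term (`h2`).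
  linear_combination hW + 2 * h1 + 2 * h3 + h4 + h2

/-- The a priori bound of `q` in terms of `p`, where `p' = q' + q² + u - c₀`. -/
lemma norm_sq_le_of_riccati (hβ : 0 ≤ β) (hA : 0 ≤ A) {q : L2T}
    (hq0 : ∫ x in (0 : ℝ)..1, q x = 0) :
    ‖q‖ ^ 2 ≤ 2 * ‖riccati 1 β A q‖ ^ 2 * (1 + 2 * ‖riccati 1 β A q‖ ^ 2) := by
  set p := riccati 1 β A q with hp
  set E : ℝ →ᵇ ℝ := expB (primitive (inclL1 q))
  set u := expTerm β A q
  set N := lowerL1 1 β A q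
  have hE (x : ℝ) : E x = Real.exp (primitive (inclL1 q) x) := expB_apply _ _
  have hEpos (x : ℝ) : 0 < E x := by rw [hE]; exact Real.exp_pos _
  -- With ψ = e^Q and h = ψ' = ψq, the function b below is the derivative of ψ². The estimate is an
  -- energy estimate for ψ.
  set ψ := toL2 E
  set h := mulBL2 E q
  have hh : h =ᵐ[periodMeasure] fun x => E x * q x := coeFn_mulBL2 E q
  set b : L1T := (2 : ℝ) • mulL2 ψ h
  have hb : b =ᵐ[periodMeasure] fun x => 2 * (E x ^ 2 * q x) := by
    filter_upwards [Lp.coeFn_smul (2 : ℝ) (mulL2 ψ h), coeFn_mulL2 ψ h, coeFn_toL2 E, hh]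
      with x h1 h2 h3 h4
    rw [h1, Pi.smul_apply, h2, h3, h4, smul_eq_mul]
    ring
  have hVb {x : ℝ} (hx : x ∈ Icc (0 : ℝ) 1) : E x ^ 2 = 1 + primitive b x := by
    have e1 := exp_primitive ((2 : ℝ) • inclL1 q) hx
    have e2 : mulBL1 (expB (primitive ((2 : ℝ) • inclL1 q))) ((2 : ℝ) • inclL1 q) = b := by
      refine Lp.ext ?_
      filter_upwards [coeFn_mulBL1 (expB (primitive ((2 : ℝ) • inclL1 q))) ((2 : ℝ) • inclL1 q),
        Lp.coeFn_smul (2 : ℝ) (inclL1 q), coeFn_inclL1 q, hb] with x h1 h2 h3 h4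
      rw [h1, h2, Pi.smul_apply, h3, h4, expB_apply, map_smul,
        BoundedContinuousFunction.smul_apply, hE, smul_eq_mul, smul_eq_mul, ← Real.exp_nat_mul]
      push_cast; ring
    rw [e2, map_smul, BoundedContinuousFunction.smul_apply, smul_eq_mul] at e1
    rw [← e1, hE, ← Real.exp_nat_mul]
    push_cast; rfl
  have hb0 : meanL1 b = 0 := by
    have := hVb (x := 1) (by simp)
    rw [hE, primitive_inclL1_one, hq0, Real.exp_zero] at this
    rw [meanL1_eq_primitive]
    linarith
  set M := ∫ x in (0 : ℝ)..1, E x ^ 2 with hM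
  have hψM : ‖ψ‖ ^ 2 = M := norm_sq_of_ae (coeFn_toL2 E)
  have hhB : ‖h‖ ^ 2 = ∫ x in (0 : ℝ)..1, E x ^ 2 * q x ^ 2 := by
    rw [norm_sq_of_ae hh]; simp only [mul_pow]
  have iE : IntervalIntegrable (fun x => E x ^ 2) volume 0 1 :=
    (E.continuous.pow 2).intervalIntegrable _ _
  have iu : IntervalIntegrable u volume 0 1 := u.continuous.intervalIntegrable _ _
  have iuE : IntervalIntegrable (fun x => u x * E x ^ 2) volume 0 1 :=
    (u.continuous.mul (E.continuous.pow 2)).intervalIntegrable _ _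
  have iq : IntervalIntegrable (fun x => q x ^ 2) volume 0 1 := by
    rw [intervalIntegrable_iff_integrableOn_Ioc_of_le zero_le_one]
    exact (Lp.memLp q).integrable_sq
  have iqE : IntervalIntegrable (fun x => E x ^ 2 * q x ^ 2) volume 0 1 :=
    iq.continuousOn_mul (E.continuous.pow 2).continuousOn
  have hMpos : 0 < M := intervalIntegral.intervalIntegral_pos_of_pos_on iE
    (fun x _ => pow_pos (hEpos x) 2) zero_lt_one
  have hmean : meanL1 N = ‖q‖ ^ 2 + ∫ x in (0 : ℝ)..1, u x := by
    have : N =ᵐ[periodMeasure] fun x => q x ^ 2 + u x := by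
      filter_upwards [coeFn_lowerL1 1 β A q, ae_Icc] with x hx hx1
      rw [hx, lowerTerm, one_mul, ← primitive_inclL1_eq_primQ q hx1, ← expTerm_apply]
    rw [meanL1_of_ae this, intervalIntegral.integral_add iq iu, norm_sq_L2T]
  have hcN : center N =ᵐ[periodMeasure] fun x => q x ^ 2 + u x - meanL1 N := by
    filter_upwards [coeFn_center N, coeFn_lowerL1 1 β A q, ae_Icc] with x h1 hx hx1
    rw [h1, hx, lowerTerm, one_mul, ← primitive_inclL1_eq_primQ q hx1, ← expTerm_apply]
  -- the identity obtained by testing the equation with `e^{2Q}`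
  have hid : 2 * inner ℝ p (mulBL2 E h) = ‖h‖ ^ 2 - (∫ x in (0 : ℝ)..1, u x * E x ^ 2)
      + meanL1 N * M := by
    set k := meanL1 (toL1 (primitive (center N)))
    have e1 : 2 * inner ℝ p (mulBL2 E h) = ∫ x in (0 : ℝ)..1,
        (2 * (E x ^ 2 * q x ^ 2) + (primitive (center N) x * b x - k * b x)) := by
      rw [inner_L2T, ← intervalIntegral.integral_const_mul]
      refine integral_period_congr ?_
      filter_upwards [Lp.coeFn_add q (invDeriv N), coeFn_invDeriv N, coeFn_mulBL2 E h, hh, hb]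
        with x h1 h2 h3 h4 h5
      rw [hp, riccati, h1, Pi.add_apply, h2, periodicPrimitive_apply, h3, h4, h5]
      ring
    have ib := intervalIntegrable_L1T b
    have ib2 : IntervalIntegrable (fun x => primitive (center N) x * b x) volume 0 1 :=
      ib.continuousOn_mul (primitive (center N)).continuous.continuousOn
    have e2 : ∫ x in (0 : ℝ)..1, primitive b x * center N x = ∫ x in (0 : ℝ)..1,
        (E x ^ 2 * q x ^ 2 + u x * E x ^ 2 - meanL1 N * E x ^ 2 - center N x) := by
      refine integral_period_congr ?_
      filter_upwards [hcN, ae_Icc] with x h1 hx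
      have := hVb hx
      rw [h1, show primitive b x = E x ^ 2 - 1 by linarith]
      ring
    rw [e1, intervalIntegral.integral_add (iqE.const_mul _) (ib2.sub (ib.const_mul _)),
      intervalIntegral.integral_sub ib2 (ib.const_mul _), intervalIntegral.integral_const_mul,
      intervalIntegral.integral_const_mul, ← meanL1_apply, hb0,
      integral_primitive_mul _ _ (meanL1_center N), e2,
      intervalIntegral.integral_sub ((iqE.add iuE).sub (iE.const_mul _))
        (intervalIntegrable_L1T _), intervalIntegral.integral_sub (iqE.add iuE) (iE.const_mul _),
      intervalIntegral.integral_add iqE iuE, intervalIntegral.integral_const_mul,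
      ← meanL1_apply, meanL1_center, ← hhB, ← hM]
    ring
  -- Chebyshev's inequality for `u` and `e^{2Q}`
  have hcheb : ∫ x in (0 : ℝ)..1, u x * E x ^ 2 ≤ M * ∫ x in (0 : ℝ)..1, u x := by
    -- At the level Q = s the increasing function e^{2Q} equals its mean M and u equals v. Hence (u
    -- - v)(e^{2Q} - M) ≤ 0 pointwise, and integration gives the claim.
    set s := Real.log M / 2
    have hs : Real.exp (2 * s) = M := by
      rw [show 2 * s = Real.log M by simp only [s]; ring, Real.exp_log hMpos]
    set v := A * Real.exp (-β * s)
    have hpt (x : ℝ) : u x * E x ^ 2 ≤ M * u x + (v * E x ^ 2 - v * M) := by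
      have hux : u x = A * Real.exp (-β * primitive (inclL1 q) x) := expTerm_apply β A q x
      have hEx : E x ^ 2 = Real.exp (2 * primitive (inclL1 q) x) := by
        rw [hE, ← Real.exp_nat_mul]; push_cast; rfl
      set y := primitive (inclL1 q) x
      have : (u x - v) * (E x ^ 2 - M) ≤ 0 := by
        rw [hux, hEx, ← hs, ← mul_sub]
        rcases le_total y s with hys | hys
        · refine mul_nonpos_of_nonneg_of_nonpos (mul_nonneg hA (sub_nonneg.2 ?_))
            (sub_nonpos.2 ?_) <;> exact Real.exp_le_exp.2 (by nlinarith)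
        · refine mul_nonpos_of_nonpos_of_nonneg
            (mul_nonpos_of_nonneg_of_nonpos hA (sub_nonpos.2 ?_)) (sub_nonneg.2 ?_) <;>
            exact Real.exp_le_exp.2 (by nlinarith)
      linarith
    refine (intervalIntegral.integral_mono_on zero_le_one iuE ((iu.const_mul _).add
      ((iE.const_mul _).sub intervalIntegrable_const)) fun x _ => hpt x).trans (le_of_eq ?_)
    rw [intervalIntegral.integral_add (iu.const_mul _)
      ((iE.const_mul _).sub intervalIntegrable_const),
      intervalIntegral.integral_sub (iE.const_mul _) intervalIntegrable_const,
      intervalIntegral.integral_const_mul, intervalIntegral.integral_const_mul, ← hM]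
    simp
  -- The maximum of ψ² exceeds its mean by at most half the total variation of ψ², which is at most
  -- ‖ψ‖‖ψ'‖.
  have hsup {x : ℝ} (hx : x ∈ Icc (0 : ℝ) 1) : E x ^ 2 ≤ M + ‖ψ‖ * ‖h‖ := by
    have hbn : 1 / 2 * ‖b‖ ≤ ‖ψ‖ * ‖h‖ := by
      have := norm_mulL2_le ψ h
      rw [norm_smul, Real.norm_ofNat]
      linarith
    have hpt : ∀ y ∈ Icc (0 : ℝ) 1, E x ^ 2 - ‖ψ‖ * ‖h‖ ≤ E y ^ 2 := by
      intro y hy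
      have := (le_abs_self _).trans (abs_primitive_sub_primitive_le b hb0 hy hx)
      rw [hVb hx, hVb hy]
      linarith
    have := intervalIntegral.integral_mono_on zero_le_one
      (intervalIntegrable_const (μ := volume)) iE hpt
    simp only [intervalIntegral.integral_const, sub_zero, one_smul] at this
    linarith
  have hEh : ‖mulBL2 E h‖ ^ 2 ≤ (M + ‖ψ‖ * ‖h‖) * ‖h‖ ^ 2 := by
    rw [norm_sq_of_ae (coeFn_mulBL2 E h), norm_sq_L2T h, ← intervalIntegral.integral_const_mul]
    have ih : IntervalIntegrable (fun x => h x ^ 2) volume 0 1 := by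
      rw [intervalIntegrable_iff_integrableOn_Ioc_of_le zero_le_one]
      exact (Lp.memLp h).integrable_sq
    refine intervalIntegral.integral_mono_on zero_le_one ?_ (ih.const_mul _) fun x hx => ?_
    · simp only [mul_pow]
      exact ih.continuousOn_mul (E.continuous.pow 2).continuousOn
    · rw [mul_pow]
      exact mul_le_mul_of_nonneg_right (hsup hx) (sq_nonneg _)
  set P := ‖p‖
  set a := ‖ψ‖
  set d := ‖h‖
  set n := ‖mulBL2 E h‖
  have hcs : inner ℝ p (mulBL2 E h) ≤ P * n := real_inner_le_norm _ _
  rw [hmean] at hid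
  -- By Chebyshev's inequality the terms with u in `hid` have the favourable sign and drop out.
  have hmain : ‖q‖ ^ 2 * a ^ 2 + d ^ 2 ≤ 2 * (P * n) := by
    rw [hψM]; nlinarith
  have hP0 : 0 ≤ P := norm_nonneg _
  have ha0 : 0 ≤ a := norm_nonneg _
  have hd0 : 0 ≤ d := norm_nonneg _
  have ha : 0 < a ^ 2 := by rw [hψM]; exact hMpos
  have hn : n ^ 2 ≤ (a ^ 2 + a * d) * d ^ 2 := by rw [hψM]; exact hEh
  have hn2 : n ≤ Real.sqrt (a ^ 2 + a * d) * d := by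
    refine le_of_sq_le_sq ?_ (by positivity)
    rw [mul_pow, Real.sq_sqrt (by positivity)]
    exact hn
  -- Young's inequality, here and in `h2`, spends d²/2 each time. Together they use up exactly the
  -- d² on the left of `hmain`, and a² then cancels.
  have h1 : 2 * (P * n) ≤ 2 * P ^ 2 * (a ^ 2 + a * d) + d ^ 2 / 2 := by
    set r := Real.sqrt (a ^ 2 + a * d)
    have hr : r ^ 2 = a ^ 2 + a * d := Real.sq_sqrt (by positivity)
    have e1 := mul_le_mul_of_nonneg_left hn2 hP0
    rw [← hr]
    nlinarith [sq_nonneg (2 * P * r - d)]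
  have h2 : 2 * P ^ 2 * (a * d) ≤ 2 * P ^ 4 * a ^ 2 + d ^ 2 / 2 := by
    nlinarith [sq_nonneg (2 * P ^ 2 * a - d)]
  have h3 : ‖q‖ ^ 2 * a ^ 2 ≤ (2 * P ^ 2 + 2 * P ^ 4) * a ^ 2 := by linarith
  have h4 := le_of_mul_le_mul_right h3 ha
  nlinarith [pow_nonneg hP0 4]

end

/-! ### Weak derivatives of higher order -/

lemma IsWeakDeriv.trans {i j : ℕ} {q g h : L2T} (hq : IsWeakDeriv i q g)
    (hg : IsWeakDeriv j g h) : IsWeakDeriv (i + j) q h := by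
  intro φ hφ
  have e : iteratedDeriv (i + j) φ = iteratedDeriv i (iteratedDeriv j φ) := by
    simp only [iteratedDeriv_eq_iterate, Function.iterate_add_apply]
  rw [e, hq _ (TestFn.iteratedDeriv_mem hφ j), hg φ hφ, pow_add, mul_assoc]

lemma IsWeakDeriv.integral_eq_zero {q g : L2T} (h : IsWeakDeriv 1 q g) :
    ∫ x in (0 : ℝ)..1, g x = 0 := ((isWeakDeriv_one_iff q g).1 h).1

lemma integral_L2T_add (q r : L2T) : ∫ x in (0 : ℝ)..1, (q + r : L2T) x
    = (∫ x in (0 : ℝ)..1, q x) + ∫ x in (0 : ℝ)..1, r x := by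
  simpa only [mul_one] using integral_add_mul q r (continuous_const (y := (1 : ℝ)))

lemma integral_L2T_smul (c : ℝ) (q : L2T) : ∫ x in (0 : ℝ)..1, (c • q : L2T) x
    = c * ∫ x in (0 : ℝ)..1, q x := by
  simpa only [mul_one] using integral_smul_mul c q fun _ => 1

lemma integral_toL2_one : ∫ x in (0 : ℝ)..1, toL2 1 x = 1 := by
  rw [integral_period_congr (coeFn_toL2 1)]; simp

lemma isWeakDeriv_one_const (c : ℝ) : IsWeakDeriv 1 (c • toL2 1) 0 := by
  rw [isWeakDeriv_one_iff]
  refine ⟨by simp, c, ?_⟩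
  filter_upwards [Lp.coeFn_smul c (toL2 1), coeFn_toL2 1] with x h1 h2
  rw [h1, Pi.smul_apply, h2]
  simp

/-- The mean-zero primitive as an operator in `L²`. -/
def invDerivL2 : L2T →L[ℝ] L2T := invDeriv.comp inclL1

lemma isWeakDeriv_invDerivL2 {g : L2T} (hg : ∫ x in (0 : ℝ)..1, g x = 0) :
    IsWeakDeriv 1 (invDerivL2 g) g := isWeakDeriv_invDeriv hg

lemma integral_invDerivL2 (g : L2T) : ∫ x in (0 : ℝ)..1, invDerivL2 g x = 0 :=
  integral_invDeriv _

lemma IsWeakDeriv.eq_of_integral_eq {j : ℕ} {q r g : L2T} (hq : IsWeakDeriv j q g)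
    (hr : IsWeakDeriv j r g)
    (h : ∫ x in (0 : ℝ)..1, q x = ∫ x in (0 : ℝ)..1, r x) : q = r := by
  have h1 : IsWeakDeriv j (q + (-1 : ℝ) • r) 0 := by
    simpa using hq.add (hr.smul (-1))
  have h2 := h1.eq_zero (by rw [integral_L2T_add, integral_L2T_smul, h]; ring)
  rwa [neg_one_smul, add_neg_eq_zero] at h2

lemma IsWeakDeriv.eq_mean_add {q g : L2T} (h : IsWeakDeriv 1 q g) :
    q = (∫ x in (0 : ℝ)..1, q x) • toL2 1 + invDerivL2 g := by
  refine h.eq_of_integral_eq (r := (∫ x in (0 : ℝ)..1, q x) • toL2 1 + invDerivL2 g) ?_ ?_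
  · simpa using (isWeakDeriv_one_const _).add (isWeakDeriv_invDerivL2 h.integral_eq_zero)
  · rw [integral_L2T_add, integral_L2T_smul, integral_toL2_one, integral_invDerivL2]; ring

lemma IsWeakDeriv.eq_invDerivL2 {q g : L2T} (h : IsWeakDeriv 1 q g)
    (hq : ∫ x in (0 : ℝ)..1, q x = 0) : q = invDerivL2 g := by
  conv_lhs => rw [h.eq_mean_add, hq, zero_smul, zero_add]

/-- The product rule for weak derivatives. -/
lemma IsWeakDeriv.mul {q q' r r' s s' : L2T} (hq : IsWeakDeriv 1 q q') (hr : IsWeakDeriv 1 r r')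
    (hs : s =ᵐ[periodMeasure] fun x => q x * r x)
    (hs' : s' =ᵐ[periodMeasure] fun x => q' x * r x + q x * r' x) : IsWeakDeriv 1 s s' := by
  obtain ⟨hq0, c, hqc⟩ := (isWeakDeriv_one_iff q q').1 hq
  obtain ⟨hr0, d, hrd⟩ := (isWeakDeriv_one_iff r r').1 hr
  set v := primitive (inclL1 q')
  set w := primitive (inclL1 r')
  have e : inclL1 s' = c • inclL1 r' + d • inclL1 q'
      + (mulBL1 v (inclL1 r') + mulBL1 w (inclL1 q')) := by
    refine Lp.ext ?_
    filter_upwards [coeFn_inclL1 s', hs', hqc, hrd, coeFn_inclL1 q', coeFn_inclL1 r',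
      coeFn_mulBL1 v (inclL1 r'), coeFn_mulBL1 w (inclL1 q'),
      Lp.coeFn_add (c • inclL1 r' + d • inclL1 q')
        (mulBL1 v (inclL1 r') + mulBL1 w (inclL1 q')),
      Lp.coeFn_add (c • inclL1 r') (d • inclL1 q'),
      Lp.coeFn_add (mulBL1 v (inclL1 r')) (mulBL1 w (inclL1 q')),
      Lp.coeFn_smul c (inclL1 r'), Lp.coeFn_smul d (inclL1 q')]
      with x h1 h2 h3 h4 h5 h6 h7 h8 h9 h10 h11 h12 h13
    rw [h1, h2, h3, h4, h9, Pi.add_apply, h10, Pi.add_apply, h11, Pi.add_apply, h12, h13,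
      Pi.smul_apply, Pi.smul_apply, h7, h8, h5, h6, smul_eq_mul, smul_eq_mul]
    ring
  have hV {x : ℝ} (hx : x ∈ Icc (0 : ℝ) 1) :
      primitive (inclL1 s') x = (c + v x) * (d + w x) - c * d := by
    rw [e, map_add, BoundedContinuousFunction.coe_add, Pi.add_apply,
      ← primitive_mul_primitive _ _ hx, map_add, map_smul, map_smul,
      BoundedContinuousFunction.coe_add, Pi.add_apply, BoundedContinuousFunction.smul_apply,
      BoundedContinuousFunction.smul_apply, smul_eq_mul, smul_eq_mul]
    ring
  rw [isWeakDeriv_one_iff]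
  refine ⟨?_, c * d, ?_⟩
  · rw [← primitive_inclL1_one, hV (by simp), primitive_inclL1_one, primitive_inclL1_one, hq0,
      hr0]
    ring
  · filter_upwards [hs, hqc, hrd, ae_Icc] with x h1 h2 h3 hx
    rw [h1, h2, h3, hV hx]
    ring

/-- The relation u' = -βqu shows that u has one more derivative than q; mean zero of q makes u
periodic. -/
lemma isWeakDeriv_expTerm {β A : ℝ} {q : L2T} (hq : ∫ x in (0 : ℝ)..1, q x = 0) :
    IsWeakDeriv 1 (toL2 (expTerm β A q)) ((-β) • mulBL2 (expTerm β A q) q) := by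
  have e : inclL1 ((-β) • mulBL2 (expTerm β A q) q)
      = (-β) • mulBL1 (expTerm β A q) (inclL1 q) := by
    rw [map_smul]
    congr 1
    refine Lp.ext ?_
    filter_upwards [coeFn_inclL1 (mulBL2 (expTerm β A q) q), coeFn_mulBL2 (expTerm β A q) q,
      coeFn_mulBL1 (expTerm β A q) (inclL1 q), coeFn_inclL1 q] with x h1 h2 h3 h4
    rw [h1, h2, h3, h4]
  rw [isWeakDeriv_one_iff]
  refine ⟨?_, A, ?_⟩
  · rw [← primitive_inclL1_one, e]
    have := expTerm_eq_add_primitive (β := β) (A := A) q (x := 1) (by simp)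
    rw [expTerm_one hq] at this
    linarith
  · filter_upwards [coeFn_toL2 (expTerm β A q), ae_Icc] with x h1 hx
    rw [h1, expTerm_eq_add_primitive q hx, e]

/-! ### Analytic families of Sobolev functions -/

section AnalyticFamilies

variable {E : Type*} [NormedAddCommGroup E] [NormedSpace ℝ E]

/-- A family of functions in `L²` whose weak derivatives up to order `k` exist in `L²` and depend
analytically on the parameter. -/
def AnalyticSobolev : ℕ → (E → L2T) → Prop
  | 0, Φ => ∀ e, AnalyticAt ℝ Φ e
  | k + 1, Φ => (∀ e, AnalyticAt ℝ Φ e) ∧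
      ∃ Φ' : E → L2T, AnalyticSobolev k Φ' ∧ ∀ e, IsWeakDeriv 1 (Φ e) (Φ' e)

namespace AnalyticSobolev

lemma analyticAt {k : ℕ} {Φ : E → L2T} (h : AnalyticSobolev k Φ) (e : E) : AnalyticAt ℝ Φ e := by
  cases k with
  | zero => exact h e
  | succ k => exact h.1 e

lemma of_succ {k : ℕ} {Φ : E → L2T} (h : AnalyticSobolev (k + 1) Φ) : AnalyticSobolev k Φ := by
  induction k generalizing Φ with
  | zero => exact h.1
  | succ k ih =>
    obtain ⟨h1, Φ', h2, h3⟩ := h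
    exact ⟨h1, Φ', ih h2, h3⟩

lemma add {k : ℕ} {Φ Ψ : E → L2T} (hΦ : AnalyticSobolev k Φ) (hΨ : AnalyticSobolev k Ψ) :
    AnalyticSobolev k (fun e => Φ e + Ψ e) := by
  induction k generalizing Φ Ψ with
  | zero => exact fun e => (hΦ e).add (hΨ e)
  | succ k ih =>
    obtain ⟨h1, Φ', h2, h3⟩ := hΦ
    obtain ⟨g1, Ψ', g2, g3⟩ := hΨ
    exact ⟨fun e => (h1 e).add (g1 e), _, ih h2 g2, fun e => (h3 e).add (g3 e)⟩

lemma const_smul {k : ℕ} {Φ : E → L2T} (c : ℝ) (hΦ : AnalyticSobolev k Φ) :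
    AnalyticSobolev k (fun e => c • Φ e) := by
  induction k generalizing Φ with
  | zero => exact fun e => AnalyticAt.clm_comp (c • ContinuousLinearMap.id ℝ L2T) (hΦ e)
  | succ k ih =>
    obtain ⟨h1, Φ', h2, h3⟩ := hΦ
    exact ⟨fun e => AnalyticAt.clm_comp (c • ContinuousLinearMap.id ℝ L2T) (h1 e), _, ih h2,
      fun e => (h3 e).smul c⟩

lemma neg {k : ℕ} {Φ : E → L2T} (hΦ : AnalyticSobolev k Φ) :
    AnalyticSobolev k (fun e => - Φ e) := by
  simpa using hΦ.const_smul (-1)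

protected lemma zero (k : ℕ) : AnalyticSobolev k (fun _ : E => 0) := by
  induction k with
  | zero => exact fun e => analyticAt_const
  | succ k ih => exact ⟨fun e => analyticAt_const, _, ih, fun e => isWeakDeriv_zero 1⟩

lemma smul_one (k : ℕ) {m : E → ℝ} (hm : ∀ e, AnalyticAt ℝ m e) :
    AnalyticSobolev k (fun e => m e • toL2 1) := by
  have h (e : E) : AnalyticAt ℝ (fun e => m e • toL2 1) e := (hm e).smul analyticAt_const
  cases k with
  | zero => exact h
  | succ k => exact ⟨h, _, AnalyticSobolev.zero k, fun e => isWeakDeriv_one_const _⟩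

lemma invDerivL2 {k : ℕ} {Φ : E → L2T} (hΦ : AnalyticSobolev k Φ)
    (h0 : ∀ e, ∫ x in (0 : ℝ)..1, Φ e x = 0) :
    AnalyticSobolev (k + 1) (fun e => RiccatiTorus.invDerivL2 (Φ e)) :=
  ⟨fun e => AnalyticAt.clm_comp _ (hΦ.analyticAt e), Φ, hΦ, fun e => isWeakDeriv_invDerivL2 (h0 e)⟩

/-- An analytic family in `H¹` is an analytic family of continuous functions. -/
lemma exists_continuous {k : ℕ} {Φ : E → L2T} (hΦ : AnalyticSobolev (k + 1) Φ) :
    ∃ R : E → (ℝ →ᵇ ℝ), (∀ e, AnalyticAt ℝ R e) ∧ ∀ e, Φ e = toL2 (R e) := by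
  obtain ⟨h1, Φ', h2, h3⟩ := hΦ
  refine ⟨fun e => (meanL1.smulRight (1 : ℝ →ᵇ ℝ)) (inclL1 (Φ e))
    + periodicPrimitive (inclL1 (Φ' e)), fun e => ?_, fun e => ?_⟩
  · exact (AnalyticAt.clm_comp ((meanL1.smulRight (1 : ℝ →ᵇ ℝ)).comp inclL1) (h1 e)).add
      (AnalyticAt.clm_comp (periodicPrimitive.comp inclL1) (h2.analyticAt e))
  · conv_lhs => rw [(h3 e).eq_mean_add]
    rw [map_add, ContinuousLinearMap.smulRight_apply, map_smul, meanL1_of_ae (coeFn_inclL1 (Φ e))]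
    rfl

/-- In (ΦΨ)' = Φ'Ψ + ΦΨ' each product has one factor of order k and one of order k + 1. The
asymmetric statement at level k is therefore what is needed; it is a hypothesis here so that `mul`
can use this step in its own induction. -/
lemma mul_succ_of_mul {k : ℕ} (ih : ∀ Φ Ψ Θ : E → L2T, AnalyticSobolev k Φ →
      AnalyticSobolev (k + 1) Ψ → (∀ e, Θ e =ᵐ[periodMeasure] fun x => Φ e x * Ψ e x) →
      AnalyticSobolev k Θ)
    {Φ Ψ Θ : E → L2T} (hΦ : AnalyticSobolev (k + 1) Φ) (hΨ : AnalyticSobolev (k + 1) Ψ)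
    (hΘ : ∀ e, Θ e =ᵐ[periodMeasure] fun x => Φ e x * Ψ e x) : AnalyticSobolev (k + 1) Θ := by
  obtain ⟨R, hR, hRΦ⟩ := hΦ.exists_continuous
  obtain ⟨S, hS, hSΨ⟩ := hΨ.exists_continuous
  have hRae (e : E) : R e =ᵐ[periodMeasure] Φ e := by
    rw [hRΦ e]; exact (coeFn_toL2 _).symm
  have hSae (e : E) : S e =ᵐ[periodMeasure] Ψ e := by
    rw [hSΨ e]; exact (coeFn_toL2 _).symm
  obtain ⟨-, Φ', hΦ', hd⟩ := id hΦ
  obtain ⟨-, Ψ', hΨ', gd⟩ := id hΨ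
  have e1 : Θ = fun e => mulBL2 (R e) (Ψ e) := by
    funext e
    refine Lp.ext ?_
    filter_upwards [hΘ e, coeFn_mulBL2 (R e) (Ψ e), hRae e] with x h1 h2 h3
    rw [h1, h2, h3]
  refine ⟨fun e => ?_, fun e => mulBL2 (S e) (Φ' e) + mulBL2 (R e) (Ψ' e), AnalyticSobolev.add ?_ ?_,
    fun e => (hd e).mul (gd e) (hΘ e) ?_⟩
  · rw [e1]
    exact AnalyticAt.clm_apply₂ mulBL2 (hR e) (hΨ.analyticAt e)
  · refine ih Φ' Ψ _ hΦ' hΨ fun e => ?_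
    filter_upwards [coeFn_mulBL2 (S e) (Φ' e), hSae e] with x h1 h2
    rw [h1, h2, mul_comm]
  · refine ih Ψ' Φ _ hΨ' hΦ fun e => ?_
    filter_upwards [coeFn_mulBL2 (R e) (Ψ' e), hRae e] with x h1 h2
    rw [h1, h2, mul_comm]
  · filter_upwards [coeFn_mulBL2 (S e) (Φ' e), hSae e, coeFn_mulBL2 (R e) (Ψ' e), hRae e,
      Lp.coeFn_add (mulBL2 (S e) (Φ' e)) (mulBL2 (R e) (Ψ' e))] with x h1 h2 h3 h4 h5
    rw [h5, Pi.add_apply, h1, h2, h3, h4]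
    ring

/-- The extra order on Ψ makes the case k = 0 meaningful: an L² function times a continuous one
stays in L². -/
lemma mul {k : ℕ} : ∀ Φ Ψ Θ : E → L2T, AnalyticSobolev k Φ →
    AnalyticSobolev (k + 1) Ψ → (∀ e, Θ e =ᵐ[periodMeasure] fun x => Φ e x * Ψ e x) →
    AnalyticSobolev k Θ := by
  induction k with
  | zero =>
    intro Φ Ψ Θ hΦ hΨ hΘ
    obtain ⟨S, hS, hSΨ⟩ := hΨ.exists_continuous
    have e1 : Θ = fun e => mulBL2 (S e) (Φ e) := by
      funext e
      refine Lp.ext ?_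
      have hSae : S e =ᵐ[periodMeasure] Ψ e := by
        rw [hSΨ e]; exact (coeFn_toL2 _).symm
      filter_upwards [hΘ e, coeFn_mulBL2 (S e) (Φ e), hSae] with x h1 h2 h3
      rw [h1, h2, h3, mul_comm]
    rw [e1]
    exact fun e => AnalyticAt.clm_apply₂ mulBL2 (hS e) (hΦ e)
  | succ k ih =>
    intro Φ Ψ Θ hΦ hΨ hΘ
    exact mul_succ_of_mul ih hΦ hΨ.of_succ hΘ

lemma mul_succ {k : ℕ} {Φ Ψ Θ : E → L2T} (hΦ : AnalyticSobolev (k + 1) Φ)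
    (hΨ : AnalyticSobolev (k + 1) Ψ)
    (hΘ : ∀ e, Θ e =ᵐ[periodMeasure] fun x => Φ e x * Ψ e x) : AnalyticSobolev (k + 1) Θ :=
  mul_succ_of_mul mul hΦ hΨ hΘ

/-- Induction on u' = -βqu: the right side has the order of q once u is known to have it. -/
lemma expTerm (β A : ℝ) {k : ℕ} {Φ : E → L2T} (hΦ : AnalyticSobolev k Φ)
    (h0 : ∀ e, ∫ x in (0 : ℝ)..1, Φ e x = 0) :
    AnalyticSobolev (k + 1) (fun e => toL2 (RiccatiTorus.expTerm β A (Φ e))) := by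
  have han (e : E) : AnalyticAt ℝ (fun e => RiccatiTorus.expTerm β A (Φ e)) e :=
    AnalyticAt.comp (g := RiccatiTorus.expTerm β A) (analyticAt_expTerm β A (Φ e)) (hΦ.analyticAt e)
  induction k with
  | zero =>
    exact ⟨fun e => AnalyticAt.clm_comp _ (han e), _,
      const_smul (k := 0) (-β) fun e => AnalyticAt.clm_apply₂ mulBL2 (han e) (hΦ e),
      fun e => isWeakDeriv_expTerm (h0 e)⟩
  | succ k ih =>
    refine ⟨fun e => AnalyticAt.clm_comp _ (han e), _, const_smul (-β) ?_,
      fun e => isWeakDeriv_expTerm (h0 e)⟩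
    refine mul_succ hΦ (ih hΦ.of_succ) fun e => ?_
    filter_upwards [coeFn_mulBL2 (RiccatiTorus.expTerm β A (Φ e)) (Φ e),
      coeFn_toL2 (RiccatiTorus.expTerm β A (Φ e))] with x h1 h2
    rw [h1, h2, mul_comm]

lemma exists_isWeakDeriv {k : ℕ} {Φ : E → L2T} (hΦ : AnalyticSobolev k Φ) :
    ∃ Φ' : E → L2T, (∀ e, AnalyticAt ℝ Φ' e) ∧ ∀ e, IsWeakDeriv k (Φ e) (Φ' e) := by
  induction k generalizing Φ with
  | zero =>
    refine ⟨Φ, hΦ, fun e φ _ => ?_⟩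
    simp
  | succ k ih =>
    obtain ⟨-, Φ', h2, h3⟩ := hΦ
    obtain ⟨Φ'', h4, h5⟩ := ih h2
    refine ⟨Φ'', h4, fun e => ?_⟩
    rw [add_comm]
    exact (h3 e).trans (h5 e)

end AnalyticSobolev

end AnalyticFamilies

/-! ### Analytic maps into and out of `ℋ_j` -/

lemma integral_invDerivL2_iterate (j : ℕ) {g : L2T} (hg : ∫ x in (0 : ℝ)..1, g x = 0) :
    ∫ x in (0 : ℝ)..1, (invDerivL2 ^ j) g x = 0 := by
  cases j with
  | zero => simpa using hg
  | succ j => rw [pow_succ', mul_apply_eq_comp]; exact integral_invDerivL2 _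

lemma isWeakDeriv_invDerivL2_iterate (j : ℕ) {g : L2T} (hg : ∫ x in (0 : ℝ)..1, g x = 0) :
    IsWeakDeriv j ((invDerivL2 ^ j) g) g := by
  induction j with
  | zero => intro φ _; simp
  | succ j ih =>
    rw [pow_succ', mul_apply_eq_comp, add_comm]
    exact (isWeakDeriv_invDerivL2 (integral_invDerivL2_iterate j hg)).trans ih

lemma AnalyticSobolev.invDerivL2_iterate {E : Type*} [NormedAddCommGroup E] [NormedSpace ℝ E]
    (j : ℕ) {Φ : E → L2T} (hΦ : ∀ e, AnalyticAt ℝ Φ e)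
    (h0 : ∀ e, ∫ x in (0 : ℝ)..1, Φ e x = 0) :
    AnalyticSobolev j (fun e => (RiccatiTorus.invDerivL2 ^ j) (Φ e)) := by
  induction j with
  | zero => simpa [AnalyticSobolev] using hΦ
  | succ j ih =>
    simp only [pow_succ', mul_apply_eq_comp]
    exact ih.invDerivL2 fun e => integral_invDerivL2_iterate j (h0 e)

lemma Sob.integral_topDeriv {j : ℕ} (q : Sob j) : ∫ x in (0 : ℝ)..1, q.topDeriv x = 0 := by
  have h := q.topDeriv_spec (fun _ => 1) ⟨contDiff_const, fun _ => rfl⟩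
  have h2 : ∫ x in (0 : ℝ)..1, q.toL2 x * iteratedDeriv j (fun _ : ℝ => (1 : ℝ)) x = 0 := by
    cases j with
    | zero => simpa using q.integral_eq_zero
    | succ j => simp [iteratedDeriv_const]
  rw [h2] at h
  simpa using h.symm

/-- The norm of ℋ_j sees only the top derivative. This recovers q from it by a bounded operator, so
the inclusion into L² and the intermediate derivatives are analytic. -/
lemma Sob.toL2_eq {j : ℕ} (q : Sob j) : q.toL2 = (invDerivL2 ^ j) q.topDeriv :=
  q.topDeriv_spec.eq_of_integral_eq (isWeakDeriv_invDerivL2_iterate j q.integral_topDeriv)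
    (by rw [q.integral_eq_zero, integral_invDerivL2_iterate j q.integral_topDeriv])

/-- The top derivative as a continuous linear map. -/
def topDerivL (j : ℕ) : Sob j →L[ℝ] L2T :=
  Sob.topDeriv.mkContinuous 1 fun q => by rw [one_mul, Sob.norm_def]

lemma analyticSobolev_toL2 (j : ℕ) : AnalyticSobolev j (Sob.toL2 : Sob j → L2T) := by
  have : (Sob.toL2 : Sob j → L2T) = fun q => (invDerivL2 ^ j) (topDerivL j q) := by
    funext q; exact q.toL2_eq
  rw [this]
  exact AnalyticSobolev.invDerivL2_iterate j (fun e => (topDerivL j).analyticAt e)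
    fun q => q.integral_topDeriv

/-- Subtraction of the mean value in `L²`. -/
def centerL2 : L2T →L[ℝ] L2T :=
  ContinuousLinearMap.id ℝ L2T - (meanL1.comp inclL1).smulRight (toL2 1)

lemma centerL2_apply (g : L2T) : centerL2 g = g - (∫ x in (0 : ℝ)..1, g x) • toL2 1 := by
  rw [← meanL1_of_ae (coeFn_inclL1 g)]; rfl

lemma integral_centerL2 (g : L2T) : ∫ x in (0 : ℝ)..1, centerL2 g x = 0 := by
  rw [centerL2_apply, sub_eq_add_neg, ← neg_smul, integral_L2T_add, integral_L2T_smul,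
    integral_toL2_one]
  ring

/-- The `j`-fold primitive, from `L²` to `ℋ_j`. -/
def ofTopDeriv (j : ℕ) : L2T →L[ℝ] Sob j :=
  LinearMap.mkContinuous
    -- Centering first defines the map on all of L²; top derivatives have mean zero and are not
    -- affected.
    { toFun := fun g => (⟨(invDerivL2 ^ j) (centerL2 g),
        ⟨_, isWeakDeriv_invDerivL2_iterate j (integral_centerL2 g)⟩,
        integral_invDerivL2_iterate j (integral_centerL2 g)⟩ : sobolev j)
      map_add' := fun g h => Subtype.ext (by simp only [map_add]; rfl)
      map_smul' := fun c g => Subtype.ext (by simp only [map_smul]; rfl) } 1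
    (fun g => by
      rw [one_mul, Sob.norm_def]
      refine le_of_eq_of_le (congrArg norm ?_) (norm_sub_mean_le g)
      rw [← centerL2_apply]
      exact (Sob.topDeriv_spec _).unique
        (isWeakDeriv_invDerivL2_iterate j (integral_centerL2 g)))

lemma toL2_ofTopDeriv (j : ℕ) (g : L2T) :
    (ofTopDeriv j g).toL2 = (invDerivL2 ^ j) (centerL2 g) := rfl

lemma ofTopDeriv_topDeriv {j : ℕ} (q : Sob j) : ofTopDeriv j q.topDeriv = q := by
  refine Sob.toL2_injective ?_
  rw [toL2_ofTopDeriv, centerL2_apply, q.integral_topDeriv, zero_smul, sub_zero, ← q.toL2_eq]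

/-- An analytic family of mean-zero Sobolev functions of order `k` is an analytic map
into `ℋ_k`. -/
lemma AnalyticSobolev.exists_lift {E : Type*} [NormedAddCommGroup E] [NormedSpace ℝ E] {k : ℕ}
    {Φ : E → L2T} (hΦ : AnalyticSobolev k Φ) (h0 : ∀ e, ∫ x in (0 : ℝ)..1, Φ e x = 0) :
    ∃ F : E → Sob k, AnalyticOnNhd ℝ F univ ∧ ∀ e, (F e).toL2 = Φ e := by
  obtain ⟨Φ', h1, h2⟩ := hΦ.exists_isWeakDeriv
  have hF (e : E) : ∃ q : Sob k, q.toL2 = Φ e := ⟨(⟨Φ e, ⟨_, h2 e⟩, h0 e⟩ : sobolev k), rfl⟩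
  choose F hF using hF
  refine ⟨F, fun e _ => ?_, hF⟩
  have : F = fun e => ofTopDeriv k (Φ' e) := by
    funext e
    have h3 : (F e).topDeriv = Φ' e := by
      have h4 := (F e).topDeriv_spec
      rw [hF e] at h4
      exact h4.unique (h2 e)
    rw [← h3, ofTopDeriv_topDeriv]
  rw [this]
  exact AnalyticAt.clm_comp _ (h1 e)

section

/-! ### Regularity for the Riccati map -/

lemma invDeriv_center (f : L1T) : invDeriv (center f) = invDeriv f := by
  have : center (center f) = center f := by
    rw [center_apply (center f), meanL1_center, zero_smul, sub_zero]
  simp [invDeriv, periodicPrimitive, this]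

section Regularity

variable {α β A : ℝ}

/-- `θ` is the function `α q² + u - c₀`. -/
def IsLowerTerm (α β A : ℝ) (q θ : L2T) : Prop :=
  θ =ᵐ[periodMeasure] fun x => lowerTerm α β A q x - meanTerm α β A q

lemma IsLowerTerm.inclL1_eq {q θ : L2T} (h : IsLowerTerm α β A q θ) :
    inclL1 θ = center (lowerL1 α β A q) := by
  refine Lp.ext ?_
  filter_upwards [coeFn_inclL1 θ, h, coeFn_center (lowerL1 α β A q), coeFn_lowerL1 α β A q]
    with x h1 h2 h3 h4
  rw [h1, h2, h3, h4, meanL1_lowerL1]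

lemma IsLowerTerm.integral_eq_zero {q θ : L2T} (h : IsLowerTerm α β A q θ) :
    ∫ x in (0 : ℝ)..1, θ x = 0 := by
  rw [← primitive_inclL1_one, h.inclL1_eq, ← meanL1_eq_primitive, meanL1_center]

lemma IsLowerTerm.riccati_eq {q θ : L2T} (h : IsLowerTerm α β A q θ) :
    riccati α β A q = q + invDerivL2 θ := by
  rw [riccati, ← invDeriv_center, ← h.inclL1_eq]; rfl

lemma IsLowerTerm.isWeakDeriv {q dq θ : L2T} (h : IsLowerTerm α β A q θ)
    (hd : IsWeakDeriv 1 q dq) : IsWeakDeriv 1 (riccati α β A q) (dq + θ) := by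
  rw [h.riccati_eq]
  exact hd.add (isWeakDeriv_invDerivL2 h.integral_eq_zero)

lemma IsLowerTerm.add_ae {q dq θ : L2T} (h : IsLowerTerm α β A q θ) :
    ∀ᵐ x ∂periodMeasure, (dq + θ : L2T) x
      = dq x + lowerTerm α β A q x - meanTerm α β A q := by
  filter_upwards [Lp.coeFn_add dq θ, h] with x h1 h2
  rw [h1, Pi.add_apply, h2]
  ring

variable {E : Type*} [NormedAddCommGroup E] [NormedSpace ℝ E] {k : ℕ} {Φ : E → L2T}

/-- The regularity of q² is a separate hypothesis because at the first step of the bootstrap q is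
known to be continuous but not yet weakly differentiable. The term u is one order smoother than q
anyway. -/
lemma AnalyticSobolev.exists_isLowerTerm_of_sq (hΦ : AnalyticSobolev k Φ)
    (h0 : ∀ e, ∫ x in (0 : ℝ)..1, Φ e x = 0) {R : E → (ℝ →ᵇ ℝ)} (hR : ∀ e, Φ e = toL2 (R e))
    (hsq : AnalyticSobolev k (fun e => mulBL2 (R e) (Φ e))) :
    ∃ Θ : E → L2T, AnalyticSobolev k Θ ∧ ∀ e, IsLowerTerm α β A (Φ e) (Θ e) := by
  refine ⟨fun e => α • mulBL2 (R e) (Φ e) + toL2 (RiccatiTorus.expTerm β A (Φ e))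
    + (-meanL1 (lowerL1 α β A (Φ e))) • toL2 1,
    ((hsq.const_smul α).add (hΦ.expTerm β A h0).of_succ).add (AnalyticSobolev.smul_one k fun e => ?_),
    fun e => ?_⟩
  · exact AnalyticAt.clm_comp (-meanL1) (AnalyticAt.comp (g := lowerL1 α β A)
      (analyticAt_lowerL1 α β A (Φ e)) (hΦ.analyticAt e))
  · have hRae : R e =ᵐ[periodMeasure] Φ e := by rw [hR e]; exact (coeFn_toL2 _).symm
    filter_upwards [coeFn_mulBL2 (R e) (Φ e), hRae, coeFn_toL2 (RiccatiTorus.expTerm β A (Φ e)),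
      Lp.coeFn_add (α • mulBL2 (R e) (Φ e) + toL2 (RiccatiTorus.expTerm β A (Φ e)))
        ((-meanL1 (lowerL1 α β A (Φ e))) • toL2 1),
      Lp.coeFn_add (α • mulBL2 (R e) (Φ e)) (toL2 (RiccatiTorus.expTerm β A (Φ e))),
      Lp.coeFn_smul α (mulBL2 (R e) (Φ e)),
      Lp.coeFn_smul (-meanL1 (lowerL1 α β A (Φ e))) (toL2 1), coeFn_toL2 1, ae_Icc]
      with x h1 h2 h3 h4 h5 h6 h7 h8 hx
    rw [h4, Pi.add_apply, h5, Pi.add_apply, h6, h7, Pi.smul_apply, Pi.smul_apply, h1, h2, h3, h8,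
      meanL1_lowerL1, lowerTerm, expTerm_apply, primitive_inclL1_eq_primQ _ hx]
    simp only [smul_eq_mul, BoundedContinuousFunction.coe_one, Pi.one_apply]
    ring

lemma AnalyticSobolev.exists_isLowerTerm (hΦ : AnalyticSobolev (k + 1) Φ)
    (h0 : ∀ e, ∫ x in (0 : ℝ)..1, Φ e x = 0) :
    ∃ Θ : E → L2T, AnalyticSobolev (k + 1) Θ ∧ ∀ e, IsLowerTerm α β A (Φ e) (Θ e) := by
  obtain ⟨R, -, hR⟩ := hΦ.exists_continuous
  refine hΦ.exists_isLowerTerm_of_sq h0 hR (hΦ.mul_succ hΦ fun e => ?_)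
  have hRae : R e =ᵐ[periodMeasure] Φ e := by rw [hR e]; exact (coeFn_toL2 _).symm
  filter_upwards [coeFn_mulBL2 (R e) (Φ e), hRae] with x h1 h2
  rw [h1, h2]

/-- Bootstrap: q = F(q) - D⁻¹θ, and D⁻¹ gains one derivative over θ = αq² + u - c₀. -/
lemma AnalyticSobolev.succ_of_riccati {Θ : E → L2T} (hΘ : AnalyticSobolev k Θ)
    (hlow : ∀ e, IsLowerTerm α β A (Φ e) (Θ e))
    (hF : AnalyticSobolev (k + 1) (fun e => riccati α β A (Φ e))) : AnalyticSobolev (k + 1) Φ := by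
  have h := hF.add (hΘ.invDerivL2 fun e => (hlow e).integral_eq_zero).neg
  refine cast (congrArg (AnalyticSobolev (k + 1)) ?_) h
  funext e
  rw [(hlow e).riccati_eq]
  abel

/-- Regularity: if the image of an analytic family under the Riccati map is an analytic family
of Sobolev functions of order `k`, then so is the family itself. -/
lemma AnalyticSobolev.of_riccati (h0 : ∀ e, ∫ x in (0 : ℝ)..1, Φ e x = 0)
    (hΦ : ∀ e, AnalyticAt ℝ Φ e)
    (hF : AnalyticSobolev k (fun e => riccati α β A (Φ e))) : AnalyticSobolev k Φ := by
  induction k with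
  | zero => exact hΦ
  | succ k ih =>
    cases k with
    | zero =>
      -- From L² to order one: q² is a priori only in L¹, but D⁻¹ maps L¹ to continuous functions
      -- and F(q) is continuous. So q is continuous, q² is in L², and the bootstrap can start.
      obtain ⟨R, hR, hRΦ⟩ := hF.exists_continuous
      set S : E → (ℝ →ᵇ ℝ) := fun e => R e - periodicPrimitive (lowerL1 α β A (Φ e))
      have hS (e : E) : AnalyticAt ℝ S e := (hR e).sub (AnalyticAt.clm_comp _
        (AnalyticAt.comp (g := lowerL1 α β A) (analyticAt_lowerL1 α β A (Φ e)) (hΦ e)))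
      have hSΦ (e : E) : Φ e = toL2 (S e) := by
        rw [map_sub, ← hRΦ e, riccati]
        exact (add_sub_cancel_right _ _).symm
      obtain ⟨Θ, hΘ, hlow⟩ := AnalyticSobolev.exists_isLowerTerm_of_sq (k := 0) (α := α) (β := β)
        (A := A) hΦ h0 hSΦ fun e => AnalyticAt.clm_apply₂ mulBL2 (hS e) (hΦ e)
      exact hΘ.succ_of_riccati hlow hF
    | succ k =>
      obtain ⟨Θ, hΘ, hlow⟩ := (ih hF.of_succ).exists_isLowerTerm (α := α) (β := β) (A := A) h0
      exact hΘ.succ_of_riccati hlow hF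

end Regularity

/-! ### The Riccati map on `ℋ_j`, `j ≥ 1` -/

variable {α β A : ℝ}

/-- If `p` has a weak derivative, then it is in the range of the Riccati map. -/
lemma invDerivL2_mem_range_riccati (hα : 0 ≤ α) (hβ : 0 ≤ β) (hA : 0 ≤ A) {f : L2T}
    (hf : ∫ x in (0 : ℝ)..1, f x = 0) : invDerivL2 f ∈ range (riccati α β A) := by
  refine mem_range_riccati_of_bound α β A hα hβ hA _ ‖f‖ fun t ht q hq => ?_
  have hp : IsWeakDeriv 1 (riccati α β A q) (t • f) := by
    rw [hq]; exact (isWeakDeriv_invDerivL2 hf).smul t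
  have hq0 : ∫ x in (0 : ℝ)..1, q x = 0 := by
    rw [← integral_riccati α β A, hq, integral_L2T_smul, integral_invDerivL2, mul_zero]
  -- A single function is treated as a constant family, so that the parametric regularity result
  -- applies.
  have hreg : AnalyticSobolev 1 (fun _ : ℝ => q) := by
    refine AnalyticSobolev.of_riccati (α := α) (β := β) (A := A) (fun _ => hq0)
      (fun _ => analyticAt_const) ?_
    exact ⟨fun _ => analyticAt_const, fun _ => t • f, fun _ => analyticAt_const, fun _ => hp⟩
  obtain ⟨Θ, -, hlow⟩ := hreg.exists_isLowerTerm (α := α) (β := β) (A := A) fun _ => hq0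
  obtain ⟨-, Φ', -, hd⟩ := hreg
  have hp2 : t • f = Φ' 0 + Θ 0 := hp.unique ((hlow 0).isWeakDeriv (hd 0))
  have h1 := (norm_sq_riccati_bounds hα hβ hA hq0 (hd 0) (hlow 0).add_ae).1
  rw [← hp2] at h1
  have h2 : ‖Φ' 0‖ ≤ ‖t • f‖ := le_of_sq_le_sq h1 (norm_nonneg _)
  rw [norm_smul, Real.norm_eq_abs, abs_of_nonneg ht.1] at h2
  have h3 : ‖q‖ ≤ ‖Φ' 0‖ :=
    (congrArg norm ((hd 0).eq_invDerivL2 hq0)).trans_le (norm_invDeriv_inclL1_le _)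
  have h4 := mul_le_mul_of_nonneg_right ht.2 (norm_nonneg f)
  linarith

/-- P is the weak derivative of F. Its inverse is D⁻¹ followed by the inverse of F, and regularity
places the values of that inverse in ℋ_{j+1} analytically. -/
theorem exists_riccatiMap (hα : 0 ≤ α) (hβ : 0 ≤ β) (hA : 0 ≤ A) (j : ℕ) :
    ∃ P : Sob (j + 1) → Sob j, IsRiccatiMap α β A P ∧ IsRealAnalyticIso P ∧
      ∀ (q : Sob (j + 1)) (dq : L2T), IsWeakDeriv 1 q.toL2 dq →
        ‖dq‖ ^ 2 ≤ ‖(P q).toL2‖ ^ 2 ∧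
        ‖(P q).toL2‖ ^ 2 ≤ ‖dq‖ ^ 2 + 2 * α ^ 2 * ‖q.toL2‖ ^ 3 * ‖dq‖
          + A * (β + α) * (2 + β * A) * ‖q.toL2‖ ^ 2 * Real.exp (2 * β * ‖q.toL2‖) := by
  have hS := analyticSobolev_toL2 (j + 1)
  obtain ⟨Θ, hΘ, hlow⟩ := hS.exists_isLowerTerm (α := α) (β := β) (A := A)
    fun q => q.integral_eq_zero
  obtain ⟨-, D, hD, hd⟩ := hS
  obtain ⟨P, hP, hPeq⟩ := (hD.add hΘ.of_succ).exists_lift fun q => by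
    rw [integral_L2T_add, (hd q).integral_eq_zero, (hlow q).integral_eq_zero, add_zero]
  have hPd (q : Sob (j + 1)) : IsWeakDeriv 1 (riccati α β A q.toL2) (P q).toL2 := by
    rw [hPeq]; exact (hlow q).isWeakDeriv (hd q)
  have hPae (q : Sob (j + 1)) : ∀ᵐ x ∂periodMeasure, (P q).toL2 x
      = D q x + lowerTerm α β A q.toL2 x - meanTerm α β A q.toL2 := by
    rw [hPeq]; exact (hlow q).add_ae
  refine ⟨P, fun q => ⟨D q, hd q, hPae q⟩, ⟨hP, ?_⟩, fun q dq hq => ?_⟩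
  · set p : Sob j → L2T := fun f => invDerivL2 f.toL2 with hp
    have hpS : AnalyticSobolev (j + 1) p :=
      (analyticSobolev_toL2 j).invDerivL2 fun f => f.integral_eq_zero
    have hmem (f : Sob j) : p f ∈ range (riccati α β A) :=
      invDerivL2_mem_range_riccati hα hβ hA f.integral_eq_zero
    have hinv (f : Sob j) : riccati α β A (riccatiInv α β A (p f)) = p f :=
      riccati_riccatiInv α β A (hmem f)
    have h0 (f : Sob j) : ∫ x in (0 : ℝ)..1, riccatiInv α β A (p f) x = 0 := by
      rw [← integral_riccati α β A, hinv, integral_invDerivL2]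
    have hΨ : AnalyticSobolev (j + 1) (fun f => riccatiInv α β A (p f)) := by
      refine AnalyticSobolev.of_riccati (α := α) (β := β) (A := A) h0 (fun f => ?_) ?_
      · exact AnalyticAt.comp (g := riccatiInv α β A)
          (analyticAt_riccatiInv α β A hβ hA (hmem f)) (hpS.analyticAt f)
      · simp only [hinv]
        exact hpS
    obtain ⟨G, hG, hGeq⟩ := hΨ.exists_lift h0
    refine ⟨G, fun q => Sob.toL2_injective ?_, fun f => Sob.toL2_injective ?_, hG⟩
    · have h1 : p (P q) = riccati α β A q.toL2 :=
        ((hPd q).eq_invDerivL2 (by rw [integral_riccati, q.integral_eq_zero])).symm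
      rw [hGeq, h1, riccatiInv_riccati α β A hβ hA]
    · have h1 := hPd (G f)
      rw [hGeq, hinv] at h1
      exact h1.unique (isWeakDeriv_invDerivL2 f.integral_eq_zero)
  · rw [hq.unique (hd q)]
    exact norm_sq_riccati_bounds hα hβ hA q.integral_eq_zero (hd q) (hPae q)

/-! ### The Riccati map on `ℋ₀` -/

/-- The derivative, as an isometry from `ℋ₀` to `ℋ₋₁`. -/
def SobNeg.ofPrimitive : Sob 0 →L[ℝ] SobNeg :=
  SobNeg.primitive.symm.toLinearMap.mkContinuous 1 fun q => by
    rw [one_mul, SobNeg.norm_def]; simp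

lemma SobNeg.primitive_ofPrimitive (q : Sob 0) : (SobNeg.ofPrimitive q).primitive = q :=
  SobNeg.primitive.apply_symm_apply q

/-- The inverse of the derivative, as an isometry from `ℋ₋₁` to `ℋ₀`. -/
def SobNeg.primitiveL : SobNeg →L[ℝ] Sob 0 :=
  SobNeg.primitive.toLinearMap.mkContinuous 1 fun q => by
    rw [one_mul, SobNeg.norm_def]; simp

lemma Sob.norm_eq_norm_toL2 (q : Sob 0) : ‖q‖ = ‖q.toL2‖ := by
  rw [Sob.norm_def, q.toL2_eq]; simp

lemma neg_integral_riccati_mul_deriv (q : L2T) (φ : TestFn) :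
    -∫ x in (0 : ℝ)..1, riccati α β A q x * deriv (φ : ℝ → ℝ) x
      = -(∫ x in (0 : ℝ)..1, q x * deriv (φ : ℝ → ℝ) x)
        + ∫ x in (0 : ℝ)..1, (lowerTerm α β A q x - meanTerm α β A q) * (φ : ℝ → ℝ) x := by
  have hc : Continuous (deriv (φ : ℝ → ℝ)) := (TestFn.deriv_mem φ.2).1.continuous
  set N := lowerL1 α β A q
  set k := meanL1 (toL1 (primitive (center N)))
  have h1 : ∫ x in (0 : ℝ)..1, invDeriv N x * deriv (φ : ℝ → ℝ) x
      = ∫ x in (0 : ℝ)..1, (primitive (center N) x * deriv (φ : ℝ → ℝ) x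
        - k * deriv (φ : ℝ → ℝ) x) := by
    refine integral_period_congr ?_
    filter_upwards [coeFn_invDeriv N] with x hx
    rw [hx, periodicPrimitive_apply]
    ring
  have h2 : ∫ x in (0 : ℝ)..1, deriv (φ : ℝ → ℝ) x = 0 := by
    rw [intervalIntegral.integral_deriv_eq_sub
      (fun x _ => φ.2.1.differentiable (by simp) x) (hc.intervalIntegrable _ _)]
    have := φ.2.2 0
    rw [zero_add] at this
    rw [this, sub_self]
  have h3 : ∫ x in (0 : ℝ)..1, center N x * (φ : ℝ → ℝ) x
      = ∫ x in (0 : ℝ)..1, (lowerTerm α β A q x - meanTerm α β A q) * (φ : ℝ → ℝ) x := by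
    refine integral_period_congr ?_
    filter_upwards [coeFn_center N, coeFn_lowerL1 α β A q] with x h4 h5
    rw [h4, h5, meanL1_lowerL1]
  have h4 : IntervalIntegrable (fun x => primitive (center N) x * deriv (φ : ℝ → ℝ) x)
      volume 0 1 := ((primitive (center N)).continuous.mul hc).intervalIntegrable _ _
  rw [riccati, integral_add_mul _ _ hc, h1, intervalIntegral.integral_sub h4
    ((hc.intervalIntegrable _ _).const_mul _), intervalIntegral.integral_const_mul, h2,
    integral_primitive_mul_deriv _ φ.2, ← meanL1_eq_primitive, meanL1_center, h3]
  ring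

/-- Since g ↦ g' is an isometry of ℋ₀ onto ℋ₋₁, all claims are claims about F on mean-zero functions
in L², a class which F preserves. For α = 1 the bound for q in terms of F(q) feeds the continuity
method. -/
theorem exists_singularRiccatiMap (hα : 0 ≤ α) (hβ : 0 ≤ β) (hA : 0 ≤ A) :
    ∃ P : Sob 0 → SobNeg,
      IsSingularRiccatiMap α β A P ∧ AnalyticOnNhd ℝ P univ ∧ Function.Injective P ∧
      (∀ q : Sob 0,
        ‖P q‖ ≤ ‖q.toL2‖ * (3 + 2 * α * ‖q.toL2‖ + β * A * Real.exp (β * ‖q.toL2‖))) ∧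
      (α = 1 →
        IsRealAnalyticIso P ∧
        ∀ q : Sob 0, ‖q.toL2‖ ^ 2 ≤ 2 * ‖P q‖ ^ 2 * (1 + 2 * ‖P q‖ ^ 2)) := by
  have hS := analyticSobolev_toL2 0
  have hF : AnalyticSobolev 0 (fun q : Sob 0 => riccati α β A q.toL2) := fun q =>
    AnalyticAt.comp (g := riccati α β A) (analyticAt_riccati α β A q.toL2) (hS q)
  obtain ⟨F, hFan, hFeq⟩ := hF.exists_lift fun q => by
    rw [integral_riccati, q.integral_eq_zero]
  have hPan : AnalyticOnNhd ℝ (fun q => SobNeg.ofPrimitive (F q)) univ := fun q hq =>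
    AnalyticAt.clm_comp SobNeg.ofPrimitive (hFan q hq)
  have hnorm (q : Sob 0) : ‖SobNeg.ofPrimitive (F q)‖ = ‖riccati α β A q.toL2‖ := by
    rw [SobNeg.norm_def, SobNeg.primitive_ofPrimitive, Sob.norm_eq_norm_toL2, hFeq]
  have hinj : Function.Injective fun q => SobNeg.ofPrimitive (F q) := by
    intro q r h
    have h1 := congrArg (fun f => (SobNeg.primitive f).toL2) h
    simp only [SobNeg.primitive_ofPrimitive, hFeq] at h1
    exact Sob.toL2_injective (riccati_injective α β A hβ hA h1)
  refine ⟨fun q => SobNeg.ofPrimitive (F q), fun q φ => ?_, hPan, hinj, fun q => ?_, ?_⟩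
  · rw [← SobNeg.distribDeriv_primitive, SobNeg.primitive_ofPrimitive,
      ← neg_integral_riccati_mul_deriv, ← hFeq]
    rfl
  · rw [hnorm]
    exact norm_riccati_le hα hβ hA q.toL2
  · rintro rfl
    refine ⟨⟨hPan, ?_⟩, fun q => ?_⟩
    · have hmem (f : SobNeg) : f.primitive.toL2 ∈ range (riccati 1 β A) := by
        set p := f.primitive.toL2
        refine mem_range_riccati_of_bound 1 β A hα hβ hA p
          -- The a priori bound increases with ‖F(q)‖ = t‖p‖ ≤ ‖p‖, so its value at p serves the
          -- whole segment.
          (Real.sqrt (2 * ‖p‖ ^ 2 * (1 + 2 * ‖p‖ ^ 2))) fun t ht q hq => ?_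
        have hq0 : ∫ x in (0 : ℝ)..1, q x = 0 := by
          rw [← integral_riccati 1 β A, hq, integral_L2T_smul, f.primitive.integral_eq_zero,
            mul_zero]
        have h1 := norm_sq_le_of_riccati hβ hA hq0
        have h2 : ‖riccati 1 β A q‖ ≤ ‖p‖ := by
          rw [hq, norm_smul, Real.norm_eq_abs, abs_of_nonneg ht.1]
          exact mul_le_of_le_one_left (norm_nonneg _) ht.2
        refine Real.le_sqrt_of_sq_le (h1.trans ?_)
        gcongr
      have hinv (f : SobNeg) :
          riccati 1 β A (riccatiInv 1 β A f.primitive.toL2) = f.primitive.toL2 :=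
        riccati_riccatiInv 1 β A (hmem f)
      have hΨ : AnalyticSobolev 0 (fun f : SobNeg => riccatiInv 1 β A f.primitive.toL2) := by
        intro f
        have h1 : AnalyticAt ℝ (fun f : SobNeg => f.primitive.toL2) f :=
          AnalyticAt.comp (g := Sob.toL2) (hS f.primitive) (SobNeg.primitiveL.analyticAt f)
        exact AnalyticAt.comp (g := riccatiInv 1 β A)
          (analyticAt_riccatiInv 1 β A hβ hA (hmem f)) h1
      obtain ⟨G, hG, hGeq⟩ := hΨ.exists_lift fun f => by
        rw [← integral_riccati 1 β A, hinv, f.primitive.integral_eq_zero]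
      refine ⟨G, fun q => Sob.toL2_injective ?_, fun f => ?_, hG⟩
      · rw [hGeq, SobNeg.primitive_ofPrimitive, hFeq, riccatiInv_riccati 1 β A hβ hA]
      · refine SobNeg.primitive.injective (Sob.toL2_injective ?_)
        rw [SobNeg.primitive_ofPrimitive, hFeq, hGeq, hinv]
    · rw [hnorm]
      exact norm_sq_le_of_riccati hβ hA q.integral_eq_zero

end

end

end RiccatiTorus

theorem theorem2p3 (α β A : ℝ) (hα : 0 < α) (hβ : 0 < β) (hA : 0 ≤ A) :
    (∀ j : ℕ, ∃ P : Sob (j + 1) → Sob j,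
      IsRiccatiMap α β A P ∧ IsRealAnalyticIso P ∧
      ∀ (q : Sob (j + 1)) (dq : L2T), IsWeakDeriv 1 q.toL2 dq →
        ‖dq‖ ^ 2 ≤ ‖(P q).toL2‖ ^ 2 ∧
        ‖(P q).toL2‖ ^ 2 ≤ ‖dq‖ ^ 2 + 2 * α ^ 2 * ‖q.toL2‖ ^ 3 * ‖dq‖
          + A * (β + α) * (2 + β * A) * ‖q.toL2‖ ^ 2 * Real.exp (2 * β * ‖q.toL2‖)) ∧
    (∃ P : Sob 0 → SobNeg,
      IsSingularRiccatiMap α β A P ∧ AnalyticOnNhd ℝ P univ ∧ Function.Injective P ∧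
      (∀ q : Sob 0,
        ‖P q‖ ≤ ‖q.toL2‖ * (3 + 2 * α * ‖q.toL2‖ + β * A * Real.exp (β * ‖q.toL2‖))) ∧
      (α = 1 → β = 4 →
        IsRealAnalyticIso P ∧
        ∀ q : Sob 0, ‖q.toL2‖ ^ 2 ≤ 2 * ‖P q‖ ^ 2 * (1 + 2 * ‖P q‖ ^ 2))) := by
  refine ⟨exists_riccatiMap hα.le hβ.le hA, ?_⟩
  obtain ⟨P, h1, h2, h3, h4, h5⟩ := exists_singularRiccatiMap hα.le hβ.le hA
  exact ⟨P, h1, h2, h3, h4, fun hα1 _ => h5 hα1⟩
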